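/- \textbf{Setting.} All vector spaces are complex, $\otimes$ between $C^*$-algebras is the spatial (minimal) tensor product, and $\odot$ is the algebraic one. A \emph{$C^*$-hyperbialgebra} $(\mathsf A,\Delta,\epsilon)$ is a unital $C^*$-algebra $\mathsf A$ with a unital completely positive map $\Delta:\mathsf A\to\mathsf A\otimes\mathsf A$ and a character $\epsilon:\mathsf A\to\mathbb C$ such that $(\Delta\otimes\mathrm{id})\circ\Delta=(\mathrm{id}\otimes\Delta)\circ\Delta$ and $(\epsilon\otimes\mathrm{id})\circ\Delta=(\mathrm{id}\otimes\epsilon)\circ\Delta=\mathrm{id}_{\mathsf A}$. Let $\mathsf k$ be a Hilbert space. For an interval $I\subseteq\mathbb R_+$ let $\mathcal F_I$ be the symmetric Fock space over $L^2(I;\mathsf k)$, with exponential vectors $\varepsilon(f)$, and put $\mathcal F=\mathcal F_{\mathbb R_+}$; let $\mathbb S=\mathrm{Lin}\{d_{[0,s[}:d\in\mathsf k,\ s\ge 0\}$, $\mathcal E=\mathrm{Lin}\{\varepsilon(f):f\in\mathbb S\}$ and $\mathcal E_{[0,t[}=\mathrm{Lin}\{\varepsilon(f|_{[0,t[}):f\in\mathbb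 S\}\subseteq\mathcal F_{[0,t[}$. Identify $\mathcal F=\mathcal F_{[0,t[}\otimes\mathcal F_{[t,\infty[}$, and let $\sigma=(\sigma_s)_{s\ge0}$ be the CCR flow on $B(\mathcal F)$: $\sigma_s(X)=I_{[0,s[}\otimes X'$, where $X'\in B(\mathcal F_{[s,\infty[})$ is the conjugate of $X$ by the second quantised shift $\mathcal F\to\mathcal F_{[s,\infty[}$. A \emph{completely bounded process} on a unital $C^*$-algebra $\mathsf A$ is a family $l=(l_t)_{t\ge0}$ of completely bounded linear maps $l_t:\mathsf A\to B(\mathcal F)$ such that, for each $a\in\mathsf A$, $t\mapsto l_t(a)\xi$ is weakly measurable for all $\xi\in\mathcal E$, and $l(a)$ is adapted: for each $t$ there is a linear map $X(t):\mathcal E_{[0,t[}\to\mathcal F_{[0,t[}$ with $l_t(a)\varepsilon(f)=X(t)\varepsilon(f|_{[0,t[})\otimes\varepsilon(f|_{[t,\infty[})$ for $f\in\mathbb S$. If $\mathsf A$ carries $(\Delta,\epsilon)$, then $l$ has the \emph{convolution increment property} if $l_{s+t}=(l_s\otimes(\sigma_s\circ l_t))\circ\Delta$ for all $s,t\ge0$,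 and $l$ is a \emph{QS convolution cocycle} on $\mathsf A$ if moreover $l_0(a)=\epsilon(a)I_{\mathcal F}$ for all $a\in\mathsf A$. \textbf{Statement.} Let $(\mathsf A,\Delta,\epsilon)$ be a $C^*$-hyperbialgebra, let $\widetilde{\mathsf A}\subseteq\mathsf A$ be a unital $C^*$-subalgebra, and let $P$ be a conditional expectation, that is, a norm-one projection, from $\mathsf A$ onto $\widetilde{\mathsf A}$ such that \[(P\otimes\mathrm{id}_{\mathsf A})\circ\Delta\circ P=(P\otimes P)\circ\Delta=(\mathrm{id}_{\mathsf A}\otimes P)\circ\Delta .\] Put $\widetilde\Delta=(P\otimes P)\circ\Delta|_{\widetilde{\mathsf A}}$ and $\widetilde\epsilon=\epsilon|_{\widetilde{\mathsf A}}$. Then $(\widetilde{\mathsf A},\widetilde\Delta,\widetilde\epsilon)$ is a $C^*$-hyperbialgebra, and $\widetilde l\mapsto(\widetilde l_t\circ P)_{t\ge0}$ is a bijection from the set of QS convolution cocycles $\widetilde l$ on $\widetilde{\mathsf A}$ (with noise dimension space $\mathsf k$) onto the set of completely bounded processes $l$ on $\mathsf A$ that are $P$-invariant ($l_t\circ P=l_t$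 for all $t\geq 0$), have the convolution increment property, and satisfy $l_0(a)=\epsilon(P(a))I_{\mathcal F}$ for all $a\in\mathsf A$. Its inverse is the restriction $l\mapsto(l_t|_{\widetilde{\mathsf A}})_{t\ge0}$. -/

import Mathlib

open scoped TensorProduct NNReal InnerProductSpace
open MeasureTheory

noncomputable section

/-! ## Hilbert space tensor products -/

section HilbertTensor

/-- The Hilbert space tensor product: the completion of the algebraic tensor product. -/
def HilbertTensor (H K : Type*) [NormedAddCommGroup H] [InnerProductSpace ℂ H]
    [NormedAddCommGroup K] [InnerProductSpace ℂ K] :=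
  UniformSpace.Completion (H ⊗[ℂ] K)

variable {H H' K K' : Type*} [NormedAddCommGroup H] [InnerProductSpace ℂ H]
  [NormedAddCommGroup K] [InnerProductSpace ℂ K]
  [NormedAddCommGroup H'] [InnerProductSpace ℂ H']
  [NormedAddCommGroup K'] [InnerProductSpace ℂ K']

instance : NormedAddCommGroup (HilbertTensor H K) :=
  inferInstanceAs (NormedAddCommGroup (UniformSpace.Completion (H ⊗[ℂ] K)))

instance : InnerProductSpace ℂ (HilbertTensor H K) :=
  inferInstanceAs (InnerProductSpace ℂ (UniformSpace.Completion (H ⊗[ℂ] K)))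

instance : CompleteSpace (HilbertTensor H K) :=
  inferInstanceAs (CompleteSpace (UniformSpace.Completion (H ⊗[ℂ] K)))

/-- The isometric embedding of the algebraic tensor product. -/
def HilbertTensor.ofAlg : H ⊗[ℂ] K →ₗᵢ[ℂ] HilbertTensor H K :=
  (UniformSpace.Completion.toComplₗᵢ : H ⊗[ℂ] K →ₗᵢ[ℂ] UniformSpace.Completion (H ⊗[ℂ] K))

theorem HilbertTensor.denseRange_ofAlg :
    DenseRange (HilbertTensor.ofAlg : H ⊗[ℂ] K → HilbertTensor H K) :=
  UniformSpace.Completion.denseRange_coe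

/-- The elementary tensor `x ⊗ y` in the Hilbert space tensor product. -/
def hTmul (x : H) (y : K) : HilbertTensor H K := HilbertTensor.ofAlg (x ⊗ₜ[ℂ] y)

/-- The tensor product `T ⊗ S` of bounded operators. -/
def opTensor (T : H →L[ℂ] H') (S : K →L[ℂ] K') : HilbertTensor H K →L[ℂ] HilbertTensor H' K' :=
  ((TensorProduct.mapL T S).completion :
    UniformSpace.Completion (H ⊗[ℂ] K) →L[ℂ] UniformSpace.Completion (H' ⊗[ℂ] K'))

theorem opTensor_ofAlg (T : H →L[ℂ] H') (S : K →L[ℂ] K') (x : H ⊗[ℂ] K) :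
    opTensor T S (HilbertTensor.ofAlg x) = HilbertTensor.ofAlg (TensorProduct.mapL T S x) :=
  ContinuousLinearMap.completion_apply_coe _ _

theorem inner_hTmul (x x' : H) (y y' : K) :
    ⟪hTmul x y, hTmul x' y'⟫_ℂ = ⟪x, x'⟫_ℂ * ⟪y, y'⟫_ℂ := by
  simp [hTmul]

theorem opTensor_hTmul (T : H →L[ℂ] H') (S : K →L[ℂ] K') (x : H) (y : K) :
    opTensor T S (hTmul x y) = hTmul (T x) (S y) := by
  simp [hTmul, opTensor_ofAlg]

/-- Two bounded operators that agree on algebraic tensors are equal. -/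
theorem HilbertTensor.clm_ext {f g : HilbertTensor H K →L[ℂ] HilbertTensor H' K'}
    (h : ∀ x : H ⊗[ℂ] K, f (HilbertTensor.ofAlg x) = g (HilbertTensor.ofAlg x)) : f = g := by
  ext x
  exact HilbertTensor.denseRange_ofAlg.induction_on (p := fun x => f x = g x) x
    (isClosed_eq f.continuous g.continuous) h

theorem opTensor_add_left (T T' : H →L[ℂ] H') (S : K →L[ℂ] K') :
    opTensor (T + T') S = opTensor T S + opTensor T' S :=
  HilbertTensor.clm_ext fun x => by
    simp [opTensor_ofAlg, TensorProduct.mapL_add_left, -TensorProduct.mapL_apply]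

theorem opTensor_add_right (T : H →L[ℂ] H') (S S' : K →L[ℂ] K') :
    opTensor T (S + S') = opTensor T S + opTensor T S' :=
  HilbertTensor.clm_ext fun x => by
    simp [opTensor_ofAlg, TensorProduct.mapL_add_right, -TensorProduct.mapL_apply]

theorem opTensor_smul_left (c : ℂ) (T : H →L[ℂ] H') (S : K →L[ℂ] K') :
    opTensor (c • T) S = c • opTensor T S :=
  HilbertTensor.clm_ext fun x => by
    simp [opTensor_ofAlg, TensorProduct.mapL_smul_left, -TensorProduct.mapL_apply]

theorem opTensor_smul_right (c : ℂ) (T : H →L[ℂ] H') (S : K →L[ℂ] K') :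
    opTensor T (c • S) = c • opTensor T S :=
  HilbertTensor.clm_ext fun x => by
    simp [opTensor_ofAlg, TensorProduct.mapL_smul_right, -TensorProduct.mapL_apply]

/-- If `v` has dense span in `H` and `w` has dense span in `K`, then the vectors `v i ⊗ w j` have
dense span in the Hilbert space tensor product. -/
theorem hTmul_total {ι κ : Type*} {v : ι → H} {w : κ → K}
    (hv : (Submodule.span ℂ (Set.range v)).topologicalClosure = ⊤)
    (hw : (Submodule.span ℂ (Set.range w)).topologicalClosure = ⊤) :
    (Submodule.span ℂ (Set.range fun p : ι × κ => hTmul (v p.1) (w p.2))).topologicalClosure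
      = ⊤ := by
  set S := (Submodule.span ℂ (Set.range fun p : ι × κ => hTmul (v p.1) (w p.2))).topologicalClosure
    with hS
  have hclosed : IsClosed (S : Set (HilbertTensor H K)) := Submodule.isClosed_topologicalClosure _
  let L (x : H) : K →L[ℂ] HilbertTensor H K :=
    HilbertTensor.ofAlg.toContinuousLinearMap.comp (TensorProduct.mkL ℂ H K x)
  let R (y : K) : H →L[ℂ] HilbertTensor H K :=
    HilbertTensor.ofAlg.toContinuousLinearMap.comp ((TensorProduct.mkL ℂ H K).flip y)
  have hL : ∀ x y, L x y = hTmul x y := fun x y => rfl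
  have hR : ∀ x y, R y x = hTmul x y := fun x y => rfl
  have h1 : ∀ i (y : K), hTmul (v i) y ∈ S := by
    intro i
    have : (⊤ : Submodule ℂ K) ≤ S.comap (L (v i)).toLinearMap := by
      rw [← hw]
      refine Submodule.topologicalClosure_minimal _ ?_ (hclosed.preimage (L (v i)).continuous)
      rw [Submodule.span_le]
      rintro _ ⟨j, rfl⟩
      exact Submodule.le_topologicalClosure _ (Submodule.subset_span ⟨(i, j), rfl⟩)
    intro y
    exact this (Submodule.mem_top (x := y))
  have h2 : ∀ (x : H) (y : K), hTmul x y ∈ S := by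
    intro x y
    have : (⊤ : Submodule ℂ H) ≤ S.comap (R y).toLinearMap := by
      rw [← hv]
      refine Submodule.topologicalClosure_minimal _ ?_ (hclosed.preimage (R y).continuous)
      rw [Submodule.span_le]
      rintro _ ⟨i, rfl⟩
      exact h1 i y
    exact this (Submodule.mem_top (x := x))
  rw [eq_top_iff]
  rintro x -
  refine HilbertTensor.denseRange_ofAlg.induction_on (p := fun x => x ∈ S) x hclosed fun x => ?_
  induction x using TensorProduct.induction_on with
  | zero => rw [map_zero]; exact S.zero_mem
  | tmul x y => exact h2 x y
  | add x y hx hy => rw [map_add]; exact S.add_mem hx hy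

/-- Two families with the same Gram matrix, the first of which has dense span, are related by a
linear isometry. -/
theorem exists_isometry_of_gram {ι : Type*} [CompleteSpace K] {v : ι → H} {w : ι → K}
    (hv : (Submodule.span ℂ (Set.range v)).topologicalClosure = ⊤)
    (h : ∀ i j, ⟪w i, w j⟫_ℂ = ⟪v i, v j⟫_ℂ) : ∃ V : H →ₗᵢ[ℂ] K, ∀ i, V (v i) = w i := by
  let e : (ι →₀ ℂ) →ₗ[ℂ] H := Finsupp.linearCombination ℂ v
  let f : (ι →₀ ℂ) →ₗ[ℂ] K := Finsupp.linearCombination ℂ w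
  have hd : DenseRange e := by
    have : (Set.range e) = (Submodule.span ℂ (Set.range v) : Set H) := by
      rw [← Finsupp.range_linearCombination]; rfl
    rw [DenseRange, this]
    exact (Submodule.dense_iff_topologicalClosure_eq_top).2 hv
  have hn : ∀ x, ‖f x‖ = ‖e x‖ := by
    intro x
    have : ⟪f x, f x⟫_ℂ = ⟪e x, e x⟫_ℂ := by
      simp only [e, f, Finsupp.linearCombination_apply, Finsupp.sum, sum_inner, inner_sum,
        inner_smul_left, inner_smul_right, h]
    rw [@norm_eq_sqrt_re_inner ℂ, @norm_eq_sqrt_re_inner ℂ, this]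
  have hb : ∃ C, ∀ x, ‖f x‖ ≤ C * ‖e x‖ := ⟨1, fun x => by rw [hn, one_mul]⟩
  let T := f.extendOfNorm e
  refine ⟨⟨T.toLinearMap, ?_⟩, ?_⟩
  · intro x
    refine hd.induction_on (p := fun x => ‖T x‖ = ‖x‖) x
      (isClosed_eq (by fun_prop) (by fun_prop)) ?_
    intro y
    rw [LinearMap.extendOfNorm_eq hd hb, hn]
  · intro i
    have := LinearMap.extendOfNorm_eq hd hb (Finsupp.single i 1)
    simpa [e, f, T] using this

end HilbertTensor

/-! ## Symmetric Fock space -/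

section Fock

universe u

/-- A bundled complex Hilbert space. -/
structure HilbertBundle : Type (u + 1) where
  carrier : Type u
  [normedAddCommGroup : NormedAddCommGroup carrier]
  [innerProductSpace : InnerProductSpace ℂ carrier]
  [completeSpace : CompleteSpace carrier]

attribute [instance] HilbertBundle.normedAddCommGroup HilbertBundle.innerProductSpace
  HilbertBundle.completeSpace

variable (K : Type u) [NormedAddCommGroup K] [InnerProductSpace ℂ K]

/-- The Hilbert space tensor powers `K^{⊗ n}`; the zeroth power is a copy of `ℂ`. -/
def hilbertPowBundle : ℕ → HilbertBundle.{u}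
  | 0 => ⟨EuclideanSpace ℂ PUnit.{u + 1}⟩
  | n + 1 => ⟨HilbertTensor K (hilbertPowBundle n).carrier⟩

/-- The `n`-fold Hilbert space tensor power of `K`. -/
abbrev HilbertPow (n : ℕ) : Type u := (hilbertPowBundle K n).carrier

variable {K}

/-- The diagonal tensor `f ⊗ ⋯ ⊗ f` in `K^{⊗ n}`. -/
def diagTensor (f : K) : ∀ n : ℕ, HilbertPow K n
  | 0 => (EuclideanSpace.single PUnit.unit (1 : ℂ) : EuclideanSpace ℂ PUnit.{u + 1})
  | n + 1 => (hTmul f (diagTensor f n) : HilbertTensor K (HilbertPow K n))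

theorem inner_diagTensor (f g : K) (n : ℕ) :
    ⟪diagTensor f n, diagTensor g n⟫_ℂ = ⟪f, g⟫_ℂ ^ n := by
  induction n with
  | zero =>
    change ⟪(EuclideanSpace.single PUnit.unit (1 : ℂ) : EuclideanSpace ℂ PUnit.{u + 1}),
      EuclideanSpace.single PUnit.unit (1 : ℂ)⟫_ℂ = _
    simp
  | succ n ih =>
    change ⟪hTmul f (diagTensor f n), hTmul g (diagTensor g n)⟫_ℂ = _
    rw [inner_hTmul, ih, pow_succ']

theorem diagTensor_smul (z : ℂ) (f : K) (n : ℕ) :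
    diagTensor (z • f) n = z ^ n • diagTensor f n := by
  induction n with
  | zero => rw [pow_zero, one_smul]; rfl
  | succ n ih =>
    change hTmul (z • f) (diagTensor (z • f) n) = z ^ (n + 1) • hTmul f (diagTensor f n)
    rw [ih]
    simp only [hTmul, ← map_smul, TensorProduct.smul_tmul', TensorProduct.tmul_smul, smul_smul,
      pow_succ]

variable (K) in
/-- The `n`-th symmetric power of `K`: the closed span of the diagonal tensors in `K^{⊗ n}`. -/
def symPow (n : ℕ) : Submodule ℂ (HilbertPow K n) :=
  (Submodule.span ℂ (Set.range fun f : K => diagTensor f n)).topologicalClosure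

instance (n : ℕ) : CompleteSpace (symPow K n) :=
  (Submodule.isClosed_topologicalClosure _).completeSpace_coe

/-- `diagTensor` as an element of the symmetric power. -/
def symTensor (f : K) (n : ℕ) : symPow K n :=
  ⟨diagTensor f n, Submodule.le_topologicalClosure _ (Submodule.subset_span ⟨f, rfl⟩)⟩

theorem inner_symTensor (f g : K) (n : ℕ) :
    ⟪symTensor f n, symTensor g n⟫_ℂ = ⟪f, g⟫_ℂ ^ n := inner_diagTensor f g n

variable (K) in
/-- The symmetric Fock space over `K`: the Hilbert space direct sum of the symmetric powers. -/
def Fock : Type u := lp (fun n => symPow K n) 2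

instance : NormedAddCommGroup (Fock K) :=
  inferInstanceAs (NormedAddCommGroup (lp (fun n => symPow K n) 2))

instance : InnerProductSpace ℂ (Fock K) :=
  inferInstanceAs (InnerProductSpace ℂ (lp (fun n => symPow K n) 2))

instance : CompleteSpace (Fock K) :=
  inferInstanceAs (CompleteSpace (lp (fun n => symPow K n) 2))

/-- The exponential vector `ε(f)`, with components `(n!)^{-1/2} f ⊗ ⋯ ⊗ f`. -/
def expVecLp (f : K) : lp (fun n => symPow K n) 2 :=
  ⟨fun n => (((Real.sqrt (n.factorial : ℝ))⁻¹ : ℝ) : ℂ) • symTensor f n, by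
    refine memℓp_gen ?_
    have := Real.summable_pow_div_factorial (‖f‖ ^ 2)
    refine this.congr fun n => ?_
    have h1 : ‖symTensor f n‖ ^ 2 = (‖f‖ ^ 2) ^ n := by
      have := inner_symTensor f f n
      rw [inner_self_eq_norm_sq_to_K, inner_self_eq_norm_sq_to_K] at this
      exact_mod_cast this
    have h2 : (2 : ENNReal).toReal = ((2 : ℕ) : ℝ) := by simp
    rw [h2, Real.rpow_natCast, norm_smul, mul_pow, h1, Complex.norm_real, norm_inv, inv_pow,
      Real.norm_of_nonneg (Real.sqrt_nonneg _), Real.sq_sqrt (by positivity)]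
    field_simp⟩

theorem expVecLp_apply (f : K) (n : ℕ) :
    expVecLp f n = (((Real.sqrt (n.factorial : ℝ))⁻¹ : ℝ) : ℂ) • symTensor f n := rfl

theorem inner_expVecLp (f g : K) : ⟪expVecLp f, expVecLp g⟫_ℂ = Complex.exp ⟪f, g⟫_ℂ := by
  rw [lp.inner_eq_tsum, Complex.exp_eq_exp_ℂ, NormedSpace.exp_eq_tsum_div]
  refine tsum_congr fun n => ?_
  have h : ((Real.sqrt (n.factorial : ℝ) : ℝ) : ℂ) * (Real.sqrt (n.factorial : ℝ) : ℝ)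
      = (n.factorial : ℂ) := by
    rw [← Complex.ofReal_mul, Real.mul_self_sqrt (by positivity)]; simp
  have h0 : ((Real.sqrt (n.factorial : ℝ) : ℝ) : ℂ) ≠ 0 := by
    intro h'
    rw [h', zero_mul] at h
    exact (Nat.cast_ne_zero.2 n.factorial_ne_zero) h.symm
  rw [expVecLp_apply, expVecLp_apply, inner_smul_left, inner_smul_right, inner_symTensor,
    Complex.conj_ofReal, ← h, Complex.ofReal_inv]
  field_simp

/-- The exponential vectors have dense span in the Fock space. -/
theorem expVecLp_total :
    (Submodule.span ℂ (Set.range (expVecLp : K → lp (fun n => symPow K n) 2))).topologicalClosure = ⊤ := by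
  rw [Submodule.topologicalClosure_eq_top_iff, Submodule.eq_bot_iff]
  intro x hx
  have hx' : ∀ f : K, ⟪x, expVecLp f⟫_ℂ = 0 := fun f => by
    rw [← inner_conj_symm, hx _ (Submodule.subset_span ⟨f, rfl⟩), map_zero]
  have key : ∀ (f : K) (n : ℕ), ⟪x n, symTensor f n⟫_ℂ = 0 := by
    intro f n
    let c : ℕ → ℂ := fun n => ⟪x n, expVecLp f n⟫_ℂ
    have hs : ∀ z : ℂ, HasSum (fun n => z ^ n • c n) 0 := by
      intro z
      have := lp.hasSum_inner (𝕜 := ℂ) (G := fun n => symPow K n) x (expVecLp (z • f))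
      rw [hx'] at this
      refine this.congr_fun fun n => ?_
      have : symTensor (z • f) n = z ^ n • symTensor f n := Subtype.ext (diagTensor_smul z f n)
      simp only [c, expVecLp_apply, this, inner_smul_right, smul_eq_mul]
      ring
    have hp : HasFPowerSeriesAt (0 : ℂ → ℂ) (FormalMultilinearSeries.ofScalars ℂ c) 0 := by
      rw [hasFPowerSeriesAt_iff]
      refine Filter.Eventually.of_forall fun z => ?_
      simpa [FormalMultilinearSeries.coeff_ofScalars] using hs z
    have hc : c n = 0 := by
      have := congrArg (fun p => FormalMultilinearSeries.coeff p n) hp.eq_zero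
      rw [FormalMultilinearSeries.coeff_ofScalars] at this
      simpa [FormalMultilinearSeries.coeff] using this
    simp only [c, expVecLp_apply, inner_smul_right, mul_eq_zero] at hc
    refine hc.resolve_left ?_
    rw [← ne_eq, Complex.ofReal_ne_zero]
    positivity
  ext n : 2
  have hle : symPow K n ≤ (ℂ ∙ (x n : HilbertPow K n))ᗮ := by
    refine Submodule.topologicalClosure_minimal _ ?_ (Submodule.isClosed_orthogonal _)
    rw [Submodule.span_le]
    rintro _ ⟨f, rfl⟩
    rw [SetLike.mem_coe, Submodule.mem_orthogonal_singleton_iff_inner_right]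
    exact key f n
  have := Submodule.mem_orthogonal_singleton_iff_inner_right.1 (hle (x n).2)
  exact inner_self_eq_zero.1 this

/-- The exponential vector `ε(f)` in the Fock space. -/
def expVec (f : K) : Fock K := expVecLp f

theorem inner_expVec (f g : K) : ⟪expVec f, expVec g⟫_ℂ = Complex.exp ⟪f, g⟫_ℂ :=
  inner_expVecLp f g

/-- The exponential vectors have dense span in the Fock space. -/
theorem expVec_total :
    (Submodule.span ℂ (Set.range (expVec : K → Fock K))).topologicalClosure = ⊤ :=
  expVecLp_total

/-- For isometries `i : K₁ → K` and `j : K₂ → K` with orthogonal ranges, the isometry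
`Fock K₁ ⊗ Fock K₂ → Fock K` that sends `ε(f) ⊗ ε(g)` to `ε(i f + j g)`. -/
theorem exists_fockJoin {K₁ K₂ K : Type*} [NormedAddCommGroup K₁] [InnerProductSpace ℂ K₁]
    [NormedAddCommGroup K₂] [InnerProductSpace ℂ K₂] [NormedAddCommGroup K]
    [InnerProductSpace ℂ K] (i : K₁ →ₗᵢ[ℂ] K) (j : K₂ →ₗᵢ[ℂ] K)
    (hij : ∀ f g, ⟪i f, j g⟫_ℂ = 0) :
    ∃ V : HilbertTensor (Fock K₁) (Fock K₂) →ₗᵢ[ℂ] Fock K,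
      ∀ f g, V (hTmul (expVec f) (expVec g)) = expVec (i f + j g) := by
  have hji : ∀ f g, ⟪j g, i f⟫_ℂ = 0 := fun f g => by rw [← inner_conj_symm, hij, map_zero]
  obtain ⟨V, hV⟩ := exists_isometry_of_gram
    (w := fun p : K₁ × K₂ => expVec (i p.1 + j p.2)) (hTmul_total expVec_total expVec_total)
    (by
      rintro ⟨f, g⟩ ⟨f', g'⟩
      simp [inner_hTmul, inner_expVec, hij, hji, Complex.exp_add])
  exact ⟨V, fun f g => hV (f, g)⟩

/-- The isometry `Fock K₁ ⊗ Fock K₂ → Fock K` determined by `ε(f) ⊗ ε(g) ↦ ε(i f + j g)`. -/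
def fockJoin {K₁ K₂ K : Type*} [NormedAddCommGroup K₁] [InnerProductSpace ℂ K₁]
    [NormedAddCommGroup K₂] [InnerProductSpace ℂ K₂] [NormedAddCommGroup K]
    [InnerProductSpace ℂ K] (i : K₁ →ₗᵢ[ℂ] K) (j : K₂ →ₗᵢ[ℂ] K)
    (hij : ∀ f g, ⟪i f, j g⟫_ℂ = 0) :
    HilbertTensor (Fock K₁) (Fock K₂) →ₗᵢ[ℂ] Fock K :=
  (exists_fockJoin i j hij).choose

theorem fockJoin_apply {K₁ K₂ K : Type*} [NormedAddCommGroup K₁] [InnerProductSpace ℂ K₁]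
    [NormedAddCommGroup K₂] [InnerProductSpace ℂ K₂] [NormedAddCommGroup K]
    [InnerProductSpace ℂ K] (i : K₁ →ₗᵢ[ℂ] K) (j : K₂ →ₗᵢ[ℂ] K)
    (hij : ∀ f g, ⟪i f, j g⟫_ℂ = 0) (f : K₁) (g : K₂) :
    fockJoin i j hij (hTmul (expVec f) (expVec g)) = expVec (i f + j g) :=
  (exists_fockJoin i j hij).choose_spec f g

end Fock

/-! ## Noise space, test functions, adaptedness and the CCR flow -/

section Noise

variable (k : Type*) [NormedAddCommGroup k] [InnerProductSpace ℂ k]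

/-- `L²(I; k)`, as the subspace of `L²(ℝ; k)` of the functions that vanish a.e. outside `I`. -/
def L2on (I : Set ℝ) : Submodule ℂ (Lp k 2 (volume : Measure ℝ)) where
  carrier := {f | ∀ᵐ r : ℝ, r ∉ I → f r = 0}
  zero_mem' := by
    filter_upwards [Lp.coeFn_zero k 2 (volume : Measure ℝ)] with r hr _
    rw [hr]; rfl
  add_mem' := by
    intro f g hf hg
    filter_upwards [hf, hg, Lp.coeFn_add f g] with r h1 h2 h3 hr
    rw [h3, Pi.add_apply, h1 hr, h2 hr, add_zero]
  smul_mem' := by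
    intro c f hf
    filter_upwards [hf, Lp.coeFn_smul c f] with r h1 h2 hr
    rw [h2, Pi.smul_apply, h1 hr, smul_zero]

variable {k}

theorem L2on_mono {I J : Set ℝ} (h : I ⊆ J) : L2on k I ≤ L2on k J := by
  intro f (hf : ∀ᵐ r : ℝ, r ∉ I → f r = 0)
  change ∀ᵐ r : ℝ, r ∉ J → f r = 0
  filter_upwards [hf] with r hr hJ
  exact hr fun hI => hJ (h hI)

theorem inner_L2on_eq_zero {I J : Set ℝ} (h : Disjoint I J) {f g : Lp k 2 (volume : Measure ℝ)}
    (hf : f ∈ L2on k I) (hg : g ∈ L2on k J) : ⟪f, g⟫_ℂ = 0 := by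
  rw [L2.inner_def]
  refine integral_eq_zero_of_ae ?_
  filter_upwards [hf, hg] with r h1 h2
  by_cases hr : r ∈ I
  · rw [h2 (Set.disjoint_left.1 h hr), inner_zero_right]; rfl
  · rw [h1 hr, inner_zero_left]; rfl

/-- The inclusion `L²(I; k) ⊆ L²(J; k)` for `I ⊆ J`. -/
def L2on.incl {I J : Set ℝ} (h : I ⊆ J) : L2on k I →ₗᵢ[ℂ] L2on k J :=
  ⟨Submodule.inclusion (L2on_mono h), fun _ => rfl⟩

/-- The restriction `f ↦ f_I` of functions on `ℝ` to `I`. -/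
def L2on.restrict {I : Set ℝ} (hI : MeasurableSet I) :
    Lp k 2 (volume : Measure ℝ) →ₗ[ℂ] L2on k I where
  toFun f := ⟨((Lp.memLp f).indicator hI).toLp, by
    filter_upwards [((Lp.memLp f).indicator hI).coeFn_toLp] with r hr hrI
    rw [hr, Set.indicator_of_notMem hrI]⟩
  map_add' f g := by
    refine Subtype.ext (Lp.ext ?_)
    refine ((Lp.memLp (f + g)).indicator hI).coeFn_toLp.trans ?_
    refine Filter.EventuallyEq.trans ?_ (Lp.coeFn_add _ _).symm
    filter_upwards [((Lp.memLp f).indicator hI).coeFn_toLp,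
      ((Lp.memLp g).indicator hI).coeFn_toLp, Lp.coeFn_add f g] with r h1 h2 h3
    rw [Pi.add_apply, h1, h2]
    by_cases hr : r ∈ I
    · rw [Set.indicator_of_mem hr, Set.indicator_of_mem hr, Set.indicator_of_mem hr, h3]; rfl
    · rw [Set.indicator_of_notMem hr, Set.indicator_of_notMem hr, Set.indicator_of_notMem hr,
        add_zero]
  map_smul' c f := by
    refine Subtype.ext (Lp.ext ?_)
    refine ((Lp.memLp (c • f)).indicator hI).coeFn_toLp.trans ?_
    refine Filter.EventuallyEq.trans ?_ (Lp.coeFn_smul _ _).symm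
    filter_upwards [((Lp.memLp f).indicator hI).coeFn_toLp, Lp.coeFn_smul c f] with r h1 h3
    rw [Pi.smul_apply, h1]
    by_cases hr : r ∈ I
    · rw [Set.indicator_of_mem hr, Set.indicator_of_mem hr, h3]; rfl
    · rw [Set.indicator_of_notMem hr, Set.indicator_of_notMem hr]; exact (smul_zero c).symm

theorem L2on.inner_incl {I J T : Set ℝ} (hI : I ⊆ T) (hJ : J ⊆ T) (h : Disjoint I J)
    (f : L2on k I) (g : L2on k J) : ⟪L2on.incl hI f, L2on.incl hJ g⟫_ℂ = 0 :=
  (Submodule.coe_inner _ _ _).trans (inner_L2on_eq_zero h f.2 g.2)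

theorem disjoint_Ico_Ici (t : ℝ) : Disjoint (Set.Ico 0 t) (Set.Ici t) :=
  Set.disjoint_left.2 fun _ hr hr' => not_lt.2 hr' hr.2

/-- Translation by `s` on `L²(ℝ; k)`: `f ↦ f(· - s)`. -/
def L2translate (s : ℝ) :
    Lp k 2 (volume : Measure ℝ) →ₗᵢ[ℂ] Lp k 2 (volume : Measure ℝ) :=
  Lp.compMeasurePreservingₗᵢ ℂ (fun r : ℝ => r - s) (measurePreserving_sub_right volume s)

theorem L2translate_mem (s : ℝ≥0) {f : Lp k 2 (volume : Measure ℝ)} (hf : f ∈ L2on k (Set.Ici 0)) :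
    L2translate s f ∈ L2on k (Set.Ici (s : ℝ)) := by
  have h1 : L2translate (s : ℝ) f =ᵐ[volume] fun r => f (r - s) :=
    Lp.coeFn_compMeasurePreserving f (measurePreserving_sub_right volume (s : ℝ))
  have h2 : ∀ᵐ r : ℝ, r - s ∉ Set.Ici (0 : ℝ) → f (r - s) = 0 :=
    (measurePreserving_sub_right volume (s : ℝ)).quasiMeasurePreserving.ae hf
  change ∀ᵐ r : ℝ, r ∉ Set.Ici (s : ℝ) → L2translate (s : ℝ) f r = 0
  filter_upwards [h1, h2] with r hr1 hr2 hr
  rw [hr1]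
  refine hr2 fun h => hr ?_
  simpa using h

/-- The right shift by `s ≥ 0`, as an isometry from `L²(ℝ₊; k)` to `L²([s,∞[; k)`. -/
def L2on.shift (s : ℝ≥0) : L2on k (Set.Ici 0) →ₗᵢ[ℂ] L2on k (Set.Ici (s : ℝ)) :=
  ⟨(L2translate (k := k) s).toLinearMap.restrict fun _ hf => L2translate_mem s hf,
    fun f => (L2translate (k := k) s).norm_map f⟩

variable (k)

/-- The span of the functions `d_{[0,s[}`, for `d ∈ k` and `s ≥ 0`. -/
def stepSpan : Submodule ℂ (Lp k 2 (volume : Measure ℝ)) :=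
  Submodule.span ℂ (Set.range fun p : k × ℝ≥0 =>
    indicatorConstLp 2 (measurableSet_Ico (a := (0 : ℝ)) (b := (p.2 : ℝ)))
      (measure_Ico_lt_top).ne p.1)

variable {k} in
/-- The exponential domain over `I`: the span of the exponential vectors `ε(f_I)` of the
restrictions to `I` of the step functions `f`. -/
def expDomain {I : Set ℝ} (hI : MeasurableSet I) : Submodule ℂ (Fock (L2on k I)) :=
  Submodule.span ℂ ((fun f => expVec (L2on.restrict hI f)) '' (stepSpan k : Set _))

/-- The exponential vector `ε(f_I)` of a step function `f`, as an element of the domain. -/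
def expDomain.mk {I : Set ℝ} (hI : MeasurableSet I) (f : stepSpan k) :
    expDomain (k := k) hI :=
  ⟨expVec (L2on.restrict hI f), Submodule.subset_span ⟨f, f.2, rfl⟩⟩

/-- The symmetric Fock space over `L²(ℝ₊; k)`. -/
abbrev FockSpace := Fock (L2on k (Set.Ici 0))

/-- The space of test vectors `ℰ = Lin {ε(f) : f ∈ 𝕊}` in the Fock space over `L²(ℝ₊; k)`, where
`𝕊 = Lin {d_{[0,s[}}`. -/
abbrev TestSpace : Submodule ℂ (FockSpace k) :=
  expDomain (k := k) (measurableSet_Ici (a := (0 : ℝ)))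

/-- The identification of `ℱ_{[0,t[} ⊗ ℱ_{[t,∞[}` with `ℱ`. -/
def fockSplit (t : ℝ≥0) :
    HilbertTensor (Fock (L2on k (Set.Ico 0 (t : ℝ)))) (Fock (L2on k (Set.Ici (t : ℝ)))) →ₗᵢ[ℂ]
      FockSpace k :=
  fockJoin (L2on.incl Set.Ico_subset_Ici_self) (L2on.incl (Set.Ici_subset_Ici.2 t.2))
    (L2on.inner_incl _ _ (disjoint_Ico_Ici _))

/-- The identification of `ℱ_{[0,s[} ⊗ ℱ` with `ℱ = ℱ_{[0,s[} ⊗ ℱ_{[s,∞[}` by means of the second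
quantised shift: `ε(f) ⊗ ε(g) ↦ ε(f + g(· - s))`. -/
def fockShift (s : ℝ≥0) :
    HilbertTensor (Fock (L2on k (Set.Ico 0 (s : ℝ)))) (FockSpace k) →ₗᵢ[ℂ] FockSpace k :=
  fockJoin (L2on.incl Set.Ico_subset_Ici_self)
    ((L2on.incl (Set.Ici_subset_Ici.2 s.2)).comp (L2on.shift s))
    fun f g => L2on.inner_incl Set.Ico_subset_Ici_self (Set.Ici_subset_Ici.2 s.2)
      (disjoint_Ico_Ici _) f (L2on.shift s g)

variable {k} in
/-- The CCR flow `σ_s` on `B(ℱ)`: `σ_s(X) = I_{[0,s[} ⊗ (shift of X)`. -/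
def ccrFlow (s : ℝ≥0) (X : FockSpace k →L[ℂ] FockSpace k) : FockSpace k →L[ℂ] FockSpace k :=
  (fockShift k s).toContinuousLinearMap ∘L
    opTensor (ContinuousLinearMap.id ℂ (Fock (L2on k (Set.Ico 0 (s : ℝ))))) X ∘L
      ContinuousLinearMap.adjoint (fockShift k s).toContinuousLinearMap

/-- An operator process: a family `X = (X_t)_{t ≥ 0}` of operators in the Fock space with domain
`ℰ` that is weakly measurable in `t` and adapted: `X_t ε(f) = X(t) ε(f_{[0,t[}) ⊗ ε(f_{[t,∞[})` for
some operator `X(t)` in `ℱ_{[0,t[}` with domain `ℰ_{[0,t[}`. -/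
structure IsOperatorProcess (X : ℝ≥0 → TestSpace k →ₗ[ℂ] FockSpace k) : Prop where
  weakly_measurable : ∀ (ξ : TestSpace k) (ζ : FockSpace k),
    Measurable fun t => ⟪ζ, X t ξ⟫_ℂ
  adapted : ∀ t : ℝ≥0,
    ∃ Y : expDomain (k := k) (measurableSet_Ico (a := (0 : ℝ)) (b := (t : ℝ))) →ₗ[ℂ]
        Fock (L2on k (Set.Ico 0 (t : ℝ))),
      ∀ f : stepSpan k,
        X t (expDomain.mk k measurableSet_Ici f) =
          fockSplit k t (hTmul (Y (expDomain.mk k measurableSet_Ico f))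
            (expVec (L2on.restrict measurableSet_Ici f)))

end Noise

/-! ## C⋆-algebras: complete positivity, complete boundedness, spatial tensor products -/

section CStar

open scoped CStarAlgebra

/-- Complete positivity of a linear map of C⋆-algebras (with their canonical orders). -/
def IsCompletelyPositive {A B : Type*} [CStarAlgebra A] [CStarAlgebra B] (φ : A →ₗ[ℂ] B) : Prop :=
  letI := CStarAlgebra.spectralOrder A
  letI := CStarAlgebra.spectralOrder B
  haveI := CStarAlgebra.spectralOrderedRing A
  haveI := CStarAlgebra.spectralOrderedRing B
  ∃ ψ : A →CP B, ∀ a, ψ a = φ a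

/-- Complete boundedness of a linear map of C⋆-algebras: the amplifications to `n × n` matrices
are bounded uniformly in `n`. -/
def IsCompletelyBounded {A B : Type*} [CStarAlgebra A] [CStarAlgebra B] (φ : A →ₗ[ℂ] B) : Prop :=
  letI := CStarAlgebra.spectralOrder A
  letI := CStarAlgebra.spectralOrder B
  haveI := CStarAlgebra.spectralOrderedRing A
  haveI := CStarAlgebra.spectralOrderedRing B
  ∃ C : ℝ, ∀ (n : ℕ) (M : CStarMatrix (Fin n) (Fin n) A), ‖M.map φ‖ ≤ C * ‖M‖

variable {A B C D H K L M : Type*} [CStarAlgebra A] [CStarAlgebra B] [CStarAlgebra C]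
  [CStarAlgebra D]
  [NormedAddCommGroup H] [InnerProductSpace ℂ H] [CompleteSpace H]
  [NormedAddCommGroup K] [InnerProductSpace ℂ K] [CompleteSpace K]
  [NormedAddCommGroup L] [InnerProductSpace ℂ L] [CompleteSpace L]
  [NormedAddCommGroup M] [InnerProductSpace ℂ M] [CompleteSpace M]

/-- The spatial tensor product `A ⊗ B` of C⋆-algebras that are represented (faithfully) by `π` on
`H` and by `ρ` on `K`: the C⋆-subalgebra of `B(H ⊗ K)` generated by the operators
`π(a) ⊗ ρ(b)`. -/
def spatialTensor (π : A →⋆ₐ[ℂ] (H →L[ℂ] H)) (ρ : B →⋆ₐ[ℂ] (K →L[ℂ] K)) :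
    StarSubalgebra ℂ (HilbertTensor H K →L[ℂ] HilbertTensor H K) :=
  (StarAlgebra.adjoin ℂ
    (Set.range fun p : A × B => opTensor (π p.1) (ρ p.2))).topologicalClosure

instance (π : A →⋆ₐ[ℂ] (H →L[ℂ] H)) (ρ : B →⋆ₐ[ℂ] (K →L[ℂ] K)) :
    CStarAlgebra (spatialTensor π ρ) :=
  StarSubalgebra.cstarAlgebra _ (h_closed := StarSubalgebra.isClosed_topologicalClosure _)

namespace spatialTensor

/-- The algebraic tensor product `A ⊙ B`, mapped into `A ⊗ B`. -/
def ofAlg (π : A →⋆ₐ[ℂ] (H →L[ℂ] H)) (ρ : B →⋆ₐ[ℂ] (K →L[ℂ] K)) :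
    A ⊗[ℂ] B →ₗ[ℂ] spatialTensor π ρ :=
  TensorProduct.lift <| LinearMap.mk₂ ℂ
    (fun a b => (⟨opTensor (π a) (ρ b),
      StarSubalgebra.le_topologicalClosure _ (StarAlgebra.subset_adjoin ℂ _ ⟨(a, b), rfl⟩)⟩ :
        spatialTensor π ρ))
    (fun a a' b => Subtype.ext (by simp [opTensor_add_left]))
    (fun c a b => Subtype.ext (by simp [opTensor_smul_left]))
    (fun a b b' => Subtype.ext (by simp [opTensor_add_right]))
    (fun c a b => Subtype.ext (by simp [opTensor_smul_right]))

/-- The representation of `A ⊗ B` on `H ⊗ K`. -/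
abbrev rep (π : A →⋆ₐ[ℂ] (H →L[ℂ] H)) (ρ : B →⋆ₐ[ℂ] (K →L[ℂ] K)) :
    spatialTensor π ρ →⋆ₐ[ℂ] (HilbertTensor H K →L[ℂ] HilbertTensor H K) :=
  (spatialTensor π ρ).subtype

/-- The unique continuous linear extension to `A ⊗ B` of a linear map on the dense subspace `A ⊙ B`
that is bounded for the norm of `A ⊗ B`. -/
def extend {V : Type*} [NormedAddCommGroup V] [NormedSpace ℂ V] [CompleteSpace V]
    (π : A →⋆ₐ[ℂ] (H →L[ℂ] H)) (ρ : B →⋆ₐ[ℂ] (K →L[ℂ] K)) (f : A ⊗[ℂ] B →ₗ[ℂ] V) :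
    spatialTensor π ρ →L[ℂ] V :=
  f.extendOfNorm (ofAlg π ρ)

/-- The tensor product `φ ⊗ ψ : A ⊗ B → C ⊗ D` of completely bounded maps: the continuous
extension of the algebraic tensor product `φ ⊙ ψ`. -/
def map (π : A →⋆ₐ[ℂ] (H →L[ℂ] H)) (ρ : B →⋆ₐ[ℂ] (K →L[ℂ] K))
    (π' : C →⋆ₐ[ℂ] (L →L[ℂ] L)) (ρ' : D →⋆ₐ[ℂ] (M →L[ℂ] M))
    (φ : A →ₗ[ℂ] C) (ψ : B →ₗ[ℂ] D) : spatialTensor π ρ →L[ℂ] spatialTensor π' ρ' :=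
  extend π ρ (ofAlg π' ρ' ∘ₗ TensorProduct.map φ ψ)

/-- The associativity isomorphism `(A ⊗ B) ⊗ C → A ⊗ (B ⊗ C)`. -/
def assoc (π : A →⋆ₐ[ℂ] (H →L[ℂ] H)) (ρ : B →⋆ₐ[ℂ] (K →L[ℂ] K)) (τ : C →⋆ₐ[ℂ] (L →L[ℂ] L)) :
    spatialTensor (rep π ρ) τ →L[ℂ] spatialTensor π (rep ρ τ) :=
  (ofAlg π (rep ρ τ) ∘ₗ TensorProduct.map LinearMap.id (ofAlg ρ τ) ∘ₗ
      (TensorProduct.assoc ℂ A B C).toLinearMap).extendOfNorm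
    (ofAlg (rep π ρ) τ ∘ₗ TensorProduct.map (ofAlg π ρ) LinearMap.id)

end spatialTensor

end CStar

/-! ## C⋆-hyperbialgebras and quantum stochastic convolution cocycles -/

section Hyperbialgebra

variable {A H : Type*} [CStarAlgebra A]
  [NormedAddCommGroup H] [InnerProductSpace ℂ H] [CompleteSpace H]

/-- `(A, Δ, ε)` is a C⋆-hyperbialgebra. Here `A` is a unital C⋆-algebra with a faithful
representation `π` (which serves to form `A ⊗ A`), `Δ : A → A ⊗ A` is unital, completely positive and
coassociative, and the character `ε` is a counit for `Δ`. -/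
structure IsCStarHyperbialgebra (π : A →⋆ₐ[ℂ] (H →L[ℂ] H)) (Δ : A →ₗ[ℂ] spatialTensor π π)
    (ε : A →⋆ₐ[ℂ] ℂ) : Prop where
  completelyPositive : IsCompletelyPositive Δ
  map_one : Δ 1 = 1
  coassoc : ∀ a,
    spatialTensor.assoc π π π
        (spatialTensor.map π π (spatialTensor.rep π π) π Δ LinearMap.id (Δ a)) =
      spatialTensor.map π π π (spatialTensor.rep π π) LinearMap.id Δ (Δ a)
  counit_left : ∀ a, spatialTensor.extend π π
    ((TensorProduct.lid ℂ A).toLinearMap ∘ₗ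
      TensorProduct.map (ε.toAlgHom.toLinearMap) LinearMap.id) (Δ a) = a
  counit_right : ∀ a, spatialTensor.extend π π
    ((TensorProduct.rid ℂ A).toLinearMap ∘ₗ
      TensorProduct.map LinearMap.id (ε.toAlgHom.toLinearMap)) (Δ a) = a

variable {k : Type*} [NormedAddCommGroup k] [InnerProductSpace ℂ k]

/-- A completely bounded process on `A` with noise dimension space `k` (and values in `ℂ`); the
bounded operators `l_t(a)` are identified with their continuous extensions from `ℰ` to `ℱ`. -/
structure IsCBProcess (l : ℝ≥0 → A →ₗ[ℂ] (FockSpace k →L[ℂ] FockSpace k)) : Prop where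
  isOperatorProcess : ∀ a,
    IsOperatorProcess k fun t => (l t a).toLinearMap ∘ₗ (TestSpace k).subtype
  completelyBounded : ∀ t, IsCompletelyBounded (l t)

theorem ccrFlow_add (s : ℝ≥0) (X Y : FockSpace k →L[ℂ] FockSpace k) :
    ccrFlow s (X + Y) = ccrFlow s X + ccrFlow s Y := by
  simp [ccrFlow, opTensor_add_right]

theorem ccrFlow_smul (s : ℝ≥0) (c : ℂ) (X : FockSpace k →L[ℂ] FockSpace k) :
    ccrFlow s (c • X) = c • ccrFlow s X := by
  simp [ccrFlow, opTensor_smul_right]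

/-- The map `l_s ⊗ (σ_s ∘ l_t) : A ⊗ A → B(ℱ_{[0,s[} ⊗ ℱ_{[s,∞[}) = B(ℱ)`. By adaptedness, `l_s(a)`
acts on the first factor and `σ_s(l_t(b))` acts on the second one, so that the value on `a ⊗ b` is the
product of these two operators on `ℱ`. -/
def incrementTensor (π : A →⋆ₐ[ℂ] (H →L[ℂ] H))
    (l : ℝ≥0 → A →ₗ[ℂ] (FockSpace k →L[ℂ] FockSpace k)) (s t : ℝ≥0) :
    spatialTensor π π →L[ℂ] (FockSpace k →L[ℂ] FockSpace k) :=
  spatialTensor.extend π π <| TensorProduct.lift <| LinearMap.mk₂ ℂ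
    (fun a b => l s a ∘L ccrFlow s (l t b))
    (fun a a' b => by rw [map_add, ContinuousLinearMap.add_comp])
    (fun c a b => by rw [map_smul, ContinuousLinearMap.smul_comp])
    (fun a b b' => by rw [map_add, ccrFlow_add, ContinuousLinearMap.comp_add])
    (fun c a b => by rw [map_smul, ccrFlow_smul, ContinuousLinearMap.comp_smul])

/-- The convolution increment property `l_{s+t} = (l_s ⊗ (σ_s ∘ l_t)) ∘ Δ`. -/
def HasConvolutionIncrements (π : A →⋆ₐ[ℂ] (H →L[ℂ] H)) (Δ : A →ₗ[ℂ] spatialTensor π π)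
    (l : ℝ≥0 → A →ₗ[ℂ] (FockSpace k →L[ℂ] FockSpace k)) : Prop :=
  ∀ (s t : ℝ≥0) (a : A), l (s + t) a = incrementTensor π l s t (Δ a)

/-- A quantum stochastic convolution cocycle on `(A, Δ, ε)`: a completely bounded process with the
convolution increment property and the initial condition `l_0(a) = ε(a) I`. -/
structure IsQSConvolutionCocycle (π : A →⋆ₐ[ℂ] (H →L[ℂ] H)) (Δ : A →ₗ[ℂ] spatialTensor π π)
    (ε : A →⋆ₐ[ℂ] ℂ) (l : ℝ≥0 → A →ₗ[ℂ] (FockSpace k →L[ℂ] FockSpace k)) : Prop where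
  isCBProcess : IsCBProcess l
  increments : HasConvolutionIncrements π Δ l
  initial : ∀ a, l 0 a = ε a • ContinuousLinearMap.id ℂ (FockSpace k)

/-! ### The conditional expectation construction -/

variable (S : StarSubalgebra ℂ A) [hS : IsClosed (S : Set A)]

/-- A conditional expectation of `A` onto the C⋆-subalgebra `S`: a projection of norm one. -/
structure IsConditionalExpectation (P : A →L[ℂ] S) : Prop where
  proj : ∀ b : S, P b = b
  norm_eq_one : ‖P‖ = 1

/-- `P`, regarded as a map from `A` to `A`. -/
def expectationEnd (P : A →L[ℂ] S) : A →ₗ[ℂ] A :=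
  S.subtype.toAlgHom.toLinearMap ∘ₗ P.toLinearMap

/-- The compatibility of `P` with the coproduct:
`(P ⊗ id) ∘ Δ ∘ P = (P ⊗ P) ∘ Δ = (id ⊗ P) ∘ Δ`. -/
structure IsCompatibleExpectation (π : A →⋆ₐ[ℂ] (H →L[ℂ] H)) (Δ : A →ₗ[ℂ] spatialTensor π π)
    (P : A →L[ℂ] S) : Prop where
  left : ∀ a,
    spatialTensor.map π π π π (expectationEnd S P) LinearMap.id (Δ (P a)) =
      spatialTensor.map π π π π (expectationEnd S P) (expectationEnd S P) (Δ a)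
  right : ∀ a,
    spatialTensor.map π π π π (expectationEnd S P) (expectationEnd S P) (Δ a) =
      spatialTensor.map π π π π LinearMap.id (expectationEnd S P) (Δ a)

/-- The restriction of the representation of `A` to `S`. -/
abbrev restrictRep (π : A →⋆ₐ[ℂ] (H →L[ℂ] H)) : S →⋆ₐ[ℂ] (H →L[ℂ] H) := π.comp S.subtype

/-- The coproduct `(P ⊗ P) ∘ Δ|_S : S → S ⊗ S`. -/
def restrictCoproduct (π : A →⋆ₐ[ℂ] (H →L[ℂ] H)) (Δ : A →ₗ[ℂ] spatialTensor π π)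
    (P : A →L[ℂ] S) : S →ₗ[ℂ] spatialTensor (restrictRep S π) (restrictRep S π) :=
  (spatialTensor.map π π (restrictRep S π) (restrictRep S π)
      P.toLinearMap P.toLinearMap).toLinearMap ∘ₗ
    Δ ∘ₗ S.subtype.toAlgHom.toLinearMap

/-- The counit `ε|_S`. -/
abbrev restrictCounit (ε : A →⋆ₐ[ℂ] ℂ) : S →⋆ₐ[ℂ] ℂ := ε.comp S.subtype

end Hyperbialgebra

end

/-!
A norm-one projection `P` onto a C⋆-subalgebra `S` is a positive `S`-bimodule map (Tomiyama), hence
completely contractive, so that `P ⊗ P` exists on the spatial tensor product. Compatibility says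
that `(P ⊗ P) ∘ Δ` is unchanged by precomposition with `P`, and therefore coassociativity and the
counit identities pass from `Δ` to `S`.

If `T` is adapted at time `s`, then `T σ_s(X)` is `U (T ⊗ X) V` with `U`, `V` depending only on `s`.
So `a ⊗ b ↦ l_s(a) σ_s(l_t(b))` extends boundedly to the spatial tensor product, and the extension
for `l ∘ P` is that for `l` composed with `P ⊗ P`. Hence `l ∘ P` has convolution increments for `Δ`
exactly when `l` has them for the restricted coproduct. Composition with `P` and restriction to `S`
are inverse to each other on `P`-invariant processes because `P` fixes `S`.
-/

noncomputable section

section UnitalContraction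

variable {A B : Type*} [CStarAlgebra A] [CStarAlgebra B]

theorem norm_add_I_smul_one_sq_le {a : A} (ha : IsSelfAdjoint a) (t : ℝ) :
    ‖a + (t * Complex.I : ℂ) • (1 : A)‖ ^ 2 ≤ ‖a‖ ^ 2 + t ^ 2 := by
  rcases subsingleton_or_nontrivial A with _ | _
  · rw [Subsingleton.elim (a + (t * Complex.I : ℂ) • (1 : A)) 0, norm_zero]
    simpa using add_nonneg (sq_nonneg ‖a‖) (sq_nonneg t)
  have star_mul_self : star (a + (t * Complex.I : ℂ) • (1 : A)) *
      (a + (t * Complex.I : ℂ) • (1 : A)) = a * a + ((t ^ 2 : ℝ) : ℂ) • (1 : A) := by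
    have hsq : ((t : ℂ) * Complex.I) * ((t : ℂ) * Complex.I) = -((t ^ 2 : ℝ) : ℂ) := by
      push_cast
      linear_combination (t : ℂ) ^ 2 * Complex.I_mul_I
    have hstar : star ((t : ℂ) * Complex.I) = -(t * Complex.I) := by simp
    simp only [star_add, ha.star_eq, star_smul, star_one, add_mul, mul_add, smul_mul_assoc,
      mul_smul_comm, one_mul, mul_one, smul_add, smul_smul, hstar, neg_smul,
      smul_neg, neg_mul, hsq, neg_neg]
    abel
  calc ‖a + (t * Complex.I : ℂ) • (1 : A)‖ ^ 2
      = ‖a * a + ((t ^ 2 : ℝ) : ℂ) • (1 : A)‖ := by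
        rw [sq, ← CStarRing.norm_star_mul_self, star_mul_self]
    _ ≤ ‖a‖ ^ 2 + t ^ 2 := by
        refine (norm_add_le _ _).trans ?_
        rw [norm_smul, norm_one, mul_one, Complex.norm_real, Real.norm_of_nonneg (sq_nonneg t),
          sq ‖a‖]
        gcongr
        exact norm_mul_le _ _

theorem exists_mem_spectrum_abs_eq_norm [Nontrivial A] {a : A} (ha : IsSelfAdjoint a) :
    ∃ γ : ℝ, γ ∈ spectrum ℝ a ∧ |γ| = ‖a‖ := by
  let := CStarAlgebra.spectralOrder A
  have := CStarAlgebra.spectralOrderedRing A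
  rcases CStarAlgebra.norm_or_neg_norm_mem_spectrum ha with h | h
  · exact ⟨_, h, abs_of_nonneg (norm_nonneg _)⟩
  · exact ⟨_, h, by rw [abs_neg, abs_of_nonneg (norm_nonneg _)]⟩

theorem eq_zero_of_norm_add_algebraMap_sq_le {a : A} (ha : IsSelfAdjoint a) {C : ℝ}
    (h : ∀ t : ℝ, ‖a + algebraMap ℝ A t‖ ^ 2 ≤ C + t ^ 2) : a = 0 := by
  rcases subsingleton_or_nontrivial A with _ | _
  · exact Subsingleton.elim _ _
  obtain ⟨γ, hγ, hγ_norm⟩ := exists_mem_spectrum_abs_eq_norm ha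
  have hparabola (t : ℝ) : (γ + t) ^ 2 ≤ C + t ^ 2 := by
    have hmem : γ + t ∈ spectrum ℝ (a + algebraMap ℝ A t) :=
      add_comm (algebraMap ℝ A t) a ▸ spectrum.add_mem_add_iff.2 hγ
    have hle : |γ + t| ≤ ‖a + algebraMap ℝ A t‖ := spectrum.norm_le_norm_of_mem hmem
    calc (γ + t) ^ 2 = |γ + t| ^ 2 := (sq_abs _).symm
      _ ≤ ‖a + algebraMap ℝ A t‖ ^ 2 := by gcongr
      _ ≤ C + t ^ 2 := h t
  rw [← norm_eq_zero, ← hγ_norm, abs_eq_zero]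
  by_contra hγ0
  have hcross : γ * (C / (2 * γ)) = C / 2 := by field_simp
  have hpos : 0 < γ ^ 2 := by positivity
  nlinarith [hparabola (C / (2 * γ))]

section

variable {φ : A →ₗ[ℂ] B} (h1 : φ 1 = 1) (hφ : ∀ a, ‖φ a‖ ≤ ‖a‖)

include h1 hφ

theorem isSelfAdjoint_map_of_unital_contraction {a : A} (ha : IsSelfAdjoint a) :
    IsSelfAdjoint (φ a) := by
  have imaginaryPart_add (t : ℝ) : ((imaginaryPart (φ a) : selfAdjoint B) : B) + algebraMap ℝ B t =
      (imaginaryPart (φ (a + (t * Complex.I : ℂ) • (1 : A))) : selfAdjoint B) := by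
    have hreal : IsSelfAdjoint ((t : ℂ) • (1 : B)) := by
      simp [isSelfAdjoint_iff]
    rw [map_add φ, map_smul φ, h1, map_add imaginaryPart, mul_comm, mul_smul, imaginaryPart_I_smul,
      AddSubgroup.coe_add, hreal.coe_realPart, Algebra.algebraMap_eq_smul_one]
    rfl
  have imaginaryPart_eq_zero : ((imaginaryPart (φ a) : selfAdjoint B) : B) = 0 := by
    refine eq_zero_of_norm_add_algebraMap_sq_le (imaginaryPart (φ a)).2 (C := ‖a‖ ^ 2) fun t => ?_
    rw [imaginaryPart_add]
    refine le_trans ?_ (norm_add_I_smul_one_sq_le ha t)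
    gcongr
    exact (imaginaryPart.norm_le _).trans (hφ _)
  rw [← realPart_add_I_smul_imaginaryPart (φ a), imaginaryPart_eq_zero, smul_zero, add_zero]
  exact (realPart (φ a)).2

theorem map_star_of_unital_contraction (a : A) : φ (star a) = star (φ a) := by
  have hsa (x : selfAdjoint A) : star (φ x) = φ x :=
    (isSelfAdjoint_map_of_unital_contraction h1 hφ x.2).star_eq
  rw [← realPart_add_I_smul_imaginaryPart a]
  simp [hsa]

theorem map_nonneg_of_unital_contraction [PartialOrder A] [StarOrderedRing A] [PartialOrder B]
    [StarOrderedRing B] {a : A} (ha : 0 ≤ a) : 0 ≤ φ a := by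
  rcases eq_or_ne a 0 with rfl | ha0
  · rw [map_zero]
  have hnorm : 0 < ‖a‖ := norm_pos_iff.2 ha0
  set x : A := (‖a‖⁻¹ : ℝ) • a with hx
  have hx_nonneg : 0 ≤ x := smul_nonneg (by positivity) ha
  have hx_norm : ‖x‖ ≤ 1 := by
    rw [hx, norm_smul, norm_inv, norm_norm, inv_mul_cancel₀ hnorm.ne']
  have hsub_norm : ‖(1 : A) - x‖ ≤ 1 := by
    have hx_le := (CStarAlgebra.mem_Icc_iff_norm_le_one.2 ⟨hx_nonneg, hx_norm⟩).2
    exact (CStarAlgebra.mem_Icc_iff_norm_le_one.1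
      ⟨sub_nonneg.2 hx_le, sub_le_self _ hx_nonneg⟩).2
  have hsub_selfAdjoint : IsSelfAdjoint ((1 : B) - φ x) :=
    (IsSelfAdjoint.one B).sub
      (isSelfAdjoint_map_of_unital_contraction h1 hφ (.of_nonneg hx_nonneg))
  have hsub_le : (1 : B) - φ x ≤ 1 := by
    refine hsub_selfAdjoint.le_algebraMap_norm_self.trans ?_
    have : ‖(1 : B) - φ x‖ ≤ 1 := by
      rw [← h1, ← map_sub]
      exact (hφ _).trans hsub_norm
    simpa using algebraMap_mono B this
  have hφx : 0 ≤ φ x := by simpa using hsub_le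
  have hφa : φ a = ‖a‖ • φ x := by
    rw [hx, φ.map_smul_of_tower, smul_smul, mul_inv_cancel₀ hnorm.ne', one_smul]
  rw [hφa]
  exact smul_nonneg (norm_nonneg _) hφx

end

end UnitalContraction

section Centrality

variable {B : Type*} [CStarAlgebra B]

theorem commute_of_commute_commutators_of_isSelfAdjoint {y t : B} (hy : IsSelfAdjoint y)
    (ht : IsSelfAdjoint t) (h : ∀ s r : B, Commute y (s * r - r * s)) : Commute y t := by
  set w := y * t - t * y with hw
  have hyw : y * w = w * y := h y t
  have hyw' : y * (w * t + t * w) = (w * t + t * w) * y := by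
    have hcomm : w * t + t * w = y * (t * t) - t * t * y := by rw [hw]; noncomm_ring
    rw [hcomm]
    exact h y (t * t)
  -- The Kleinecke–Shirokov identity: `ad y` applied twice to `t * t` is `2 • w ^ 2`.
  have hw_sq : (2 : ℂ) • (w * w) = 0 := by
    have : (2 : ℂ) • (w * w) = y * (w * t + t * w) - (w * t + t * w) * y -
        (y * w - w * y) * t - t * (y * w - w * y) := by
      rw [two_smul, hw]; noncomm_ring
    rw [this, hyw', hyw]
    simp
  have hw_skew : star w = -w := by
    rw [hw]; simp [hy.star_eq, ht.star_eq]
  have hw_star_mul : star w * w = 0 := by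
    rw [hw_skew, neg_mul, (smul_eq_zero.1 hw_sq).resolve_left two_ne_zero, neg_zero]
  exact sub_eq_zero.1 (CStarRing.star_mul_self_eq_zero_iff w |>.1 hw_star_mul)

theorem commute_of_commute_commutators {z : B} (h : ∀ s t : B, Commute z (s * t - t * s)) (t : B) :
    Commute z t := by
  have h_star (s t : B) : Commute (star z) (s * t - t * s) := by
    simpa using (h (star t) (star s)).star_star
  have h_re (s t : B) : Commute ((realPart z : selfAdjoint B) : B) (s * t - t * s) := by
    rw [realPart_apply_coe]
    exact ((h s t).add_left (h_star s t)).smul_left _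
  have h_im (s t : B) : Commute ((imaginaryPart z : selfAdjoint B) : B) (s * t - t * s) := by
    rw [imaginaryPart_apply_coe]
    exact (((h s t).sub_left (h_star s t)).smul_left _).smul_left _
  have h_selfAdjoint (t : selfAdjoint B) : Commute z t := by
    rw [← realPart_add_I_smul_imaginaryPart z]
    exact (commute_of_commute_commutators_of_isSelfAdjoint (realPart z).2 t.2 h_re).add_left
      ((commute_of_commute_commutators_of_isSelfAdjoint (imaginaryPart z).2 t.2 h_im).smul_left _)
  rw [← realPart_add_I_smul_imaginaryPart t]
  exact (h_selfAdjoint _).add_right ((h_selfAdjoint _).smul_right _)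

end Centrality

section Tomiyama

variable {A B : Type*} [CStarAlgebra A] [CStarAlgebra B]

/-- A projection of norm at most one onto a C⋆-subalgebra: a contractive linear left inverse `P` of
the inclusion `i`. The subalgebra is given by a unital ⋆-homomorphism `i`, which the existence of
`P` forces to be injective. -/
structure IsContractiveRetraction (i : B →⋆ₐ[ℂ] A) (P : A →ₗ[ℂ] B) : Prop where
  norm_apply_le : ∀ a, ‖P a‖ ≤ ‖a‖
  apply_incl : ∀ b, P (i b) = b

/-- The deviation `P(s x) - s P(x)` of `P` from being a left module map over the subalgebra embedded
by `i`; Tomiyama's theorem asserts that it vanishes for contractive retractions. -/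
def moduleDefect (i : B →⋆ₐ[ℂ] A) (P : A →ₗ[ℂ] B) (x : A) : B →ₗ[ℂ] B :=
  P ∘ₗ LinearMap.mulRight ℂ x ∘ₗ i.toAlgHom.toLinearMap - LinearMap.mulRight ℂ (P x)

variable {i : B →⋆ₐ[ℂ] A} {P : A →ₗ[ℂ] B}

theorem moduleDefect_apply (x : A) (s : B) : moduleDefect i P x s = P (i s * x) - s * P x := rfl

namespace IsContractiveRetraction

theorem map_one (hP : IsContractiveRetraction i P) : P 1 = 1 := by
  rw [← _root_.map_one i, hP.apply_incl]

theorem map_star (hP : IsContractiveRetraction i P) (a : A) : P (star a) = star (P a) :=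
  map_star_of_unital_contraction hP.map_one hP.norm_apply_le a

theorem map_unitary_mul_mul (hP : IsContractiveRetraction i P) {u : B} (hu : u ∈ unitary B)
    (x : A) : P (i u * x * i u) = u * P x * u := by
  have hu_mul_star : u * star u = 1 := Unitary.mul_star_self_of_mem hu
  have hiu : i u * star (i u) = 1 := by
    rw [← StarHomClass.map_star, ← map_mul, hu_mul_star, _root_.map_one]
  -- Translating `P` by `u` gives another unital contraction; that it preserves `star` is the claim.
  let Q : A →ₗ[ℂ] B := LinearMap.mulLeft ℂ (star u) ∘ₗ P ∘ₗ LinearMap.mulLeft ℂ (i u)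
  have hQ (x : A) : Q x = star u * P (i u * x) := rfl
  have hQ_one : Q 1 = 1 := by
    rw [hQ, mul_one, hP.apply_incl, Unitary.star_mul_self_of_mem hu]
  have hQ_norm (x : A) : ‖Q x‖ ≤ ‖x‖ := by
    rw [hQ, CStarRing.norm_mem_unitary_mul _ (Unitary.star_mem hu)]
    exact (hP.norm_apply_le _).trans_eq (CStarRing.norm_mem_unitary_mul _ (Unitary.map_mem i hu))
  have hQ_star := map_star_of_unital_contraction hQ_one hQ_norm (star (x * i u))
  rw [hQ, hQ, star_star, star_mul (star u), star_star, ← hP.map_star, star_mul, star_star,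
    mul_assoc x, hiu, mul_one] at hQ_star
  rw [mul_assoc (i u), mul_assoc u, ← hQ_star, ← mul_assoc u, hu_mul_star, one_mul]

theorem map_jordan_of_isSelfAdjoint (hP : IsContractiveRetraction i P) {h : B}
    (hh : IsSelfAdjoint h) (x : A) : P (i h * x + x * i h) = h * P x + P x * h := by
  let Pc : A →L[ℝ] B :=
    (P.mkContinuous 1 (by simpa using hP.norm_apply_le)).restrictScalars ℝ
  let ic : B →L[ℝ] A := (i.toAlgHom.toLinearMap.mkContinuous 1
    (by simpa using NonUnitalStarAlgHom.norm_apply_le i)).restrictScalars ℝ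
  let a : B := Complex.I • h
  let e : ℝ → B := fun t => NormedSpace.exp (t • a)
  have he : HasDerivAt e a 0 := by
    simpa using hasDerivAt_exp_smul_const (𝕂 := ℝ) a (0 : ℝ)
  have he0 : e 0 = 1 := by simp [e]
  have he_unitary (t : ℝ) : e t ∈ unitary B := by
    have hexp := (selfAdjoint.expUnitary ⟨t • h, (IsSelfAdjoint.all t).smul hh⟩).2
    rw [selfAdjoint.expUnitary_coe] at hexp
    simpa only [e, a, smul_comm t Complex.I h] using hexp
  have hie : HasDerivAt (fun t => i (e t)) (i a) 0 := ic.hasFDerivAt.comp_hasDerivAt 0 he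
  have hderiv_left : HasDerivAt (fun t => P (i (e t) * x * i (e t))) (P (i a * x + x * i a)) 0 := by
    have hd := (hie.mul_const x).mul hie
    simp only [he0, _root_.map_one, mul_one, one_mul] at hd
    exact Pc.hasFDerivAt.comp_hasDerivAt 0 hd
  have hderiv_right : HasDerivAt (fun t => e t * P x * e t) (a * P x + P x * a) 0 := by
    have hd := (he.mul_const (P x)).mul he
    simp only [he0, mul_one, one_mul] at hd
    exact hd
  simp only [hP.map_unitary_mul_mul (he_unitary _)] at hderiv_left
  have hderiv_eq := hderiv_left.unique hderiv_right
  simp only [a, map_smul, smul_mul_assoc, mul_smul_comm, ← smul_add] at hderiv_eq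
  exact smul_right_injective B Complex.I_ne_zero hderiv_eq

theorem map_jordan (hP : IsContractiveRetraction i P) (s : B) (x : A) :
    P (i s * x + x * i s) = s * P x + P x * s := by
  have h_re := hP.map_jordan_of_isSelfAdjoint (realPart s).2 x
  have h_im := hP.map_jordan_of_isSelfAdjoint (imaginaryPart s).2 x
  calc P (i s * x + x * i s)
      = P (i (realPart s : B) * x + x * i (realPart s : B)) +
          Complex.I • P (i (imaginaryPart s : B) * x + x * i (imaginaryPart s : B)) := by
        conv_lhs => rw [← realPart_add_I_smul_imaginaryPart s]
        simp only [map_add, map_smul, add_mul, mul_add, smul_mul_assoc, mul_smul_comm, smul_add]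
        abel
    _ = ((realPart s : B) + Complex.I • (imaginaryPart s : B)) * P x +
          P x * ((realPart s : B) + Complex.I • (imaginaryPart s : B)) := by
        rw [h_re, h_im]
        simp only [add_mul, mul_add, smul_mul_assoc, mul_smul_comm, smul_add]
        abel
    _ = s * P x + P x * s := by rw [realPart_add_I_smul_imaginaryPart]

theorem moduleDefect_eq_right (hP : IsContractiveRetraction i P) (x : A) (s : B) :
    moduleDefect i P x s = P x * s - P (x * i s) := by
  rw [moduleDefect_apply, sub_eq_sub_iff_add_eq_add, ← map_add, hP.map_jordan, add_comm]

theorem two_smul_moduleDefect_mul (hP : IsContractiveRetraction i P) (x : A) (s t : B) :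
    (2 : ℂ) • moduleDefect i P x (s * t) =
      s * moduleDefect i P x t + t * moduleDefect i P x s +
        (moduleDefect i P x t * s + moduleDefect i P x s * t) := by
  have left_expansion : moduleDefect i P x (s * t) =
      moduleDefect i P (i t * x) s + s * moduleDefect i P x t := by
    simp only [moduleDefect_apply, map_mul]; noncomm_ring
  have right_expansion : moduleDefect i P x (s * t) =
      moduleDefect i P x s * t + moduleDefect i P (x * i s) t := by
    simp only [hP.moduleDefect_eq_right, map_mul]; noncomm_ring
  have exchange : moduleDefect i P (i t * x) s + moduleDefect i P (x * i s) t =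
      moduleDefect i P x t * s + t * moduleDefect i P x s := by
    rw [hP.moduleDefect_eq_right (i t * x) s, hP.moduleDefect_eq_right x s]
    simp only [moduleDefect_apply, ← mul_assoc]; noncomm_ring
  calc (2 : ℂ) • moduleDefect i P x (s * t)
      = (moduleDefect i P (i t * x) s + s * moduleDefect i P x t) +
          (moduleDefect i P x s * t + moduleDefect i P (x * i s) t) := by
        rw [two_smul, ← left_expansion, ← right_expansion]
    _ = (moduleDefect i P (i t * x) s + moduleDefect i P (x * i s) t) +
          (s * moduleDefect i P x t + moduleDefect i P x s * t) := by abel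
    _ = _ := by rw [exchange]; abel

theorem moduleDefect_commutator (hP : IsContractiveRetraction i P) (x : A) (s t : B) :
    moduleDefect i P x (s * t - t * s) = 0 := by
  refine smul_right_injective B (two_ne_zero (α := ℂ)) ?_
  simp only [map_sub, smul_sub, hP.two_smul_moduleDefect_mul, smul_zero]
  abel

theorem commute_moduleDefect (hP : IsContractiveRetraction i P) (x : A) (r t : B) :
    Commute (moduleDefect i P x r) t := by
  refine commute_of_commute_commutators (fun s t => ?_) t
  have hmul (c : B) (hc : ∀ y, moduleDefect i P y c = 0) :
      moduleDefect i P x (c * r) = c * moduleDefect i P x r := by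
    have := hc (i r * x)
    simp only [moduleDefect_apply, map_mul, sub_eq_zero] at this ⊢
    rw [mul_assoc, this]
    noncomm_ring
  have hcomm (y : A) := hP.moduleDefect_commutator y s t
  have htwo := hP.two_smul_moduleDefect_mul x (s * t - t * s) r
  rw [hmul _ hcomm, hcomm, two_smul] at htwo
  simp only [mul_zero, zero_mul, add_zero] at htwo
  exact (add_left_cancel htwo).symm

theorem moduleDefect_mul (hP : IsContractiveRetraction i P) (x : A) (s t : B) :
    moduleDefect i P x (s * t) = s * moduleDefect i P x t + t * moduleDefect i P x s := by
  refine smul_right_injective B (two_ne_zero (α := ℂ)) ?_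
  change (2 : ℂ) • moduleDefect i P x (s * t) = (2 : ℂ) • _
  rw [hP.two_smul_moduleDefect_mul, (hP.commute_moduleDefect x t s).eq,
    (hP.commute_moduleDefect x s t).eq, two_smul]

theorem moduleDefect_pow_succ (hP : IsContractiveRetraction i P) (x : A) (u : B) (n : ℕ) :
    moduleDefect i P x (u ^ (n + 1)) = ((n : ℂ) + 1) • (u ^ n * moduleDefect i P x u) := by
  induction n with
  | zero => simp
  | succ n ih =>
    rw [pow_succ' u (n + 1), hP.moduleDefect_mul, ih, mul_smul_comm, ← mul_assoc, ← pow_succ',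
      Nat.cast_succ]
    simp only [add_smul, one_smul]

theorem norm_moduleDefect_unitary_le (hP : IsContractiveRetraction i P) (x : A) {u : B}
    (hu : u ∈ unitary B) : ‖moduleDefect i P x u‖ ≤ 2 * ‖x‖ := by
  rw [moduleDefect_apply, two_mul]
  refine (norm_sub_le _ _).trans (add_le_add ?_ ?_)
  · exact (hP.norm_apply_le _).trans_eq (CStarRing.norm_mem_unitary_mul _ (Unitary.map_mem i hu))
  · exact (CStarRing.norm_mem_unitary_mul _ hu).trans_le (hP.norm_apply_le x)

-- The defect grows linearly along the powers of a unitary, but it is bounded on unitaries.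
theorem moduleDefect_unitary (hP : IsContractiveRetraction i P) (x : A) {u : B}
    (hu : u ∈ unitary B) : moduleDefect i P x u = 0 := by
  have hbound (n : ℕ) : ((n : ℝ) + 1) * ‖moduleDefect i P x u‖ ≤ 2 * ‖x‖ := by
    calc ((n : ℝ) + 1) * ‖moduleDefect i P x u‖ = ‖moduleDefect i P x (u ^ (n + 1))‖ := by
          rw [hP.moduleDefect_pow_succ, norm_smul, CStarRing.norm_mem_unitary_mul _ (pow_mem hu n)]
          congr 1
          exact_mod_cast (Complex.norm_natCast (n + 1)).symm
      _ ≤ 2 * ‖x‖ := hP.norm_moduleDefect_unitary_le x (pow_mem hu _)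
  by_contra hne
  have hpos : 0 < ‖moduleDefect i P x u‖ := norm_pos_iff.2 hne
  obtain ⟨n, hn⟩ := exists_nat_gt (2 * ‖x‖ / ‖moduleDefect i P x u‖)
  rw [div_lt_iff₀ hpos] at hn
  nlinarith [hbound n]

theorem map_mul_left (hP : IsContractiveRetraction i P) (s : B) (x : A) :
    P (i s * x) = s * P x := by
  have hspan : Submodule.span ℂ (unitary B : Set B) ≤ (moduleDefect i P x).ker :=
    Submodule.span_le.2 fun u hu => hP.moduleDefect_unitary x hu
  rw [CStarAlgebra.span_unitary] at hspan
  exact sub_eq_zero.1 (hspan (Submodule.mem_top (x := s)))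

theorem map_mul_right (hP : IsContractiveRetraction i P) (s : B) (x : A) :
    P (x * i s) = P x * s := by
  have h := hP.map_jordan s x
  rw [map_add, hP.map_mul_left] at h
  exact add_left_cancel h

end IsContractiveRetraction

end Tomiyama

section CompletelyBounded

section UnitalPositive

variable {A B : Type*} [CStarAlgebra A] [PartialOrder A] [StarOrderedRing A]
  [CStarAlgebra B] [PartialOrder B] [StarOrderedRing B] {φ : A →ₗ[ℂ] B}

theorem norm_map_le_of_unital_nonneg_of_isSelfAdjoint (h1 : φ 1 = 1) (hφ : ∀ a, 0 ≤ a → 0 ≤ φ a)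
    {a : A} (ha : IsSelfAdjoint a) : ‖φ a‖ ≤ ‖a‖ := by
  rcases subsingleton_or_nontrivial B with _ | _
  · rw [Subsingleton.elim (φ a) 0, norm_zero]
    exact norm_nonneg _
  have hreal (r : ℝ) : φ (algebraMap ℝ A r) = algebraMap ℝ B r := by
    rw [Algebra.algebraMap_eq_smul_one, Algebra.algebraMap_eq_smul_one, φ.map_smul_of_tower, h1]
  have hle : φ a ≤ algebraMap ℝ B ‖a‖ := by
    have := hφ _ (sub_nonneg.2 ha.le_algebraMap_norm_self)
    rwa [map_sub, hreal, sub_nonneg] at this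
  have hge : algebraMap ℝ B (-‖a‖) ≤ φ a := by
    have := hφ _ (sub_nonneg.2 ha.neg_algebraMap_norm_le_self)
    rwa [map_sub, map_neg, hreal, sub_nonneg, ← map_neg] at this
  have hsa : IsSelfAdjoint (φ a) := by
    have hnorm : IsSelfAdjoint (algebraMap ℝ B ‖a‖) := .algebraMap B (.all _)
    simpa using hnorm.sub (IsSelfAdjoint.of_nonneg (sub_nonneg.2 hle))
  obtain ⟨r, hr, habs⟩ := exists_mem_spectrum_abs_eq_norm hsa
  rw [← habs, abs_le]
  exact ⟨(algebraMap_le_iff_le_spectrum (R := ℝ) hsa).1 hge r hr,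
    (le_algebraMap_iff_spectrum_le (R := ℝ) hsa).1 hle r hr⟩

theorem norm_map_le_of_unital_nonneg (h1 : φ 1 = 1) (hφ : ∀ a, 0 ≤ a → 0 ≤ φ a) (a : A) :
    ‖φ a‖ ≤ 2 * ‖a‖ := by
  calc ‖φ a‖ = ‖φ (realPart a) + Complex.I • φ (imaginaryPart a)‖ := by
        conv_lhs => rw [← realPart_add_I_smul_imaginaryPart a, map_add, map_smul]
    _ ≤ ‖φ (realPart a)‖ + ‖φ (imaginaryPart a)‖ := by
        refine (norm_add_le _ _).trans_eq ?_
        rw [norm_smul, Complex.norm_I, one_mul]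
    _ ≤ ‖a‖ + ‖a‖ := add_le_add
        ((norm_map_le_of_unital_nonneg_of_isSelfAdjoint h1 hφ (realPart a).2).trans
          (realPart.norm_le a))
        ((norm_map_le_of_unital_nonneg_of_isSelfAdjoint h1 hφ (imaginaryPart a).2).trans
          (imaginaryPart.norm_le a))
    _ = 2 * ‖a‖ := (two_mul _).symm

end UnitalPositive

theorem cstarMatrix_mapₗ_one {R S T n : Type*} [DecidableEq n] [Semiring R] [NonAssocSemiring S]
    [NonAssocSemiring T] [Module R S] [Module R T] {φ : S →ₗ[R] T} (h1 : φ 1 = 1) :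
    CStarMatrix.mapₗ φ (1 : CStarMatrix n n S) = 1 := by
  ext r s
  rcases eq_or_ne r s with rfl | h
  · simp [CStarMatrix.mapₗ, CStarMatrix.map_apply, h1]
  · simp [CStarMatrix.mapₗ, CStarMatrix.map_apply, h]

attribute [local instance] CStarAlgebra.spectralOrder CStarAlgebra.spectralOrderedRing

variable {A B C : Type*} [CStarAlgebra A] [CStarAlgebra B] [CStarAlgebra C]

theorem isCompletelyPositive_starAlgHom (φ : A →⋆ₐ[ℂ] B) :
    IsCompletelyPositive φ.toAlgHom.toLinearMap :=
  ⟨CompletelyPositiveMapClass.toCompletelyPositiveLinearMap φ, fun _ => rfl⟩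

theorem IsCompletelyPositive.comp {ψ : B →ₗ[ℂ] C} {φ : A →ₗ[ℂ] B}
    (hψ : IsCompletelyPositive ψ) (hφ : IsCompletelyPositive φ) :
    IsCompletelyPositive (ψ ∘ₗ φ) := by
  obtain ⟨φ', hφ'⟩ := hφ
  obtain ⟨ψ', hψ'⟩ := hψ
  refine ⟨{ ψ ∘ₗ φ with map_cstarMatrix_nonneg' := fun k M hM => ?_ }, fun a => rfl⟩
  convert ψ'.map_cstarMatrix_nonneg _ (φ'.map_cstarMatrix_nonneg M hM) using 1
  ext r s
  simp [CStarMatrix.map_apply, hφ', hψ']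

theorem IsCompletelyPositive.isCompletelyBounded {φ : A →ₗ[ℂ] B} (hφ : IsCompletelyPositive φ)
    (h1 : φ 1 = 1) : IsCompletelyBounded φ := by
  obtain ⟨φ', hφ'⟩ := hφ
  refine ⟨2, fun n M => norm_map_le_of_unital_nonneg (cstarMatrix_mapₗ_one h1) (fun N hN => ?_) M⟩
  convert φ'.map_cstarMatrix_nonneg N hN using 1
  ext r s
  simp [CStarMatrix.mapₗ, CStarMatrix.map_apply, hφ']

theorem isCompletelyBounded_starAlgHom (φ : A →⋆ₐ[ℂ] B) :
    IsCompletelyBounded φ.toAlgHom.toLinearMap :=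
  (isCompletelyPositive_starAlgHom φ).isCompletelyBounded (map_one φ)

theorem IsCompletelyBounded.comp {ψ : B →ₗ[ℂ] C} {φ : A →ₗ[ℂ] B}
    (hψ : IsCompletelyBounded ψ) (hφ : IsCompletelyBounded φ) :
    IsCompletelyBounded (ψ ∘ₗ φ) := by
  obtain ⟨c, hc⟩ := hφ
  obtain ⟨d, hd⟩ := hψ
  refine ⟨|d| * c, fun n M => ?_⟩
  calc ‖(M.map φ).map ψ‖ ≤ d * ‖M.map φ‖ := hd n _
    _ ≤ |d| * (c * ‖M‖) := mul_le_mul (le_abs_self d) (hc n M) (norm_nonneg _) (abs_nonneg d)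
    _ = |d| * c * ‖M‖ := (mul_assoc _ _ _).symm

theorem norm_cstarMatrix_toOneByOne (a : A) :
    ‖CStarMatrix.toOneByOne (Fin 1) ℂ A a‖ = ‖a‖ :=
  NonUnitalStarAlgHom.norm_map (CStarMatrix.toOneByOne (Fin 1) ℂ A).toStarAlgHom
    (CStarMatrix.toOneByOne (Fin 1) ℂ A).injective a

theorem IsCompletelyBounded.continuous {φ : A →ₗ[ℂ] B} (hφ : IsCompletelyBounded φ) :
    Continuous φ := by
  obtain ⟨c, hc⟩ := hφ
  refine AddMonoidHomClass.continuous_of_bound φ c fun a => ?_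
  rw [← norm_cstarMatrix_toOneByOne (φ a), ← norm_cstarMatrix_toOneByOne a]
  exact hc 1 (CStarMatrix.toOneByOne (Fin 1) ℂ A a)

namespace IsContractiveRetraction

variable {i : B →⋆ₐ[ℂ] A} {P : A →ₗ[ℂ] B}

open WithCStarModule in
theorem norm_cstarMatrix_map_le (hP : IsContractiveRetraction i P) {n : Type*} [Fintype n]
    (M : CStarMatrix n n A) : ‖M.map P‖ ≤ ‖M‖ := by
  refine CStarMatrix.norm_le_of_forall_inner_le (C := ‖M‖₊) fun v w => ?_
  let lift : C⋆ᵐᵒᵈ(B, n → B) → C⋆ᵐᵒᵈ(A, n → A) := fun v => (equiv _ _).symm fun j => i (v j)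
  have hlift (v) : ‖lift v‖ = ‖v‖ := by
    have hsum : (∑ j, ⟪lift v j, lift v j⟫_A) = i (∑ j, ⟪v j, v j⟫_B) := by
      simp [lift, inner_def, StarHomClass.map_star]
    rw [pi_norm, pi_norm, hsum,
      NonUnitalStarAlgHom.norm_map i (Function.LeftInverse.injective hP.apply_incl)]
  have hinner : ⟪w, CStarMatrix.toCLM (M.map P) v⟫_B =
      P ⟪lift w, CStarMatrix.toCLM M (lift v)⟫_A := by
    simp only [CStarMatrix.toCLM_apply_eq_sum, pi_inner, equiv_symm_pi_apply, inner_def, lift,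
      map_sum, ← StarHomClass.map_star, hP.map_mul_right, hP.map_mul_left, CStarMatrix.map_apply]
  calc ‖⟪w, CStarMatrix.toCLM (M.map P) v⟫_B‖
      ≤ ‖⟪lift w, CStarMatrix.toCLM M (lift v)⟫_A‖ := hinner ▸ hP.norm_apply_le _
    _ ≤ ‖lift w‖ * (‖M‖ * ‖lift v‖) := (CStarModule.norm_inner_le _).trans
        (mul_le_mul_of_nonneg_left ((CStarMatrix.toCLM M).le_opNorm _) (norm_nonneg _))
    _ = ‖M‖₊ * ‖v‖ * ‖w‖ := by rw [hlift, hlift, coe_nnnorm, mul_comm]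

theorem isCompletelyBounded (hP : IsContractiveRetraction i P) : IsCompletelyBounded P :=
  ⟨1, fun _ M => (hP.norm_cstarMatrix_map_le M).trans_eq (one_mul _).symm⟩

theorem isCompletelyPositive (hP : IsContractiveRetraction i P) : IsCompletelyPositive P := by
  refine ⟨{ P with map_cstarMatrix_nonneg' := fun k M hM => ?_ }, fun _ => rfl⟩
  exact map_nonneg_of_unital_contraction (φ := CStarMatrix.mapₗ P)
    (cstarMatrix_mapₗ_one hP.map_one) hP.norm_cstarMatrix_map_le hM

end IsContractiveRetraction

end CompletelyBounded

section MatrixRepresentation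

variable {A C H L ι : Type*} [CStarAlgebra A] [CStarAlgebra C] [Fintype ι]
  [NormedAddCommGroup H] [InnerProductSpace ℂ H] [NormedAddCommGroup L] [InnerProductSpace ℂ L]

/-- The operator on the Hilbert sum `H ^ ι` given by an `ι × ι` matrix of operators on `H`. -/
def matrixOp (T : ι → ι → H →L[ℂ] H) :
    PiLp 2 (fun _ : ι => H) →L[ℂ] PiLp 2 (fun _ : ι => H) :=
  (PiLp.continuousLinearEquiv 2 ℂ (fun _ : ι => H)).symm.toContinuousLinearMap ∘L
    ContinuousLinearMap.pi fun r => ∑ j, T r j ∘L PiLp.proj 2 (fun _ : ι => H) j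

theorem matrixOp_apply (T : ι → ι → H →L[ℂ] H) (x : PiLp 2 (fun _ : ι => H)) (r : ι) :
    matrixOp T x r = ∑ j, T r j (x j) := by
  simp [matrixOp]

theorem inner_matrixOp (T : ι → ι → H →L[ℂ] H) (x y : PiLp 2 (fun _ : ι => H)) :
    ⟪y, matrixOp T x⟫_ℂ = ∑ r, ∑ j, ⟪y r, T r j (x j)⟫_ℂ := by
  simp [PiLp.inner_apply, matrixOp_apply, inner_sum]

variable [CompleteSpace H] [CompleteSpace L]

/-- The amplification of a representation of `A` on `H` to a representation of the C⋆-algebra of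
`ι × ι` matrices over `A` on the Hilbert sum `H ^ ι`. -/
def matrixRep (ι : Type*) [Fintype ι] (π : A →⋆ₐ[ℂ] (H →L[ℂ] H)) :
    CStarMatrix ι ι A →⋆ₙₐ[ℂ] (PiLp 2 (fun _ : ι => H) →L[ℂ] PiLp 2 (fun _ : ι => H)) where
  toFun M := matrixOp fun r j => π (M r j)
  map_smul' c M := by
    ext x r
    simp [matrixOp_apply, Finset.smul_sum]
  map_zero' := by
    ext x r
    simp [matrixOp_apply]
  map_add' M N := by
    ext x r
    simp [matrixOp_apply, Finset.sum_add_distrib]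
  map_mul' M N := by
    ext x r
    simp only [matrixOp_apply, CStarMatrix.mul_apply, map_sum, map_mul,
      sum_apply, mul_apply_eq_comp]
    exact Finset.sum_comm
  map_star' M := by
    rw [ContinuousLinearMap.star_eq_adjoint, ContinuousLinearMap.eq_adjoint_iff]
    intro x y
    rw [← inner_conj_symm, inner_matrixOp, inner_matrixOp, Finset.sum_comm, map_sum]
    refine Finset.sum_congr rfl fun r _ => ?_
    rw [map_sum]
    refine Finset.sum_congr rfl fun j _ => ?_
    rw [inner_conj_symm, CStarMatrix.star_apply, map_star, ContinuousLinearMap.star_eq_adjoint,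
      ContinuousLinearMap.adjoint_inner_left]

theorem matrixRep_apply (π : A →⋆ₐ[ℂ] (H →L[ℂ] H)) (M : CStarMatrix ι ι A) :
    matrixRep ι π M = matrixOp fun r j => π (M r j) := rfl

theorem matrixRep_injective {π : A →⋆ₐ[ℂ] (H →L[ℂ] H)} (hπ : Function.Injective π) :
    Function.Injective (matrixRep ι π) := by
  classical
  refine (injective_iff_map_eq_zero _).2 fun M hM => CStarMatrix.ext fun r j => hπ ?_
  rw [CStarMatrix.zero_apply, map_zero]
  ext x
  have := congrArg (fun T => T (PiLp.single 2 j x) r) hM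
  simpa [matrixRep_apply, matrixOp_apply, apply_ite, PiLp.single_apply, Pi.single_apply] using this

attribute [local instance] CStarAlgebra.spectralOrder CStarAlgebra.spectralOrderedRing

/-- Complete boundedness of `φ` with constant `c`, expressed through representations of its domain
and codomain: the form in which it bounds operators on Hilbert tensor products. -/
structure IsCompletelyBoundedBy (π : A →⋆ₐ[ℂ] (H →L[ℂ] H)) (τ : C →⋆ₐ[ℂ] (L →L[ℂ] L))
    (φ : A →ₗ[ℂ] C) (c : ℝ) : Prop where
  nonneg : 0 ≤ c
  norm_matrixRep_map_le : ∀ (n : ℕ) (M : CStarMatrix (Fin n) (Fin n) A),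
    ‖matrixRep (Fin n) τ (M.map φ)‖ ≤ c * ‖matrixRep (Fin n) π M‖

theorem isCompletelyBoundedBy_of_norm_map_le {π : A →⋆ₐ[ℂ] (H →L[ℂ] H)}
    (hπ : Function.Injective π) (τ : C →⋆ₐ[ℂ] (L →L[ℂ] L)) {φ : A →ₗ[ℂ] C} {c : ℝ} (hc : 0 ≤ c)
    (h : ∀ (n : ℕ) (M : CStarMatrix (Fin n) (Fin n) A), ‖M.map φ‖ ≤ c * ‖M‖) :
    IsCompletelyBoundedBy π τ φ c := by
  refine ⟨hc, fun n M => ?_⟩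
  rw [NonUnitalStarAlgHom.norm_map (matrixRep (Fin n) π) (matrixRep_injective hπ)]
  exact (NonUnitalStarAlgHom.norm_apply_le _ _).trans (h n M)

theorem IsCompletelyBounded.exists_isCompletelyBoundedBy {φ : A →ₗ[ℂ] C}
    (hφ : IsCompletelyBounded φ) {π : A →⋆ₐ[ℂ] (H →L[ℂ] H)} (hπ : Function.Injective π)
    (τ : C →⋆ₐ[ℂ] (L →L[ℂ] L)) : ∃ c, IsCompletelyBoundedBy π τ φ c := by
  obtain ⟨c, hc⟩ := hφ
  exact ⟨|c|, isCompletelyBoundedBy_of_norm_map_le hπ τ (abs_nonneg c) fun n M =>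
    (hc n M).trans (mul_le_mul_of_nonneg_right (le_abs_self c) (norm_nonneg M))⟩

theorem IsContractiveRetraction.isCompletelyBoundedBy_one {i : C →⋆ₐ[ℂ] A} {P : A →ₗ[ℂ] C}
    (hP : IsContractiveRetraction i P) {π : A →⋆ₐ[ℂ] (H →L[ℂ] H)} (hπ : Function.Injective π)
    (τ : C →⋆ₐ[ℂ] (L →L[ℂ] L)) : IsCompletelyBoundedBy π τ P 1 :=
  isCompletelyBoundedBy_of_norm_map_le hπ τ zero_le_one fun _ M =>
    (hP.norm_cstarMatrix_map_le M).trans_eq (one_mul _).symm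

end MatrixRepresentation

section ColumnTensor

variable {L K ι : Type*} [NormedAddCommGroup L] [InnerProductSpace ℂ L]
  [NormedAddCommGroup K] [InnerProductSpace ℂ K] [Fintype ι]

/-- The vector `∑ j, ξ j ⊗ f j`. For an orthonormal family `f` this embeds the Hilbert sum `L ^ ι`
isometrically into `L ⊗ K`, so that matrices of operators on `L` give estimates on `L ⊗ K`. -/
def columnTensor (f : ι → K) (ξ : PiLp 2 (fun _ : ι => L)) : L ⊗[ℂ] K :=
  ∑ j, ξ j ⊗ₜ[ℂ] f j

theorem columnTensor_add (f : ι → K) (ξ η : PiLp 2 (fun _ : ι => L)) :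
    columnTensor f (ξ + η) = columnTensor f ξ + columnTensor f η := by
  simp [columnTensor, TensorProduct.add_tmul, Finset.sum_add_distrib]

theorem norm_columnTensor {f : ι → K} (hf : Orthonormal ℂ f) (ξ : PiLp 2 (fun _ : ι => L)) :
    ‖columnTensor f ξ‖ = ‖ξ‖ := by
  classical
  have hinner : ⟪columnTensor f ξ, columnTensor f ξ⟫_ℂ = ⟪ξ, ξ⟫_ℂ := by
    simp only [columnTensor, sum_inner, inner_sum, TensorProduct.inner_tmul, PiLp.inner_apply]
    refine Finset.sum_congr rfl fun j _ => ?_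
    simp [orthonormal_iff_ite.1 hf]
  rw [@norm_eq_sqrt_re_inner ℂ, @norm_eq_sqrt_re_inner ℂ, hinner]

theorem exists_columnTensor_eq_lTensor_subtype {F : Submodule ℂ K} (b : OrthonormalBasis ι ℂ F)
    (u : L ⊗[ℂ] F) : ∃ ξ, columnTensor (fun j => (b j : K)) ξ = F.subtype.lTensor L u := by
  induction u using TensorProduct.induction_on with
  | zero => exact ⟨0, by simp [columnTensor]⟩
  | tmul x y =>
    refine ⟨WithLp.toLp 2 fun j => ⟪b j, y⟫_ℂ • x, ?_⟩
    rw [LinearMap.lTensor_tmul]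
    conv_rhs => rw [← b.sum_repr' y, map_sum, TensorProduct.tmul_sum]
    simp [columnTensor, TensorProduct.smul_tmul]
  | add x y hx hy =>
    obtain ⟨ξ, hξ⟩ := hx
    obtain ⟨η, hη⟩ := hy
    exact ⟨ξ + η, by rw [columnTensor_add, hξ, hη, map_add]⟩

theorem exists_columnTensor_eq (v w : L ⊗[ℂ] K) :
    ∃ (n : ℕ) (f : Fin n → K), Orthonormal ℂ f ∧
      (∃ ξ, columnTensor f ξ = v) ∧ ∃ η, columnTensor f η = w := by
  obtain ⟨F, hF, hvw⟩ := TensorProduct.exists_finite_submodule_right_of_setFinite {v, w}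
    (Set.toFinite _)
  obtain ⟨u, rfl⟩ := hvw (Set.mem_insert v _)
  obtain ⟨u', rfl⟩ := hvw (Set.mem_insert_of_mem _ rfl)
  let b := stdOrthonormalBasis ℂ F
  exact ⟨_, fun j => (b j : K), b.orthonormal.comp_linearIsometry F.subtypeₗᵢ,
    exists_columnTensor_eq_lTensor_subtype b u, exists_columnTensor_eq_lTensor_subtype b u'⟩

end ColumnTensor

section OpTensor

variable {H K L : Type*} [NormedAddCommGroup H] [InnerProductSpace ℂ H]
  [NormedAddCommGroup K] [InnerProductSpace ℂ K] [NormedAddCommGroup L] [InnerProductSpace ℂ L]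

theorem HilbertTensor.ofAlg_tmul (x : H) (y : K) :
    HilbertTensor.ofAlg (x ⊗ₜ[ℂ] y) = hTmul x y := rfl

theorem norm_hTmul (x : H) (y : K) : ‖hTmul x y‖ = ‖x‖ * ‖y‖ := by
  rw [hTmul, HilbertTensor.ofAlg.norm_map, TensorProduct.norm_tmul]

theorem HilbertTensor.clm_ext_tmul {f g : HilbertTensor H K →L[ℂ] HilbertTensor H K}
    (h : ∀ x y, f (hTmul x y) = g (hTmul x y)) : f = g :=
  HilbertTensor.clm_ext fun x => by
    induction x using TensorProduct.induction_on with
    | zero => simp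
    | tmul x y => exact h x y
    | add x y hx hy => simp only [map_add, hx, hy]

theorem HilbertTensor.opNorm_le_of_inner_ofAlg {T : HilbertTensor H K →L[ℂ] HilbertTensor H K}
    {c : ℝ} (hc : 0 ≤ c) (h : ∀ v w : H ⊗[ℂ] K,
      ‖⟪HilbertTensor.ofAlg w, T (HilbertTensor.ofAlg v)⟫_ℂ‖ ≤ c * ‖v‖ * ‖w‖) : ‖T‖ ≤ c := by
  have hbound (x y : HilbertTensor H K) : ‖⟪y, T x⟫_ℂ‖ ≤ c * ‖x‖ * ‖y‖ := by
    refine HilbertTensor.denseRange_ofAlg.induction_on₂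
      (p := fun x y => ‖⟪y, T x⟫_ℂ‖ ≤ c * ‖x‖ * ‖y‖) (isClosed_le (by fun_prop) (by fun_prop))
      (fun v w => ?_) x y
    rw [HilbertTensor.ofAlg.norm_map, HilbertTensor.ofAlg.norm_map]
    exact h v w
  refine T.opNorm_le_of_re_inner_le hc fun x y hx hy => (RCLike.re_le_norm _).trans ?_
  simpa [norm_inner_symm, hx, hy] using hbound x y

theorem opTensor_mul (T T' : H →L[ℂ] H) (S S' : K →L[ℂ] K) :
    opTensor T S * opTensor T' S' = opTensor (T * T') (S * S') :=
  HilbertTensor.clm_ext_tmul fun x y => by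
    simp [mul_apply_eq_comp, opTensor_hTmul]

theorem opTensor_one : opTensor (1 : H →L[ℂ] H) (1 : K →L[ℂ] K) = 1 :=
  HilbertTensor.clm_ext_tmul fun x y => by
    simp [opTensor_hTmul]

theorem inner_opTensor_star_left [CompleteSpace H] [CompleteSpace K] (T : H →L[ℂ] H)
    (S : K →L[ℂ] K) (v w : H ⊗[ℂ] K) :
    ⟪opTensor (star T) (star S) (HilbertTensor.ofAlg v), HilbertTensor.ofAlg w⟫_ℂ =
      ⟪HilbertTensor.ofAlg v, opTensor T S (HilbertTensor.ofAlg w)⟫_ℂ := by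
  induction v using TensorProduct.induction_on with
  | zero => simp
  | add v v' hv hv' => simp only [map_add, inner_add_left, hv, hv']
  | tmul a b =>
    induction w using TensorProduct.induction_on with
    | zero => simp
    | add v v' hv hv' => simp only [map_add, inner_add_right, hv, hv']
    | tmul c d =>
      change ⟪opTensor (star T) (star S) (hTmul a b), hTmul c d⟫_ℂ =
        ⟪hTmul a b, opTensor T S (hTmul c d)⟫_ℂ
      simp [opTensor_hTmul, inner_hTmul, ContinuousLinearMap.star_eq_adjoint,
        ContinuousLinearMap.adjoint_inner_left]

theorem star_opTensor [CompleteSpace H] [CompleteSpace K] (T : H →L[ℂ] H) (S : K →L[ℂ] K) :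
    star (opTensor T S) = opTensor (star T) (star S) := by
  symm
  rw [ContinuousLinearMap.star_eq_adjoint (opTensor T S), ContinuousLinearMap.eq_adjoint_iff]
  intro x y
  exact HilbertTensor.denseRange_ofAlg.induction_on₂
    (p := fun x y => ⟪opTensor (star T) (star S) x, y⟫_ℂ = ⟪x, opTensor T S y⟫_ℂ)
    (isClosed_eq (by fun_prop) (by fun_prop)) (inner_opTensor_star_left T S) x y

theorem norm_opTensor_le (T : H →L[ℂ] H) (S : K →L[ℂ] K) : ‖opTensor T S‖ ≤ ‖T‖ * ‖S‖ := by
  refine ContinuousLinearMap.opNorm_le_bound _ (by positivity) fun x => ?_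
  refine HilbertTensor.denseRange_ofAlg.induction_on
    (p := fun x => ‖opTensor T S x‖ ≤ ‖T‖ * ‖S‖ * ‖x‖) x
    (isClosed_le (by fun_prop) (by fun_prop)) fun v => ?_
  rw [opTensor_ofAlg, HilbertTensor.ofAlg.norm_map, HilbertTensor.ofAlg.norm_map]
  exact (ContinuousLinearMap.le_opNorm _ _).trans
    (mul_le_mul_of_nonneg_right (TensorProduct.norm_mapL_le T S) (norm_nonneg _))

theorem norm_le_norm_opTensor_one_left [Nontrivial H] (S : K →L[ℂ] K) :
    ‖S‖ ≤ ‖opTensor (1 : H →L[ℂ] H) S‖ := by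
  refine S.opNorm_le_bound (norm_nonneg _) fun y => ?_
  obtain ⟨x, hx⟩ := exists_ne (0 : H)
  have h := (opTensor (1 : H →L[ℂ] H) S).le_opNorm (hTmul x y)
  rw [opTensor_hTmul, norm_hTmul, norm_hTmul, mul_left_comm] at h
  exact le_of_mul_le_mul_left h (norm_pos_iff.2 hx)

theorem topologicalClosure_span_range_id :
    (Submodule.span ℂ (Set.range fun x : H => x)).topologicalClosure = ⊤ := by
  rw [Set.range_id', Submodule.span_univ]
  exact top_unique (Submodule.le_topologicalClosure _)

theorem hTmul_assoc_total : (Submodule.span ℂ (Set.range fun p : H × K × L =>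
    hTmul p.1 (hTmul p.2.1 p.2.2))).topologicalClosure = ⊤ :=
  hTmul_total (v := fun x : H => x) topologicalClosure_span_range_id
    (w := fun p : K × L => hTmul p.1 p.2)
    (hTmul_total (v := fun x : K => x) (w := fun x : L => x) topologicalClosure_span_range_id
      topologicalClosure_span_range_id)

theorem exists_isometry_assoc :
    ∃ W : HilbertTensor H (HilbertTensor K L) →ₗᵢ[ℂ] HilbertTensor (HilbertTensor H K) L,
      ∀ x y z, W (hTmul x (hTmul y z)) = hTmul (hTmul x y) z := by
  obtain ⟨W, hW⟩ := exists_isometry_of_gram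
    (w := fun p : H × K × L => hTmul (hTmul p.1 p.2.1) p.2.2) hTmul_assoc_total
    (by simp [inner_hTmul, mul_assoc])
  exact ⟨W, fun x y z => hW (x, y, z)⟩

end OpTensor

theorem mem_span_of_mem_starAlgebra_adjoin {R : Type*} [Ring R] [StarRing R] [Algebra ℂ R]
    [StarModule ℂ R] {E : Submonoid R} (hE : star (E : Set R) ⊆ E) {T : R}
    (hT : T ∈ StarAlgebra.adjoin ℂ (E : Set R)) : T ∈ Submodule.span ℂ (E : Set R) := by
  rwa [← StarSubalgebra.mem_toSubalgebra, StarAlgebra.adjoin_toSubalgebra,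
    Set.union_eq_left.2 hE, ← Subalgebra.mem_toSubmodule, Algebra.adjoin_eq_span,
    Submonoid.closure_eq] at hT

namespace spatialTensor

variable {A B C D H K L M ι : Type*} [CStarAlgebra A] [CStarAlgebra B] [CStarAlgebra C]
  [CStarAlgebra D]
  [NormedAddCommGroup H] [InnerProductSpace ℂ H] [CompleteSpace H]
  [NormedAddCommGroup K] [InnerProductSpace ℂ K] [CompleteSpace K]
  [NormedAddCommGroup L] [InnerProductSpace ℂ L] [CompleteSpace L]
  [NormedAddCommGroup M] [InnerProductSpace ℂ M] [CompleteSpace M]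

section Dense

variable {π : A →⋆ₐ[ℂ] (H →L[ℂ] H)} {ρ : B →⋆ₐ[ℂ] (K →L[ℂ] K)}

theorem coe_ofAlg_tmul (a : A) (b : B) :
    (ofAlg π ρ (a ⊗ₜ b) : HilbertTensor H K →L[ℂ] HilbertTensor H K) = opTensor (π a) (ρ b) := rfl

theorem exists_ofAlg_eq_of_mem_adjoin {T : HilbertTensor H K →L[ℂ] HilbertTensor H K}
    (hT : T ∈ StarAlgebra.adjoin ℂ (Set.range fun p : A × B => opTensor (π p.1) (ρ p.2))) :
    ∃ x, (ofAlg π ρ x : HilbertTensor H K →L[ℂ] HilbertTensor H K) = T := by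
  let E : Submonoid (HilbertTensor H K →L[ℂ] HilbertTensor H K) :=
    { carrier := Set.range fun p : A × B => opTensor (π p.1) (ρ p.2)
      one_mem' := ⟨1, by simp [opTensor_one]⟩
      mul_mem' := by
        rintro _ _ ⟨p, rfl⟩ ⟨q, rfl⟩
        exact ⟨p * q, by simp [opTensor_mul]⟩ }
  have hstar : star (E : Set (HilbertTensor H K →L[ℂ] HilbertTensor H K)) ⊆ E := by
    rintro T ⟨p, hp⟩
    exact ⟨star p, by simp [map_star, ← star_opTensor, hp]⟩
  refine Submodule.span_le (p := LinearMap.range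
    ((spatialTensor π ρ).subtype.toAlgHom.toLinearMap ∘ₗ ofAlg π ρ)).2 ?_
    (mem_span_of_mem_starAlgebra_adjoin (E := E) hstar hT)
  rintro _ ⟨p, rfl⟩
  exact ⟨p.1 ⊗ₜ p.2, rfl⟩

variable (π ρ) in
theorem denseRange_ofAlg : DenseRange (ofAlg π ρ) := by
  intro y
  have hy : (y : HilbertTensor H K →L[ℂ] HilbertTensor H K) ∈ closure (StarAlgebra.adjoin ℂ
    (Set.range fun p : A × B => opTensor (π p.1) (ρ p.2)) : Set _) := y.2
  rw [closure_subtype]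
  refine closure_mono (fun T hT => ?_) hy
  obtain ⟨x, hx⟩ := exists_ofAlg_eq_of_mem_adjoin hT
  exact ⟨_, ⟨x, rfl⟩, hx⟩

theorem clm_ext {V : Type*} [NormedAddCommGroup V] [NormedSpace ℂ V]
    {f g : spatialTensor π ρ →L[ℂ] V}
    (h : ∀ a b, f (ofAlg π ρ (a ⊗ₜ b)) = g (ofAlg π ρ (a ⊗ₜ b))) : f = g := by
  have hfg : f.toLinearMap ∘ₗ ofAlg π ρ = g.toLinearMap ∘ₗ ofAlg π ρ := TensorProduct.ext' h
  exact ContinuousLinearMap.ext fun x => (denseRange_ofAlg π ρ).induction_on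
    (p := fun x => f x = g x) x (isClosed_eq f.continuous g.continuous) (LinearMap.congr_fun hfg)

end Dense

section Slice

/-- The slice map `a ⊗ b ↦ ⟪f, ρ(b) g⟫ a`. -/
def slice (A : Type*) [CStarAlgebra A] (ρ : B →⋆ₐ[ℂ] (K →L[ℂ] K)) (f g : K) : A ⊗[ℂ] B →ₗ[ℂ] A :=
  (TensorProduct.rid ℂ A).toLinearMap ∘ₗ TensorProduct.map LinearMap.id
    ((innerSL ℂ f).toLinearMap ∘ₗ (ContinuousLinearMap.apply ℂ K g).toLinearMap ∘ₗ
      ρ.toAlgHom.toLinearMap)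

theorem slice_tmul (ρ : B →⋆ₐ[ℂ] (K →L[ℂ] K)) (f g : K) (a : A) (b : B) :
    slice A ρ f g (a ⊗ₜ b) = ⟪f, ρ b g⟫_ℂ • a := rfl

theorem slice_map_left (φ : A →ₗ[ℂ] C) (ρ : B →⋆ₐ[ℂ] (K →L[ℂ] K)) (f g : K) (x : A ⊗[ℂ] B) :
    slice C ρ f g (TensorProduct.map φ LinearMap.id x) = φ (slice A ρ f g x) := by
  refine LinearMap.congr_fun (f := slice C ρ f g ∘ₗ TensorProduct.map φ LinearMap.id)
    (g := φ ∘ₗ slice A ρ f g) (TensorProduct.ext' fun a b => ?_) x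
  simp [slice_tmul]

/-- The matrix of slices of an element of `A ⊙ B` along a family of vectors. -/
def sliceMatrix (ρ : B →⋆ₐ[ℂ] (K →L[ℂ] K)) (f : ι → K) (x : A ⊗[ℂ] B) : CStarMatrix ι ι A :=
  CStarMatrix.ofMatrix fun r j => slice A ρ (f r) (f j) x

theorem sliceMatrix_apply (ρ : B →⋆ₐ[ℂ] (K →L[ℂ] K)) (f : ι → K) (x : A ⊗[ℂ] B) (r j : ι) :
    sliceMatrix ρ f x r j = slice A ρ (f r) (f j) x := rfl

theorem sliceMatrix_map_left (φ : A →ₗ[ℂ] C) (ρ : B →⋆ₐ[ℂ] (K →L[ℂ] K)) (f : ι → K)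
    (x : A ⊗[ℂ] B) :
    sliceMatrix ρ f (TensorProduct.map φ LinearMap.id x) = (sliceMatrix ρ f x).map φ :=
  CStarMatrix.ext fun _ _ => slice_map_left φ ρ _ _ x

variable [Fintype ι]

theorem inner_ofAlg_columnTensor (π : A →⋆ₐ[ℂ] (H →L[ℂ] H)) (ρ : B →⋆ₐ[ℂ] (K →L[ℂ] K))
    (f : ι → K) (x : A ⊗[ℂ] B) (ξ η : PiLp 2 (fun _ : ι => H)) :
    ⟪HilbertTensor.ofAlg (columnTensor f η),
      (ofAlg π ρ x : HilbertTensor H K →L[ℂ] HilbertTensor H K)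
        (HilbertTensor.ofAlg (columnTensor f ξ))⟫_ℂ =
      ⟪η, matrixRep ι π (sliceMatrix ρ f x) ξ⟫_ℂ := by
  rw [matrixRep_apply, inner_matrixOp]
  simp only [sliceMatrix_apply]
  induction x using TensorProduct.induction_on with
  | zero => simp
  | add x y hx hy =>
    simp only [map_add, AddMemClass.coe_add, _root_.add_apply, inner_add_right,
      Finset.sum_add_distrib, hx, hy]
  | tmul a b =>
    simp only [coe_ofAlg_tmul, columnTensor, map_sum, HilbertTensor.ofAlg_tmul, opTensor_hTmul,
      sum_inner, inner_sum, inner_hTmul, slice_tmul, map_smul, _root_.smul_apply, inner_smul_right]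
    rw [Finset.sum_comm]
    exact Finset.sum_congr rfl fun r _ => Finset.sum_congr rfl fun j _ => mul_comm _ _

theorem norm_matrixRep_sliceMatrix_le (π : A →⋆ₐ[ℂ] (H →L[ℂ] H)) (ρ : B →⋆ₐ[ℂ] (K →L[ℂ] K))
    {f : ι → K} (hf : Orthonormal ℂ f) (x : A ⊗[ℂ] B) :
    ‖matrixRep ι π (sliceMatrix ρ f x)‖ ≤ ‖ofAlg π ρ x‖ := by
  refine ContinuousLinearMap.opNorm_le_of_re_inner_le (norm_nonneg _) fun ξ η hξ hη => ?_
  have hcol (ζ : PiLp 2 (fun _ : ι => H)) : ‖HilbertTensor.ofAlg (columnTensor f ζ)‖ = ‖ζ‖ := by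
    rw [HilbertTensor.ofAlg.norm_map, norm_columnTensor hf]
  rw [inner_re_symm, ← inner_ofAlg_columnTensor]
  calc _ ≤ _ := re_inner_le_norm _ _
    _ ≤ ‖HilbertTensor.ofAlg (columnTensor f η)‖ *
        (‖ofAlg π ρ x‖ * ‖HilbertTensor.ofAlg (columnTensor f ξ)‖) :=
      mul_le_mul_of_nonneg_left (ContinuousLinearMap.le_opNorm _ _) (norm_nonneg _)
    _ = ‖ofAlg π ρ x‖ := by rw [hcol, hcol, hξ, hη, one_mul, mul_one]

end Slice

section Flip

theorem inner_ofAlg_comm (π : A →⋆ₐ[ℂ] (H →L[ℂ] H)) (ρ : B →⋆ₐ[ℂ] (K →L[ℂ] K)) (x : A ⊗[ℂ] B)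
    (v w : H ⊗[ℂ] K) :
    ⟪HilbertTensor.ofAlg (TensorProduct.comm ℂ H K w),
        (ofAlg ρ π (TensorProduct.comm ℂ A B x) : HilbertTensor K H →L[ℂ] HilbertTensor K H)
          (HilbertTensor.ofAlg (TensorProduct.comm ℂ H K v))⟫_ℂ =
      ⟪HilbertTensor.ofAlg w, (ofAlg π ρ x : HilbertTensor H K →L[ℂ] HilbertTensor H K)
        (HilbertTensor.ofAlg v)⟫_ℂ := by
  induction x using TensorProduct.induction_on with
  | zero => simp
  | add x y hx hy => simp only [map_add, AddMemClass.coe_add, _root_.add_apply, inner_add_right,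
      hx, hy]
  | tmul a b =>
    induction v using TensorProduct.induction_on with
    | zero => simp
    | add x y hx hy => simp only [map_add, inner_add_right, hx, hy]
    | tmul x y =>
      induction w using TensorProduct.induction_on with
      | zero => simp
      | add x y hx hy => simp only [map_add, inner_add_left, hx, hy]
      | tmul x' y' =>
        simp only [TensorProduct.comm_tmul, coe_ofAlg_tmul, HilbertTensor.ofAlg_tmul,
          opTensor_hTmul, inner_hTmul]
        exact mul_comm _ _

theorem norm_ofAlg_le_comm (π : A →⋆ₐ[ℂ] (H →L[ℂ] H)) (ρ : B →⋆ₐ[ℂ] (K →L[ℂ] K))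
    (x : A ⊗[ℂ] B) : ‖ofAlg π ρ x‖ ≤ ‖ofAlg ρ π (TensorProduct.comm ℂ A B x)‖ := by
  refine HilbertTensor.opNorm_le_of_inner_ofAlg
    (T := (ofAlg π ρ x : HilbertTensor H K →L[ℂ] HilbertTensor H K))
    (norm_nonneg _) fun v w => ?_
  have hcomm (u : H ⊗[ℂ] K) : ‖HilbertTensor.ofAlg (TensorProduct.comm ℂ H K u)‖ = ‖u‖ :=
    (HilbertTensor.ofAlg.norm_map _).trans ((TensorProduct.commIsometry ℂ H K).norm_map u)
  rw [← inner_ofAlg_comm, ← hcomm v, ← hcomm w, mul_comm]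
  exact (norm_inner_le_norm _ _).trans
    (mul_le_mul_of_nonneg_left (ContinuousLinearMap.le_opNorm _ _) (norm_nonneg _))

theorem norm_ofAlg_comm (π : A →⋆ₐ[ℂ] (H →L[ℂ] H)) (ρ : B →⋆ₐ[ℂ] (K →L[ℂ] K)) (x : A ⊗[ℂ] B) :
    ‖ofAlg ρ π (TensorProduct.comm ℂ A B x)‖ = ‖ofAlg π ρ x‖ := by
  refine le_antisymm ?_ (norm_ofAlg_le_comm π ρ x)
  simpa only [TensorProduct.comm_comm] using
    norm_ofAlg_le_comm ρ π (TensorProduct.comm ℂ A B x)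

end Flip

section Bounds

variable {π : A →⋆ₐ[ℂ] (H →L[ℂ] H)} {ρ : B →⋆ₐ[ℂ] (K →L[ℂ] K)} {π' : C →⋆ₐ[ℂ] (L →L[ℂ] L)}
  {ρ' : D →⋆ₐ[ℂ] (M →L[ℂ] M)} {φ : A →ₗ[ℂ] C} {ψ : B →ₗ[ℂ] D} {c d : ℝ}

theorem norm_ofAlg_map_left_le (hφ : IsCompletelyBoundedBy π π' φ c) (ρ : B →⋆ₐ[ℂ] (K →L[ℂ] K))
    (x : A ⊗[ℂ] B) :
    ‖ofAlg π' ρ (TensorProduct.map φ LinearMap.id x)‖ ≤ c * ‖ofAlg π ρ x‖ := by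
  refine HilbertTensor.opNorm_le_of_inner_ofAlg
    (T := (ofAlg π' ρ (TensorProduct.map φ LinearMap.id x) :
      HilbertTensor L K →L[ℂ] HilbertTensor L K))
    (mul_nonneg hφ.nonneg (norm_nonneg _)) fun v w => ?_
  obtain ⟨n, f, hf, ⟨ξ, rfl⟩, ⟨η, rfl⟩⟩ := exists_columnTensor_eq v w
  rw [inner_ofAlg_columnTensor, sliceMatrix_map_left, norm_columnTensor hf, norm_columnTensor hf]
  have hslice : ‖matrixRep (Fin n) π' ((sliceMatrix ρ f x).map φ)‖ ≤ c * ‖ofAlg π ρ x‖ :=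
    (hφ.norm_matrixRep_map_le n _).trans
      (mul_le_mul_of_nonneg_left (norm_matrixRep_sliceMatrix_le π ρ hf x) hφ.nonneg)
  calc _ ≤ ‖η‖ * ‖matrixRep (Fin n) π' ((sliceMatrix ρ f x).map φ) ξ‖ := norm_inner_le_norm _ _
    _ ≤ ‖η‖ * (c * ‖ofAlg π ρ x‖ * ‖ξ‖) :=
      mul_le_mul_of_nonneg_left (ContinuousLinearMap.le_of_opNorm_le _ hslice ξ) (norm_nonneg _)
    _ = _ := mul_comm _ _

theorem norm_ofAlg_map_right_le (hψ : IsCompletelyBoundedBy ρ ρ' ψ d)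
    (π : A →⋆ₐ[ℂ] (H →L[ℂ] H)) (x : A ⊗[ℂ] B) :
    ‖ofAlg π ρ' (TensorProduct.map LinearMap.id ψ x)‖ ≤ d * ‖ofAlg π ρ x‖ := by
  rw [← norm_ofAlg_comm π ρ', ← norm_ofAlg_comm π ρ, ← TensorProduct.map_comm]
  exact norm_ofAlg_map_left_le hψ π _

theorem norm_ofAlg_map_le (hφ : IsCompletelyBoundedBy π π' φ c)
    (hψ : IsCompletelyBoundedBy ρ ρ' ψ d) (x : A ⊗[ℂ] B) :
    ‖ofAlg π' ρ' (TensorProduct.map φ ψ x)‖ ≤ c * d * ‖ofAlg π ρ x‖ := by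
  have hsplit : TensorProduct.map φ ψ x =
      TensorProduct.map φ LinearMap.id (TensorProduct.map LinearMap.id ψ x) := by
    rw [← LinearMap.comp_apply, ← TensorProduct.map_comp, LinearMap.comp_id, LinearMap.id_comp]
  rw [hsplit, mul_assoc]
  exact (norm_ofAlg_map_left_le hφ ρ' _).trans
    (mul_le_mul_of_nonneg_left (norm_ofAlg_map_right_le hψ π x) hφ.nonneg)

end Bounds

end spatialTensor

namespace spatialTensor

variable {A B C A₁ B₁ C₁ A₂ B₂ H K L H₁ K₁ L₁ H₂ K₂ : Type*}
  [CStarAlgebra A] [CStarAlgebra B] [CStarAlgebra C] [CStarAlgebra A₁] [CStarAlgebra B₁]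
  [CStarAlgebra C₁] [CStarAlgebra A₂] [CStarAlgebra B₂]
  [NormedAddCommGroup H] [InnerProductSpace ℂ H] [CompleteSpace H]
  [NormedAddCommGroup K] [InnerProductSpace ℂ K] [CompleteSpace K]
  [NormedAddCommGroup L] [InnerProductSpace ℂ L] [CompleteSpace L]
  [NormedAddCommGroup H₁] [InnerProductSpace ℂ H₁] [CompleteSpace H₁]
  [NormedAddCommGroup K₁] [InnerProductSpace ℂ K₁] [CompleteSpace K₁]
  [NormedAddCommGroup L₁] [InnerProductSpace ℂ L₁] [CompleteSpace L₁]
  [NormedAddCommGroup H₂] [InnerProductSpace ℂ H₂] [CompleteSpace H₂]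
  [NormedAddCommGroup K₂] [InnerProductSpace ℂ K₂] [CompleteSpace K₂]
  {π : A →⋆ₐ[ℂ] (H →L[ℂ] H)} {ρ : B →⋆ₐ[ℂ] (K →L[ℂ] K)} {τ : C →⋆ₐ[ℂ] (L →L[ℂ] L)}
  {π₁ : A₁ →⋆ₐ[ℂ] (H₁ →L[ℂ] H₁)} {ρ₁ : B₁ →⋆ₐ[ℂ] (K₁ →L[ℂ] K₁)}
  {τ₁ : C₁ →⋆ₐ[ℂ] (L₁ →L[ℂ] L₁)}
  {π₂ : A₂ →⋆ₐ[ℂ] (H₂ →L[ℂ] H₂)} {ρ₂ : B₂ →⋆ₐ[ℂ] (K₂ →L[ℂ] K₂)}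

theorem rep_injective (π : A →⋆ₐ[ℂ] (H →L[ℂ] H)) (ρ : B →⋆ₐ[ℂ] (K →L[ℂ] K)) :
    Function.Injective (rep π ρ) :=
  Subtype.val_injective

section Map

theorem extend_ofAlg {V : Type*} [NormedAddCommGroup V] [NormedSpace ℂ V] [CompleteSpace V]
    {f : A ⊗[ℂ] B →ₗ[ℂ] V} (hf : ∃ c, ∀ x, ‖f x‖ ≤ c * ‖ofAlg π ρ x‖)
    (x : A ⊗[ℂ] B) : extend π ρ f (ofAlg π ρ x) = f x :=
  LinearMap.extendOfNorm_eq (denseRange_ofAlg π ρ) hf x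

theorem norm_map_apply_le {φ : A →ₗ[ℂ] A₁} {ψ : B →ₗ[ℂ] B₁} {c d : ℝ}
    (hφ : IsCompletelyBoundedBy π π₁ φ c) (hψ : IsCompletelyBoundedBy ρ ρ₁ ψ d)
    (x : spatialTensor π ρ) : ‖map π ρ π₁ ρ₁ φ ψ x‖ ≤ c * d * ‖x‖ := by
  have hbound := norm_ofAlg_map_le hφ hψ
  exact LinearMap.norm_extendOfNorm_apply_le (denseRange_ofAlg π ρ) (c * d) hbound x

variable {φ : A →ₗ[ℂ] A₁} {ψ : B →ₗ[ℂ] B₁}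

theorem map_ofAlg (hπ : Function.Injective π) (hρ : Function.Injective ρ)
    (π₁ : A₁ →⋆ₐ[ℂ] (H₁ →L[ℂ] H₁)) (ρ₁ : B₁ →⋆ₐ[ℂ] (K₁ →L[ℂ] K₁))
    (hφ : IsCompletelyBounded φ) (hψ : IsCompletelyBounded ψ) (x : A ⊗[ℂ] B) :
    map π ρ π₁ ρ₁ φ ψ (ofAlg π ρ x) = ofAlg π₁ ρ₁ (TensorProduct.map φ ψ x) := by
  obtain ⟨c, hc⟩ := hφ.exists_isCompletelyBoundedBy hπ π₁
  obtain ⟨d, hd⟩ := hψ.exists_isCompletelyBoundedBy hρ ρ₁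
  have hbound := norm_ofAlg_map_le hc hd
  exact extend_ofAlg ⟨c * d, hbound⟩ x

theorem map_ofAlg_tmul (hπ : Function.Injective π) (hρ : Function.Injective ρ)
    (π₁ : A₁ →⋆ₐ[ℂ] (H₁ →L[ℂ] H₁)) (ρ₁ : B₁ →⋆ₐ[ℂ] (K₁ →L[ℂ] K₁))
    (hφ : IsCompletelyBounded φ) (hψ : IsCompletelyBounded ψ) (a : A) (b : B) :
    map π ρ π₁ ρ₁ φ ψ (ofAlg π ρ (a ⊗ₜ b)) = ofAlg π₁ ρ₁ (φ a ⊗ₜ ψ b) := by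
  rw [map_ofAlg hπ hρ π₁ ρ₁ hφ hψ, TensorProduct.map_tmul]

theorem map_id_id (π : A →⋆ₐ[ℂ] (H →L[ℂ] H)) (ρ : B →⋆ₐ[ℂ] (K →L[ℂ] K)) :
    map π ρ π ρ LinearMap.id LinearMap.id = ContinuousLinearMap.id ℂ (spatialTensor π ρ) :=
  clm_ext fun a b => extend_ofAlg ⟨1, fun x => by simp⟩ (a ⊗ₜ b)

theorem map_map (hπ : Function.Injective π) (hρ : Function.Injective ρ)
    (hπ₁ : Function.Injective π₁) (hρ₁ : Function.Injective ρ₁)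
    (π₂ : A₂ →⋆ₐ[ℂ] (H₂ →L[ℂ] H₂)) (ρ₂ : B₂ →⋆ₐ[ℂ] (K₂ →L[ℂ] K₂))
    {φ' : A₁ →ₗ[ℂ] A₂} {ψ' : B₁ →ₗ[ℂ] B₂}
    (hφ : IsCompletelyBounded φ) (hψ : IsCompletelyBounded ψ)
    (hφ' : IsCompletelyBounded φ') (hψ' : IsCompletelyBounded ψ') (x : spatialTensor π ρ) :
    map π₁ ρ₁ π₂ ρ₂ φ' ψ' (map π ρ π₁ ρ₁ φ ψ x) =
      map π ρ π₂ ρ₂ (φ' ∘ₗ φ) (ψ' ∘ₗ ψ) x := by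
  suffices h : map π₁ ρ₁ π₂ ρ₂ φ' ψ' ∘L map π ρ π₁ ρ₁ φ ψ =
      map π ρ π₂ ρ₂ (φ' ∘ₗ φ) (ψ' ∘ₗ ψ) from congrArg (fun F => F x) h
  refine clm_ext fun a b => ?_
  rw [ContinuousLinearMap.comp_apply, map_ofAlg_tmul hπ hρ _ _ hφ hψ,
    map_ofAlg_tmul hπ₁ hρ₁ _ _ hφ' hψ', map_ofAlg_tmul hπ hρ _ _ (hφ'.comp hφ) (hψ'.comp hψ)]
  rfl

end Map

section Slice

theorem exists_norm_lid_map_le {ω : A →ₗ[ℂ] ℂ} (hπ : Function.Injective π)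
    (hρ : Function.Injective ρ) (hω : IsCompletelyBounded ω) :
    ∃ c, ∀ x, ‖((TensorProduct.lid ℂ B).toLinearMap ∘ₗ
      TensorProduct.map ω LinearMap.id) x‖ ≤ c * ‖ofAlg π ρ x‖ := by
  let scalarRep : ℂ →⋆ₐ[ℂ] (ℂ →L[ℂ] ℂ) := StarAlgHom.ofId ℂ _
  obtain ⟨c, hc⟩ := hω.exists_isCompletelyBoundedBy hπ scalarRep
  refine ⟨c, fun x => le_trans ?_ (norm_ofAlg_map_left_le hc ρ x)⟩
  set y := TensorProduct.map ω (LinearMap.id : B →ₗ[ℂ] B) x with hy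
  have hy_tmul : y = 1 ⊗ₜ[ℂ] TensorProduct.lid ℂ B y :=
    (TensorProduct.lid ℂ B).injective (by simp)
  rw [LinearMap.comp_apply, ← hy, LinearEquiv.coe_coe, ← NonUnitalStarAlgHom.norm_map ρ hρ]
  conv_rhs => rw [hy_tmul]
  refine (norm_le_norm_opTensor_one_left (H := ℂ) _).trans_eq ?_
  rw [← map_one scalarRep]
  rfl

theorem exists_norm_rid_map_le {ω : B →ₗ[ℂ] ℂ} (hπ : Function.Injective π)
    (hρ : Function.Injective ρ) (hω : IsCompletelyBounded ω) :
    ∃ c, ∀ x, ‖((TensorProduct.rid ℂ A).toLinearMap ∘ₗ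
      TensorProduct.map LinearMap.id ω) x‖ ≤ c * ‖ofAlg π ρ x‖ := by
  obtain ⟨c, hc⟩ := exists_norm_lid_map_le hρ hπ hω
  have hcomm : (TensorProduct.rid ℂ A).toLinearMap ∘ₗ TensorProduct.map LinearMap.id ω =
      ((TensorProduct.lid ℂ A).toLinearMap ∘ₗ TensorProduct.map ω LinearMap.id) ∘ₗ
        (TensorProduct.comm ℂ A B).toLinearMap :=
    TensorProduct.ext' fun a b => by simp
  refine ⟨c, fun x => ?_⟩
  rw [hcomm, ← norm_ofAlg_comm π ρ x]
  exact hc _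

/-- The slice map `ω ⊗ id : A ⊗ B → B`. -/
def leftSlice (π : A →⋆ₐ[ℂ] (H →L[ℂ] H)) (ρ : B →⋆ₐ[ℂ] (K →L[ℂ] K)) (ω : A →ₗ[ℂ] ℂ) :
    spatialTensor π ρ →L[ℂ] B :=
  extend π ρ ((TensorProduct.lid ℂ B).toLinearMap ∘ₗ TensorProduct.map ω LinearMap.id)

/-- The slice map `id ⊗ ω : A ⊗ B → A`. -/
def rightSlice (π : A →⋆ₐ[ℂ] (H →L[ℂ] H)) (ρ : B →⋆ₐ[ℂ] (K →L[ℂ] K)) (ω : B →ₗ[ℂ] ℂ) :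
    spatialTensor π ρ →L[ℂ] A :=
  extend π ρ ((TensorProduct.rid ℂ A).toLinearMap ∘ₗ TensorProduct.map LinearMap.id ω)

theorem leftSlice_ofAlg_tmul {ω : A →ₗ[ℂ] ℂ} (hπ : Function.Injective π)
    (hρ : Function.Injective ρ) (hω : IsCompletelyBounded ω) (a : A) (b : B) :
    leftSlice π ρ ω (ofAlg π ρ (a ⊗ₜ b)) = ω a • b :=
  extend_ofAlg (exists_norm_lid_map_le hπ hρ hω) _

theorem rightSlice_ofAlg_tmul {ω : B →ₗ[ℂ] ℂ} (hπ : Function.Injective π)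
    (hρ : Function.Injective ρ) (hω : IsCompletelyBounded ω) (a : A) (b : B) :
    rightSlice π ρ ω (ofAlg π ρ (a ⊗ₜ b)) = ω b • a :=
  extend_ofAlg (exists_norm_rid_map_le hπ hρ hω) _

theorem leftSlice_map (hπ : Function.Injective π) (hρ : Function.Injective ρ)
    (hπ₁ : Function.Injective π₁) (hρ₁ : Function.Injective ρ₁)
    {φ : A →ₗ[ℂ] A₁} {ψ : B →ₗ[ℂ] B₁} {ω : A₁ →ₗ[ℂ] ℂ} (hφ : IsCompletelyBounded φ)
    (hψ : IsCompletelyBounded ψ) (hω : IsCompletelyBounded ω) (x : spatialTensor π ρ) :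
    leftSlice π₁ ρ₁ ω (map π ρ π₁ ρ₁ φ ψ x) = ψ (leftSlice π ρ (ω ∘ₗ φ) x) := by
  suffices h : leftSlice π₁ ρ₁ ω ∘L map π ρ π₁ ρ₁ φ ψ =
      (⟨ψ, hψ.continuous⟩ : B →L[ℂ] B₁) ∘L leftSlice π ρ (ω ∘ₗ φ) from
    congrArg (fun F => F x) h
  refine clm_ext fun a b => ?_
  rw [ContinuousLinearMap.comp_apply, map_ofAlg_tmul hπ hρ _ _ hφ hψ,
    leftSlice_ofAlg_tmul hπ₁ hρ₁ hω, ContinuousLinearMap.comp_apply,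
    leftSlice_ofAlg_tmul hπ hρ (hω.comp hφ)]
  exact (map_smul ψ _ b).symm

theorem rightSlice_map (hπ : Function.Injective π) (hρ : Function.Injective ρ)
    (hπ₁ : Function.Injective π₁) (hρ₁ : Function.Injective ρ₁)
    {φ : A →ₗ[ℂ] A₁} {ψ : B →ₗ[ℂ] B₁} {ω : B₁ →ₗ[ℂ] ℂ} (hφ : IsCompletelyBounded φ)
    (hψ : IsCompletelyBounded ψ) (hω : IsCompletelyBounded ω) (x : spatialTensor π ρ) :
    rightSlice π₁ ρ₁ ω (map π ρ π₁ ρ₁ φ ψ x) = φ (rightSlice π ρ (ω ∘ₗ ψ) x) := by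
  suffices h : rightSlice π₁ ρ₁ ω ∘L map π ρ π₁ ρ₁ φ ψ =
      (⟨φ, hφ.continuous⟩ : A →L[ℂ] A₁) ∘L rightSlice π ρ (ω ∘ₗ ψ) from
    congrArg (fun F => F x) h
  refine clm_ext fun a b => ?_
  rw [ContinuousLinearMap.comp_apply, map_ofAlg_tmul hπ hρ _ _ hφ hψ,
    rightSlice_ofAlg_tmul hπ₁ hρ₁ hω, ContinuousLinearMap.comp_apply,
    rightSlice_ofAlg_tmul hπ hρ (hω.comp hψ)]
  exact (map_smul φ _ a).symm

end Slice

section Assoc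

variable (π : A →⋆ₐ[ℂ] (H →L[ℂ] H)) (ρ : B →⋆ₐ[ℂ] (K →L[ℂ] K)) (τ : C →⋆ₐ[ℂ] (L →L[ℂ] L))

theorem norm_ofAlg_tmul_le (a : A) (b : B) : ‖ofAlg π ρ (a ⊗ₜ b)‖ ≤ ‖a‖ * ‖b‖ :=
  (norm_opTensor_le (π a) (ρ b)).trans (mul_le_mul (NonUnitalStarAlgHom.norm_apply_le π a)
    (NonUnitalStarAlgHom.norm_apply_le ρ b) (norm_nonneg _) (norm_nonneg _))

/-- The map `a ↦ a ⊗ b`. -/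
def tmulRight (b : B) : A →L[ℂ] spatialTensor π ρ :=
  (ofAlg π ρ ∘ₗ (TensorProduct.mk ℂ A B).flip b).mkContinuous ‖b‖ fun a => by
    rw [mul_comm]
    exact norm_ofAlg_tmul_le π ρ a b

/-- The map `(A ⊙ B) ⊙ C → (A ⊗ B) ⊗ C`. -/
abbrev ofAlgLeft : (A ⊗[ℂ] B) ⊗[ℂ] C →ₗ[ℂ] spatialTensor (rep π ρ) τ :=
  ofAlg (rep π ρ) τ ∘ₗ TensorProduct.map (ofAlg π ρ) LinearMap.id

/-- The map `(A ⊙ B) ⊙ C → A ⊗ (B ⊗ C)`. -/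
abbrev ofAlgRight : (A ⊗[ℂ] B) ⊗[ℂ] C →ₗ[ℂ] spatialTensor π (rep ρ τ) :=
  ofAlg π (rep ρ τ) ∘ₗ TensorProduct.map LinearMap.id (ofAlg ρ τ) ∘ₗ
    (TensorProduct.assoc ℂ A B C).toLinearMap

theorem ofAlg_mem_topologicalClosure (T : spatialTensor π ρ) (c : C) :
    ofAlg (rep π ρ) τ (T ⊗ₜ c) ∈ (LinearMap.range (ofAlgLeft π ρ τ)).topologicalClosure := by
  refine (denseRange_ofAlg π ρ).induction_on
    (p := fun T => ofAlg (rep π ρ) τ (T ⊗ₜ c) ∈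
      (LinearMap.range (ofAlgLeft π ρ τ)).topologicalClosure) T
    ((Submodule.isClosed_topologicalClosure _).preimage (tmulRight (rep π ρ) τ c).continuous)
    fun x => Submodule.le_topologicalClosure _ ⟨x ⊗ₜ c, rfl⟩

theorem denseRange_ofAlgLeft : DenseRange (ofAlgLeft π ρ τ) := by
  rw [DenseRange, ← LinearMap.coe_range, Submodule.dense_iff_topologicalClosure_eq_top, eq_top_iff]
  rintro x -
  refine (denseRange_ofAlg (rep π ρ) τ).induction_on
    (p := fun x => x ∈ (LinearMap.range (ofAlgLeft π ρ τ)).topologicalClosure) x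
    (Submodule.isClosed_topologicalClosure _) fun x => ?_
  induction x using TensorProduct.induction_on with
  | zero => rw [map_zero]; exact Submodule.zero_mem _
  | add x y hx hy => rw [map_add]; exact Submodule.add_mem _ hx hy
  | tmul T c => exact ofAlg_mem_topologicalClosure π ρ τ T c

theorem isometry_comp_ofAlgRight
    {W : HilbertTensor H (HilbertTensor K L) →ₗᵢ[ℂ] HilbertTensor (HilbertTensor H K) L}
    (hW : ∀ x y z, W (hTmul x (hTmul y z)) = hTmul (hTmul x y) z) (x : (A ⊗[ℂ] B) ⊗[ℂ] C) :
    W.toContinuousLinearMap ∘L (ofAlgRight π ρ τ x :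
        HilbertTensor H (HilbertTensor K L) →L[ℂ] HilbertTensor H (HilbertTensor K L)) =
      (ofAlgLeft π ρ τ x : HilbertTensor (HilbertTensor H K) L →L[ℂ]
        HilbertTensor (HilbertTensor H K) L) ∘L W.toContinuousLinearMap := by
  refine ContinuousLinearMap.ext_on
    (Submodule.dense_iff_topologicalClosure_eq_top.2 hTmul_assoc_total) ?_
  rintro _ ⟨⟨u, v, w⟩, rfl⟩
  induction x using TensorProduct.induction_on with
  | zero => simp
  | add x y hx hy =>
    simp only [map_add, AddMemClass.coe_add, ContinuousLinearMap.comp_apply,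
      _root_.add_apply] at hx hy ⊢
    rw [hx, hy]
  | tmul x c =>
    induction x using TensorProduct.induction_on with
    | zero => simp
    | add x y hx hy =>
      simp only [TensorProduct.add_tmul, map_add, AddMemClass.coe_add,
        ContinuousLinearMap.comp_apply, _root_.add_apply] at hx hy ⊢
      rw [hx, hy]
    | tmul a b =>
      change W (opTensor (π a) (opTensor (ρ b) (τ c)) (hTmul u (hTmul v w))) =
        opTensor (opTensor (π a) (ρ b)) (τ c) (W (hTmul u (hTmul v w)))
      simp only [hW, opTensor_hTmul]

theorem norm_ofAlgRight_le (x : (A ⊗[ℂ] B) ⊗[ℂ] C) :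
    ‖ofAlgRight π ρ τ x‖ ≤ ‖ofAlgLeft π ρ τ x‖ := by
  obtain ⟨W, hW⟩ := exists_isometry_assoc (H := H) (K := K) (L := L)
  refine ContinuousLinearMap.opNorm_le_bound _ (norm_nonneg _) fun v => ?_
  have hv := congrArg (fun T => ‖T v‖) (isometry_comp_ofAlgRight π ρ τ hW x)
  simp only [ContinuousLinearMap.comp_apply, LinearIsometry.coe_toContinuousLinearMap,
    W.norm_map] at hv
  rw [← W.norm_map v]
  exact hv.trans_le (ContinuousLinearMap.le_opNorm _ _)

theorem assoc_ofAlg (a : A) (b : B) (c : C) :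
    assoc π ρ τ (ofAlg (rep π ρ) τ (ofAlg π ρ (a ⊗ₜ b) ⊗ₜ c)) =
      ofAlg π (rep ρ τ) (a ⊗ₜ ofAlg ρ τ (b ⊗ₜ c)) :=
  LinearMap.extendOfNorm_eq (f := ofAlgRight π ρ τ) (e := ofAlgLeft π ρ τ)
    (denseRange_ofAlgLeft π ρ τ)
    ⟨1, fun x => by rw [one_mul]; exact norm_ofAlgRight_le π ρ τ x⟩ ((a ⊗ₜ b) ⊗ₜ c)

variable {π ρ τ}

theorem clm_ext_left {V : Type*} [NormedAddCommGroup V] [NormedSpace ℂ V]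
    {f g : spatialTensor (rep π ρ) τ →L[ℂ] V}
    (h : ∀ a b c, f (ofAlg (rep π ρ) τ (ofAlg π ρ (a ⊗ₜ b) ⊗ₜ c)) =
      g (ofAlg (rep π ρ) τ (ofAlg π ρ (a ⊗ₜ b) ⊗ₜ c))) : f = g :=
  clm_ext fun T c => by
    have hc : f ∘L tmulRight (rep π ρ) τ c = g ∘L tmulRight (rep π ρ) τ c :=
      clm_ext fun a b => h a b c
    exact congrArg (fun F => F T) hc

theorem assoc_map (hπ : Function.Injective π) (hρ : Function.Injective ρ)
    (hτ : Function.Injective τ) {φ : A →ₗ[ℂ] A₁} {ψ : B →ₗ[ℂ] B₁} {χ : C →ₗ[ℂ] C₁}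
    (hφ : IsCompletelyBounded φ) (hψ : IsCompletelyBounded ψ) (hχ : IsCompletelyBounded χ)
    (hφψ : IsCompletelyBounded (map π ρ π₁ ρ₁ φ ψ).toLinearMap)
    (hψχ : IsCompletelyBounded (map ρ τ ρ₁ τ₁ ψ χ).toLinearMap)
    (x : spatialTensor (rep π ρ) τ) :
    assoc π₁ ρ₁ τ₁ (map (rep π ρ) τ (rep π₁ ρ₁) τ₁ (map π ρ π₁ ρ₁ φ ψ).toLinearMap χ x) =
      map π (rep ρ τ) π₁ (rep ρ₁ τ₁) φ (map ρ τ ρ₁ τ₁ ψ χ).toLinearMap (assoc π ρ τ x) := by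
  suffices h : assoc π₁ ρ₁ τ₁ ∘L
      map (rep π ρ) τ (rep π₁ ρ₁) τ₁ (map π ρ π₁ ρ₁ φ ψ).toLinearMap χ =
        map π (rep ρ τ) π₁ (rep ρ₁ τ₁) φ (map ρ τ ρ₁ τ₁ ψ χ).toLinearMap ∘L assoc π ρ τ from
    congrArg (fun F => F x) h
  refine clm_ext_left fun a b c => ?_
  simp only [ContinuousLinearMap.comp_apply, assoc_ofAlg,
    map_ofAlg_tmul (rep_injective π ρ) hτ _ _ hφψ hχ,
    map_ofAlg_tmul hπ (rep_injective ρ τ) _ _ hφ hψχ,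
    ContinuousLinearMap.coe_coe, map_ofAlg_tmul hπ hρ _ _ hφ hψ, map_ofAlg_tmul hρ hτ _ _ hψ hχ]

end Assoc

end spatialTensor

section Expectation

variable {A H : Type*} [CStarAlgebra A]
  [NormedAddCommGroup H] [InnerProductSpace ℂ H] [CompleteSpace H]
  {S : StarSubalgebra ℂ A} {P : A →L[ℂ] S}

theorem isCompletelyBounded_id : IsCompletelyBounded (LinearMap.id : A →ₗ[ℂ] A) :=
  isCompletelyBounded_starAlgHom (StarAlgHom.id ℂ A)

theorem restrictRep_injective (S : StarSubalgebra ℂ A) {π : A →⋆ₐ[ℂ] (H →L[ℂ] H)}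
    (hπ : Function.Injective π) : Function.Injective (restrictRep S π) :=
  hπ.comp Subtype.val_injective

variable [hS : IsClosed (S : Set A)]

namespace IsConditionalExpectation

theorem isContractiveRetraction (hP : IsConditionalExpectation S P) :
    IsContractiveRetraction S.subtype P.toLinearMap where
  norm_apply_le a := by
    simpa only [hP.norm_eq_one, one_mul, ContinuousLinearMap.coe_coe] using P.le_opNorm a
  apply_incl := hP.proj

theorem isCompletelyBounded (hP : IsConditionalExpectation S P) :
    IsCompletelyBounded P.toLinearMap :=
  hP.isContractiveRetraction.isCompletelyBounded

theorem isCompletelyBounded_expectationEnd (hP : IsConditionalExpectation S P) :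
    IsCompletelyBounded (expectationEnd S P) :=
  (isCompletelyBounded_starAlgHom S.subtype).comp hP.isCompletelyBounded

theorem comp_subtype (hP : IsConditionalExpectation S P) :
    P.toLinearMap ∘ₗ S.subtype.toAlgHom.toLinearMap = LinearMap.id :=
  LinearMap.ext hP.proj

end IsConditionalExpectation

theorem spatialTensor_restrictRep_le (S : StarSubalgebra ℂ A) [IsClosed (S : Set A)]
    (π : A →⋆ₐ[ℂ] (H →L[ℂ] H)) :
    spatialTensor (restrictRep S π) (restrictRep S π) ≤ spatialTensor π π := by
  refine StarSubalgebra.topologicalClosure_mono (StarAlgebra.adjoin_mono ?_)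
  rintro _ ⟨p, rfl⟩
  exact ⟨(p.1, p.2), rfl⟩

/-- The inclusion `S ⊗ S ⊆ A ⊗ A`, a star homomorphism because both tensor products act on the same
Hilbert space. -/
def restrictIncl (S : StarSubalgebra ℂ A) [IsClosed (S : Set A)] (π : A →⋆ₐ[ℂ] (H →L[ℂ] H)) :
    spatialTensor (restrictRep S π) (restrictRep S π) →⋆ₐ[ℂ] spatialTensor π π :=
  StarSubalgebra.inclusion (spatialTensor_restrictRep_le S π)

/-- The map `P ⊗ P : A ⊗ A → S ⊗ S`. -/
abbrev expectationTensor (P : A →L[ℂ] S) (π : A →⋆ₐ[ℂ] (H →L[ℂ] H)) :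
    spatialTensor π π →L[ℂ] spatialTensor (restrictRep S π) (restrictRep S π) :=
  spatialTensor.map π π (restrictRep S π) (restrictRep S π) P.toLinearMap P.toLinearMap

section

variable {π : A →⋆ₐ[ℂ] (H →L[ℂ] H)} (hπ : Function.Injective π)
include hπ

theorem restrictIncl_eq_map (x : spatialTensor (restrictRep S π) (restrictRep S π)) :
    restrictIncl S π x = spatialTensor.map (restrictRep S π) (restrictRep S π) π π
      S.subtype.toAlgHom.toLinearMap S.subtype.toAlgHom.toLinearMap x := by
  have hι := isCompletelyBounded_starAlgHom S.subtype
  suffices h : (⟨(restrictIncl S π).toAlgHom.toLinearMap,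
      (isCompletelyBounded_starAlgHom (restrictIncl S π)).continuous⟩ :
        spatialTensor (restrictRep S π) (restrictRep S π) →L[ℂ] spatialTensor π π) =
      spatialTensor.map (restrictRep S π) (restrictRep S π) π π
        S.subtype.toAlgHom.toLinearMap S.subtype.toAlgHom.toLinearMap from
    congrArg (fun F => F x) h
  refine spatialTensor.clm_ext fun a b => ?_
  rw [spatialTensor.map_ofAlg_tmul (restrictRep_injective S hπ) (restrictRep_injective S hπ)
    _ _ hι hι]
  rfl

variable (hP : IsConditionalExpectation S P)
include hP

theorem restrictIncl_expectationTensor (x : spatialTensor π π) :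
    restrictIncl S π (expectationTensor P π x) =
      spatialTensor.map π π π π (expectationEnd S P) (expectationEnd S P) x := by
  have hι := isCompletelyBounded_starAlgHom S.subtype
  have hπS := restrictRep_injective S hπ
  rw [restrictIncl_eq_map hπ, spatialTensor.map_map hπ hπ hπS hπS _ _ hP.isCompletelyBounded
    hP.isCompletelyBounded hι hι]
  rfl

theorem isContractiveRetraction_expectationTensor :
    IsContractiveRetraction (restrictIncl S π) (expectationTensor P π).toLinearMap where
  norm_apply_le x := by
    have hbound := hP.isContractiveRetraction.isCompletelyBoundedBy_one hπ (restrictRep S π)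
    simpa only [one_mul, ContinuousLinearMap.coe_coe] using
      spatialTensor.norm_map_apply_le hbound hbound x
  apply_incl x := by
    have hι := isCompletelyBounded_starAlgHom S.subtype
    have hπS := restrictRep_injective S hπ
    rw [restrictIncl_eq_map hπ, ContinuousLinearMap.coe_coe,
      spatialTensor.map_map hπS hπS hπ hπ _ _ hι hι hP.isCompletelyBounded hP.isCompletelyBounded,
      hP.comp_subtype, spatialTensor.map_id_id, ContinuousLinearMap.id_apply]

theorem isCompletelyBounded_expectationTensor :
    IsCompletelyBounded (expectationTensor P π).toLinearMap :=
  (isContractiveRetraction_expectationTensor hπ hP).isCompletelyBounded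

variable {Δ : A →ₗ[ℂ] spatialTensor π π} {ε : A →⋆ₐ[ℂ] ℂ}

theorem restrictCoproduct_apply_expectation (hPΔ : IsCompatibleExpectation S π Δ P) (a : A) :
    restrictCoproduct S π Δ P (P a) = expectationTensor P π (Δ a) := by
  refine Set.inclusion_injective (spatialTensor_restrictRep_le S π) ?_
  change restrictIncl S π (expectationTensor P π (Δ (P a))) =
    restrictIncl S π (expectationTensor P π (Δ a))
  rw [restrictIncl_expectationTensor hπ hP, restrictIncl_expectationTensor hπ hP,
    ← hPΔ.left, ← hPΔ.left, hP.proj]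

theorem restrictCoproduct_comp_expectation (hPΔ : IsCompatibleExpectation S π Δ P) :
    restrictCoproduct S π Δ P ∘ₗ P.toLinearMap = (expectationTensor P π).toLinearMap ∘ₗ Δ :=
  LinearMap.ext (restrictCoproduct_apply_expectation hπ hP hPΔ)

theorem isCompletelyPositive_restrictCoproduct (hΔ : IsCompletelyPositive Δ) :
    IsCompletelyPositive (restrictCoproduct S π Δ P) :=
  (isContractiveRetraction_expectationTensor hπ hP).isCompletelyPositive.comp
    (hΔ.comp (isCompletelyPositive_starAlgHom S.subtype))

theorem restrictCoproduct_one (hΔ : Δ 1 = 1) : restrictCoproduct S π Δ P 1 = 1 := by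
  change expectationTensor P π (Δ 1) = 1
  rw [hΔ]
  exact (isContractiveRetraction_expectationTensor hπ hP).map_one

theorem isCompletelyBounded_restrictCoproduct (hA : IsCStarHyperbialgebra π Δ ε) :
    IsCompletelyBounded (restrictCoproduct S π Δ P) :=
  (isCompletelyPositive_restrictCoproduct hπ hP hA.completelyPositive).isCompletelyBounded
    (restrictCoproduct_one hπ hP hA.map_one)

theorem map_restrictCoproduct_id_expectationTensor (hA : IsCStarHyperbialgebra π Δ ε)
    (hPΔ : IsCompatibleExpectation S π Δ P) (x : spatialTensor π π) :
    spatialTensor.map (restrictRep S π) (restrictRep S π)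
        (spatialTensor.rep (restrictRep S π) (restrictRep S π)) (restrictRep S π)
        (restrictCoproduct S π Δ P) LinearMap.id (expectationTensor P π x) =
      spatialTensor.map (spatialTensor.rep π π) π
        (spatialTensor.rep (restrictRep S π) (restrictRep S π)) (restrictRep S π)
        (expectationTensor P π).toLinearMap P.toLinearMap
        (spatialTensor.map π π (spatialTensor.rep π π) π Δ LinearMap.id x) := by
  have hπS := restrictRep_injective S hπ
  have hPcb := hP.isCompletelyBounded
  rw [spatialTensor.map_map hπ hπ hπS hπS _ _ hPcb hPcb
      (isCompletelyBounded_restrictCoproduct hπ hP hA) isCompletelyBounded_id,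
    spatialTensor.map_map hπ hπ (spatialTensor.rep_injective π π) hπ _ _
      (hA.completelyPositive.isCompletelyBounded hA.map_one) isCompletelyBounded_id
      (isCompletelyBounded_expectationTensor hπ hP) hPcb,
    restrictCoproduct_comp_expectation hπ hP hPΔ, LinearMap.id_comp, LinearMap.comp_id]

theorem map_id_restrictCoproduct_expectationTensor (hA : IsCStarHyperbialgebra π Δ ε)
    (hPΔ : IsCompatibleExpectation S π Δ P) (x : spatialTensor π π) :
    spatialTensor.map (restrictRep S π) (restrictRep S π) (restrictRep S π)
        (spatialTensor.rep (restrictRep S π) (restrictRep S π))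
        LinearMap.id (restrictCoproduct S π Δ P) (expectationTensor P π x) =
      spatialTensor.map π (spatialTensor.rep π π) (restrictRep S π)
        (spatialTensor.rep (restrictRep S π) (restrictRep S π))
        P.toLinearMap (expectationTensor P π).toLinearMap
        (spatialTensor.map π π π (spatialTensor.rep π π) LinearMap.id Δ x) := by
  have hπS := restrictRep_injective S hπ
  have hPcb := hP.isCompletelyBounded
  rw [spatialTensor.map_map hπ hπ hπS hπS _ _ hPcb hPcb isCompletelyBounded_id
      (isCompletelyBounded_restrictCoproduct hπ hP hA),
    spatialTensor.map_map hπ hπ hπ (spatialTensor.rep_injective π π) _ _ isCompletelyBounded_id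
      (hA.completelyPositive.isCompletelyBounded hA.map_one) hPcb
      (isCompletelyBounded_expectationTensor hπ hP),
    restrictCoproduct_comp_expectation hπ hP hPΔ, LinearMap.id_comp, LinearMap.comp_id]

theorem leftSlice_restrictCoproduct (hA : IsCStarHyperbialgebra π Δ ε)
    (hPΔ : IsCompatibleExpectation S π Δ P) (s : S) :
    spatialTensor.leftSlice (restrictRep S π) (restrictRep S π)
      (restrictCounit S ε).toAlgHom.toLinearMap (restrictCoproduct S π Δ P s) = s := by
  have hπS := restrictRep_injective S hπ
  have hPcb := hP.isCompletelyBounded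
  have hE := hP.isCompletelyBounded_expectationEnd
  have hε := isCompletelyBounded_starAlgHom ε
  refine Subtype.ext ?_
  calc ((spatialTensor.leftSlice (restrictRep S π) (restrictRep S π)
          (restrictCounit S ε).toAlgHom.toLinearMap (expectationTensor P π (Δ s)) : S) : A)
      = expectationEnd S P (spatialTensor.leftSlice π π
          (ε.toAlgHom.toLinearMap ∘ₗ expectationEnd S P) (Δ s)) := by
        rw [spatialTensor.leftSlice_map hπ hπ hπS hπS hPcb hPcb
          (isCompletelyBounded_starAlgHom (restrictCounit S ε))]
        rfl
    _ = spatialTensor.leftSlice π π ε.toAlgHom.toLinearMap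
          (spatialTensor.map π π π π LinearMap.id (expectationEnd S P) (Δ s)) := by
        rw [← spatialTensor.leftSlice_map hπ hπ hπ hπ hE hE hε, hPΔ.right]
    _ = expectationEnd S P (spatialTensor.leftSlice π π ε.toAlgHom.toLinearMap (Δ s)) := by
        rw [spatialTensor.leftSlice_map hπ hπ hπ hπ isCompletelyBounded_id hE hε,
          LinearMap.comp_id]
    _ = expectationEnd S P s := congrArg _ (hA.counit_left s)
    _ = s := congrArg Subtype.val (hP.proj s)

theorem rightSlice_restrictCoproduct (hA : IsCStarHyperbialgebra π Δ ε)
    (hPΔ : IsCompatibleExpectation S π Δ P) (s : S) :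
    spatialTensor.rightSlice (restrictRep S π) (restrictRep S π)
      (restrictCounit S ε).toAlgHom.toLinearMap (restrictCoproduct S π Δ P s) = s := by
  have hπS := restrictRep_injective S hπ
  have hPcb := hP.isCompletelyBounded
  have hE := hP.isCompletelyBounded_expectationEnd
  have hε := isCompletelyBounded_starAlgHom ε
  refine Subtype.ext ?_
  calc ((spatialTensor.rightSlice (restrictRep S π) (restrictRep S π)
          (restrictCounit S ε).toAlgHom.toLinearMap (expectationTensor P π (Δ s)) : S) : A)
      = expectationEnd S P (spatialTensor.rightSlice π π
          (ε.toAlgHom.toLinearMap ∘ₗ expectationEnd S P) (Δ s)) := by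
        rw [spatialTensor.rightSlice_map hπ hπ hπS hπS hPcb hPcb
          (isCompletelyBounded_starAlgHom (restrictCounit S ε))]
        rfl
    _ = spatialTensor.rightSlice π π ε.toAlgHom.toLinearMap
          (spatialTensor.map π π π π (expectationEnd S P) LinearMap.id (Δ (P (s : A)))) := by
        rw [← spatialTensor.rightSlice_map hπ hπ hπ hπ hE hE hε, hPΔ.left]
    _ = expectationEnd S P (spatialTensor.rightSlice π π ε.toAlgHom.toLinearMap (Δ s)) := by
        rw [spatialTensor.rightSlice_map hπ hπ hπ hπ hE isCompletelyBounded_id hε,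
          LinearMap.comp_id, hP.proj]
    _ = expectationEnd S P s := congrArg _ (hA.counit_right s)
    _ = s := congrArg Subtype.val (hP.proj s)

theorem isCStarHyperbialgebra_restrict (hA : IsCStarHyperbialgebra π Δ ε)
    (hPΔ : IsCompatibleExpectation S π Δ P) :
    IsCStarHyperbialgebra (restrictRep S π) (restrictCoproduct S π Δ P) (restrictCounit S ε) where
  completelyPositive := isCompletelyPositive_restrictCoproduct hπ hP hA.completelyPositive
  map_one := restrictCoproduct_one hπ hP hA.map_one
  coassoc s := by
    have hPcb := hP.isCompletelyBounded
    have hPP := isCompletelyBounded_expectationTensor hπ hP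
    refine (congrArg _ (map_restrictCoproduct_id_expectationTensor hπ hP hA hPΔ (Δ s))).trans
      (Eq.trans ?_ (map_id_restrictCoproduct_expectationTensor hπ hP hA hPΔ (Δ s)).symm)
    rw [spatialTensor.assoc_map hπ hπ hπ hPcb hPcb hPcb hPP hPP, hA.coassoc]
  counit_left := leftSlice_restrictCoproduct hπ hP hA hPΔ
  counit_right := rightSlice_restrictCoproduct hπ hP hA hPΔ

end

end Expectation

section StepFunctions

variable {k : Type*} [NormedAddCommGroup k] [InnerProductSpace ℂ k]

namespace L2on

variable {I J : Set ℝ}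

theorem coeFn_restrict (hI : MeasurableSet I) (f : Lp k 2 (volume : Measure ℝ)) :
    (restrict hI f : Lp k 2 (volume : Measure ℝ)) =ᵐ[volume] I.indicator f :=
  ((Lp.memLp f).indicator hI).coeFn_toLp

theorem restrict_congr (hI : MeasurableSet I) {f g : Lp k 2 (volume : Measure ℝ)}
    (h : ∀ᵐ r : ℝ, r ∈ I → f r = g r) : restrict hI f = restrict hI g := by
  refine Subtype.ext (Lp.ext ?_)
  filter_upwards [coeFn_restrict hI f, coeFn_restrict hI g, h] with r hf hg hfg
  rw [hf, hg]
  simp only [Set.indicator]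
  split_ifs with hr
  exacts [hfg hr, rfl]

theorem restrict_eq_self (hI : MeasurableSet I) (f : L2on k I) :
    restrict hI (f : Lp k 2 (volume : Measure ℝ)) = f := by
  refine Subtype.ext (Lp.ext ?_)
  have hfI : ∀ᵐ r : ℝ, r ∉ I → (f : Lp k 2 (volume : Measure ℝ)) r = 0 := f.2
  filter_upwards [coeFn_restrict hI (f : Lp k 2 (volume : Measure ℝ)), hfI] with r hr hr0
  rw [hr, Set.indicator_apply_eq_self]
  exact hr0

theorem restrict_surjective (hI : MeasurableSet I) :
    Function.Surjective (restrict (k := k) hI) := fun f => ⟨f, restrict_eq_self hI f⟩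

theorem restrict_restrict (hI : MeasurableSet I) (hJ : MeasurableSet J) (hIJ : I ⊆ J)
    (f : Lp k 2 (volume : Measure ℝ)) :
    restrict hI (restrict hJ f : Lp k 2 (volume : Measure ℝ)) = restrict hI f := by
  refine restrict_congr hI ?_
  filter_upwards [coeFn_restrict hJ f] with r hr hrI
  rw [hr, Set.indicator_of_mem (hIJ hrI)]

theorem restrict_eq_zero (hI : MeasurableSet I) (h : Disjoint I J)
    {f : Lp k 2 (volume : Measure ℝ)} (hf : f ∈ L2on k J) : restrict hI f = 0 := by
  rw [← map_zero (restrict (k := k) hI)]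
  refine restrict_congr hI ?_
  have hfJ : ∀ᵐ r : ℝ, r ∉ J → f r = 0 := hf
  filter_upwards [hfJ, Lp.coeFn_zero k 2 (volume : Measure ℝ)] with r hr h0 hrI
  rw [hr (Set.disjoint_left.1 h hrI), h0, Pi.zero_apply]

theorem continuous_restrict (hI : MeasurableSet I) : Continuous (restrict (k := k) hI) := by
  refine AddMonoidHomClass.continuous_of_bound (restrict (k := k) hI) 1 fun f => ?_
  rw [one_mul]
  refine Lp.norm_le_norm_of_ae_le ?_
  filter_upwards [coeFn_restrict hI f] with r hr
  exact (congrArg norm hr).le.trans (norm_indicator_le_norm_self f r)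

theorem incl_restrict_add_incl_restrict {T : Set ℝ} (hI : MeasurableSet I) (hJ : MeasurableSet J)
    (hT : MeasurableSet T) (hIT : I ⊆ T) (hJT : J ⊆ T) (hIJ : Disjoint I J) (hIJT : I ∪ J = T)
    (f : Lp k 2 (volume : Measure ℝ)) :
    incl hIT (restrict hI f) + incl hJT (restrict hJ f) = restrict hT f := by
  refine Subtype.ext (Lp.ext ?_)
  refine (Lp.coeFn_add _ _).trans ?_
  filter_upwards [coeFn_restrict hI f, coeFn_restrict hJ f, coeFn_restrict hT f]
    with r hrI hrJ hrT
  refine (congrArg₂ (· + ·) hrI hrJ).trans (Eq.trans ?_ hrT.symm)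
  rw [← hIJT, Set.indicator_union_of_disjoint hIJ]

theorem restrict_indicatorConstLp_congr {s t : Set ℝ} (hI : MeasurableSet I)
    (hs : MeasurableSet s) (hμs : volume s ≠ ⊤) (ht : MeasurableSet t) (hμt : volume t ≠ ⊤)
    (h : s ∩ I = t ∩ I) (d : k) :
    restrict hI (indicatorConstLp 2 hs hμs d) = restrict hI (indicatorConstLp 2 ht hμt d) := by
  refine restrict_congr hI ?_
  filter_upwards [indicatorConstLp_coeFn (p := 2) (c := d) (hs := hs) (hμs := hμs),
    indicatorConstLp_coeFn (p := 2) (c := d) (hs := ht) (hμs := hμt)] with r hrs hrt hrI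
  have hmem : r ∈ s ↔ r ∈ t := by simpa [hrI] using Set.ext_iff.1 h r
  rw [hrs, hrt]
  by_cases hr : r ∈ t <;> simp [hr, hmem]

end L2on

theorem exists_mem_stepSpan_truncation (t : ℝ≥0) {f : Lp k 2 (volume : Measure ℝ)}
    (hf : f ∈ stepSpan k) : ∃ g ∈ stepSpan k,
      L2on.restrict (measurableSet_Ico (a := (0 : ℝ)) (b := (t : ℝ))) g =
        L2on.restrict measurableSet_Ico f ∧
      L2on.restrict (measurableSet_Ici (a := (t : ℝ))) g = 0 := by
  let R := L2on.restrict (k := k) (measurableSet_Ico (a := (0 : ℝ)) (b := (t : ℝ)))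
  let R' := L2on.restrict (k := k) (measurableSet_Ici (a := (t : ℝ)))
  suffices hle : (stepSpan k).map (R.prod 0) ≤ (stepSpan k).map (R.prod R') by
    obtain ⟨g, hg, h⟩ := hle (Submodule.mem_map_of_mem hf)
    exact ⟨g, hg, congrArg Prod.fst h, congrArg Prod.snd h⟩
  refine (Submodule.map_span_le _ _ _).2 ?_
  rintro _ ⟨⟨d, s⟩, rfl⟩
  refine ⟨_, Submodule.subset_span ⟨(d, min s t), rfl⟩, Prod.ext ?_ ?_⟩
  · refine L2on.restrict_indicatorConstLp_congr _ _ _ _ _ ?_ d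
    ext r
    simp only [Set.mem_inter_iff, Set.mem_Ico, NNReal.coe_min, lt_min_iff]
    tauto
  · change R' _ = 0
    rw [← map_zero R', ← indicatorConstLp_empty (p := 2) (μ := volume) (c := d)]
    refine L2on.restrict_indicatorConstLp_congr _ _ _ _ _ ?_ d
    ext r
    simp only [Set.mem_inter_iff, Set.mem_Ico, Set.mem_Ici, NNReal.coe_min, lt_min_iff,
      Set.empty_inter, Set.mem_empty_iff_false, iff_false]
    exact fun h => h.2.not_gt h.1.2.2

/-- The function `d_{[0,b[}`, or `d_{[b,0[}` if `b < 0`. These functions are total in all of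
`L²(ℝ; k)`, where the Lebesgue differentiation theorem applies. -/
def centredStep (p : k × ℝ) : Lp k 2 (volume : Measure ℝ) :=
  indicatorConstLp 2 (measurableSet_Ico (a := min 0 p.2) (b := max 0 p.2))
    measure_Ico_lt_top.ne p.1

theorem centredStep_total [CompleteSpace k] :
    (Submodule.span ℂ (Set.range (centredStep (k := k)))).topologicalClosure = ⊤ := by
  rw [Submodule.topologicalClosure_eq_top_iff, Submodule.eq_bot_iff]
  intro f hf
  have hset : ∀ b : ℝ, ∫ x in Set.Ico (min 0 b) (max 0 b), f x = 0 := by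
    intro b
    refine ext_inner_left ℂ fun d => ?_
    rw [inner_zero_right, ← L2.inner_indicatorConstLp_eq_inner_setIntegral (𝕜 := ℂ)
      measurableSet_Ico measure_Ico_lt_top.ne]
    exact hf _ (Submodule.subset_span ⟨(d, b), rfl⟩)
  have hprimitive : ∀ b : ℝ, ∫ x in (0 : ℝ)..b, f x = 0 := by
    intro b
    rw [intervalIntegral.intervalIntegral_eq_integral_uIoc, Set.uIoc,
      ← integral_Ico_eq_integral_Ioc, hset, smul_zero]
  refine Lp.ext ?_
  filter_upwards [LocallyIntegrable.ae_hasDerivAt_integral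
      ((Lp.memLp f).locallyIntegrable one_le_two),
    Lp.coeFn_zero k 2 (volume : Measure ℝ)] with x hderiv hx0
  have hderiv0 := hderiv 0
  simp only [hprimitive] at hderiv0
  rw [hx0, hderiv0.unique (hasDerivAt_const x 0), Pi.zero_apply]

theorem map_restrict_span_centredStep_le :
    (Submodule.span ℂ (Set.range (centredStep (k := k)))).map
        (L2on.restrict (measurableSet_Ici (a := (0 : ℝ)))) ≤
      (stepSpan k).map (L2on.restrict measurableSet_Ici) := by
  refine (Submodule.map_span_le _ _ _).2 ?_
  rintro _ ⟨⟨d, b⟩, rfl⟩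
  refine ⟨_, Submodule.subset_span ⟨(d, b.toNNReal), rfl⟩,
    L2on.restrict_indicatorConstLp_congr _ _ _ _ _ ?_ d⟩
  ext r
  simp only [Set.mem_inter_iff, Set.mem_Ico, Set.mem_Ici, Real.coe_toNNReal', max_comm b]
  exact ⟨fun h => ⟨⟨(min_le_left 0 b).trans h.2, h.1.2⟩, h.2⟩, fun h => ⟨⟨h.2, h.1.2⟩, h.2⟩⟩

theorem dense_map_restrict_stepSpan [CompleteSpace k] :
    Dense ((stepSpan k).map (L2on.restrict (measurableSet_Ici (a := (0 : ℝ)))) :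
      Set (L2on k (Set.Ici 0))) :=
  ((L2on.restrict_surjective measurableSet_Ici).denseRange.dense_image
    (L2on.continuous_restrict measurableSet_Ici)
    ((Submodule.dense_iff_topologicalClosure_eq_top).2 centredStep_total)).mono
    map_restrict_span_centredStep_le

end StepFunctions

section ExponentialVectors

variable {H K L : Type*} [NormedAddCommGroup H] [InnerProductSpace ℂ H]
  [NormedAddCommGroup K] [InnerProductSpace ℂ K] [NormedAddCommGroup L] [InnerProductSpace ℂ L]

/-- The operator `x ↦ x ⊗ y` on `H`. -/
def hTmulRight (H : Type*) [NormedAddCommGroup H] [InnerProductSpace ℂ H] (y : K) :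
    H →L[ℂ] HilbertTensor H K :=
  HilbertTensor.ofAlg.toContinuousLinearMap.comp ((TensorProduct.mkL ℂ H K).flip y)

theorem continuous_hTmul {X : Type*} [TopologicalSpace X] {u : X → H} {v : X → K}
    (hu : Continuous u) (hv : Continuous v) : Continuous fun x => hTmul (u x) (v x) := by
  have h : Continuous fun x => TensorProduct.mkL ℂ H K (u x) (v x) := by fun_prop
  exact HilbertTensor.ofAlg.continuous.comp h

theorem clm_ext_expVec {f g : Fock K →L[ℂ] L} (h : ∀ u, f (expVec u) = g (expVec u)) : f = g :=
  ContinuousLinearMap.ext_on ((Submodule.dense_iff_topologicalClosure_eq_top).2 expVec_total)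
    (Set.forall_mem_range.2 h)

theorem clm_ext_hTmul_expVec {f g : HilbertTensor (Fock H) (Fock K) →L[ℂ] L}
    (h : ∀ u v, f (hTmul (expVec u) (expVec v)) = g (hTmul (expVec u) (expVec v))) : f = g :=
  ContinuousLinearMap.ext_on
    ((Submodule.dense_iff_topologicalClosure_eq_top).2 (hTmul_total expVec_total expVec_total))
    (Set.forall_mem_range.2 fun p => h p.1 p.2)

theorem norm_expVec_sub_expVec (f g : K) :
    ‖expVec g - expVec f‖ = Real.sqrt (RCLike.re (Complex.exp ⟪g, g⟫_ℂ - Complex.exp ⟪g, f⟫_ℂ -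
      (Complex.exp ⟪f, g⟫_ℂ - Complex.exp ⟪f, f⟫_ℂ))) := by
  rw [@norm_eq_sqrt_re_inner ℂ, inner_sub_left, inner_sub_right, inner_sub_right, inner_expVec,
    inner_expVec, inner_expVec, inner_expVec]

theorem continuous_expVec : Continuous (expVec : K → Fock K) := by
  refine continuous_iff_continuousAt.2 fun f => tendsto_iff_norm_sub_tendsto_zero.2 ?_
  simp only [norm_expVec_sub_expVec]
  refine Continuous.tendsto' (by fun_prop) _ _ ?_
  simp only [sub_self, map_zero, Real.sqrt_zero]

theorem norm_expVec_zero : ‖expVec (0 : K)‖ = 1 := by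
  rw [@norm_eq_sqrt_re_inner ℂ, inner_expVec, inner_zero_left, Complex.exp_zero, RCLike.one_re,
    Real.sqrt_one]

end ExponentialVectors

section Adapted

variable {k : Type*} [NormedAddCommGroup k] [InnerProductSpace ℂ k]

variable (k) in
/-- The embedding `v ↦ v ⊗ ε(0)` of `ℱ_{[0,s[}` in `ℱ`. -/
def fockEmbed (s : ℝ≥0) : Fock (L2on k (Set.Ico 0 (s : ℝ))) →L[ℂ] FockSpace k :=
  (fockSplit k s).toContinuousLinearMap ∘L hTmulRight _ (expVec 0)

theorem fockEmbed_apply (s : ℝ≥0) (v : Fock (L2on k (Set.Ico 0 (s : ℝ)))) :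
    fockEmbed k s v = fockSplit k s (hTmul v (expVec 0)) := rfl

theorem adjoint_fockEmbed_apply (s : ℝ≥0) (v : Fock (L2on k (Set.Ico 0 (s : ℝ)))) :
    ContinuousLinearMap.adjoint (fockEmbed k s) (fockEmbed k s v) = v := by
  refine ext_inner_right ℂ fun w => ?_
  rw [ContinuousLinearMap.adjoint_inner_left, fockEmbed_apply, fockEmbed_apply,
    LinearIsometry.inner_map_map, inner_hTmul, inner_self_eq_norm_sq_to_K, norm_expVec_zero,
    RCLike.ofReal_one, one_pow, mul_one]

/-- The compression of a bounded operator on `ℱ` to `ℱ_{[0,s[}`. -/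
def fockCompress (s : ℝ≥0) (T : FockSpace k →L[ℂ] FockSpace k) :
    Fock (L2on k (Set.Ico 0 (s : ℝ))) →L[ℂ] Fock (L2on k (Set.Ico 0 (s : ℝ))) :=
  ContinuousLinearMap.adjoint (fockEmbed k s) ∘L T ∘L fockEmbed k s

theorem fockSplit_hTmul_expVec (s : ℝ≥0) (f : L2on k (Set.Ico 0 (s : ℝ)))
    (g : L2on k (Set.Ici (s : ℝ))) :
    fockSplit k s (hTmul (expVec f) (expVec g)) = expVec
      (L2on.incl Set.Ico_subset_Ici_self f + L2on.incl (Set.Ici_subset_Ici.2 s.2) g) :=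
  fockJoin_apply _ _ _ f g

theorem fockSplit_expVec_restrict (s : ℝ≥0) (f : Lp k 2 (volume : Measure ℝ)) :
    fockSplit k s (hTmul (expVec (L2on.restrict measurableSet_Ico f))
      (expVec (L2on.restrict measurableSet_Ici f))) =
      expVec (L2on.restrict measurableSet_Ici f) := by
  rw [fockSplit_hTmul_expVec]
  exact congrArg expVec (L2on.incl_restrict_add_incl_restrict _ _ _ _ _ (disjoint_Ico_Ici _)
    (Set.Ico_union_Ici_eq_Ici s.2) f)

theorem fockShift_hTmul_expVec (s : ℝ≥0) (v : Fock (L2on k (Set.Ico 0 (s : ℝ))))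
    (g : L2on k (Set.Ici 0)) :
    fockShift k s (hTmul v (expVec g)) = fockSplit k s (hTmul v (expVec (L2on.shift s g))) := by
  have h : (fockShift k s).toContinuousLinearMap ∘L hTmulRight _ (expVec g) =
      (fockSplit k s).toContinuousLinearMap ∘L hTmulRight _ (expVec (L2on.shift s g)) :=
    clm_ext_expVec fun f => (fockJoin_apply _ _ _ f g).trans
      (fockSplit_hTmul_expVec s f (L2on.shift s g)).symm
  exact DFunLike.congr_fun h v

/-- A bounded operator `T` on `ℱ` is adapted at time `s` if `T ε(f) = Y ε(f_{[0,s[}) ⊗ ε(f_{[s,∞[})`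
for an operator `Y` in `ℱ_{[0,s[}` and all step functions `f`. As in `IsOperatorProcess`, the
operator `Y` is only defined on the exponential domain and need not be bounded. -/
def IsAdaptedAt (s : ℝ≥0) (T : FockSpace k →L[ℂ] FockSpace k) : Prop :=
  ∃ Y : expDomain (k := k) (measurableSet_Ico (a := (0 : ℝ)) (b := (s : ℝ))) →ₗ[ℂ]
      Fock (L2on k (Set.Ico 0 (s : ℝ))),
    ∀ f : stepSpan k, T (expVec (L2on.restrict measurableSet_Ici (f : Lp k 2 volume))) =
      fockSplit k s (hTmul (Y (expDomain.mk k measurableSet_Ico f))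
        (expVec (L2on.restrict measurableSet_Ici (f : Lp k 2 volume))))

namespace IsAdaptedAt

variable {s : ℝ≥0} {T : FockSpace k →L[ℂ] FockSpace k}

theorem apply_expVec_of_mem_stepSpan (hT : IsAdaptedAt s T) {f : Lp k 2 (volume : Measure ℝ)}
    (hf : f ∈ stepSpan k) :
    T (expVec (L2on.restrict measurableSet_Ici f)) =
      fockSplit k s (hTmul (fockCompress s T (expVec (L2on.restrict measurableSet_Ico f)))
        (expVec (L2on.restrict measurableSet_Ici f))) := by
  obtain ⟨Y, hY⟩ := hT
  -- Truncation at time `s` turns `ε(f)` into `ε(f_{[0,s[}) ⊗ ε(0)`, on which `T` determines `Y`.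
  obtain ⟨g, hg, hgf, hg0⟩ := exists_mem_stepSpan_truncation s hf
  have hmk : expDomain.mk k (measurableSet_Ico (a := (0 : ℝ)) (b := (s : ℝ))) ⟨g, hg⟩ =
      expDomain.mk k measurableSet_Ico ⟨f, hf⟩ := Subtype.ext (congrArg expVec hgf)
  have hembed : expVec (L2on.restrict measurableSet_Ici g) =
      fockEmbed k s (expVec (L2on.restrict measurableSet_Ico f)) := by
    rw [← fockSplit_expVec_restrict s g, hg0, hgf, fockEmbed_apply]
  have hYg := hY ⟨g, hg⟩
  rw [hmk, hg0, hembed, ← fockEmbed_apply] at hYg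
  rw [fockCompress, ContinuousLinearMap.comp_apply, ContinuousLinearMap.comp_apply, hYg,
    adjoint_fockEmbed_apply]
  exact hY ⟨f, hf⟩

variable [CompleteSpace k]

theorem apply_expVec (hT : IsAdaptedAt s T) (f : L2on k (Set.Ici 0)) :
    T (expVec f) = fockSplit k s (hTmul
      (fockCompress s T (expVec (L2on.restrict measurableSet_Ico (f : Lp k 2 volume))))
      (expVec (L2on.restrict measurableSet_Ici (f : Lp k 2 volume)))) := by
  have hcont : ∀ {I : Set ℝ} (hI : MeasurableSet I),
      Continuous fun f : L2on k (Set.Ici 0) => expVec (L2on.restrict hI (f : Lp k 2 volume)) :=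
    fun hI => continuous_expVec.comp ((L2on.continuous_restrict hI).comp continuous_subtype_val)
  refine dense_map_restrict_stepSpan.induction (P := fun f => T (expVec f) = fockSplit k s (hTmul
      (fockCompress s T (expVec (L2on.restrict measurableSet_Ico (f : Lp k 2 volume))))
      (expVec (L2on.restrict measurableSet_Ici (f : Lp k 2 volume))))) ?_
    (isClosed_eq (T.continuous.comp continuous_expVec) ((fockSplit k s).continuous.comp
      (continuous_hTmul ((fockCompress s T).continuous.comp (hcont _)) (hcont _)))) f
  rintro _ ⟨g, hg, rfl⟩
  rw [L2on.restrict_restrict _ _ Set.Ico_subset_Ici_self,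
    L2on.restrict_restrict _ _ (Set.Ici_subset_Ici.2 (NNReal.coe_nonneg s))]
  exact hT.apply_expVec_of_mem_stepSpan hg

theorem apply_fockSplit (hT : IsAdaptedAt s T) (f : L2on k (Set.Ico 0 (s : ℝ)))
    (g : L2on k (Set.Ici (s : ℝ))) :
    T (fockSplit k s (hTmul (expVec f) (expVec g))) =
      fockSplit k s (hTmul (fockCompress s T (expVec f)) (expVec g)) := by
  have hf : L2on.restrict (measurableSet_Ico (a := (0 : ℝ)) (b := (s : ℝ)))
      (f + g : Lp k 2 (volume : Measure ℝ)) = f := by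
    rw [map_add, L2on.restrict_eq_self, L2on.restrict_eq_zero _ (disjoint_Ico_Ici _) g.2, add_zero]
  have hg : L2on.restrict (measurableSet_Ici (a := (s : ℝ)))
      (f + g : Lp k 2 (volume : Measure ℝ)) = g := by
    rw [map_add, L2on.restrict_eq_self, L2on.restrict_eq_zero _ (disjoint_Ico_Ici _).symm f.2,
      zero_add]
  rw [fockSplit_hTmul_expVec, hT.apply_expVec]
  exact congrArg₂ (fun u v => fockSplit k s (hTmul (fockCompress s T (expVec u)) (expVec v))) hf hg

theorem comp_fockShift (hT : IsAdaptedAt s T) :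
    T ∘L (fockShift k s).toContinuousLinearMap =
      (fockShift k s).toContinuousLinearMap ∘L
        opTensor (fockCompress s T) (ContinuousLinearMap.id ℂ (FockSpace k)) := by
  refine clm_ext_hTmul_expVec fun f g => ?_
  calc T (fockShift k s (hTmul (expVec f) (expVec g)))
      = T (fockSplit k s (hTmul (expVec f) (expVec (L2on.shift s g)))) := by
        rw [fockShift_hTmul_expVec]
    _ = fockSplit k s (hTmul (fockCompress s T (expVec f)) (expVec (L2on.shift s g))) :=
        hT.apply_fockSplit f _
    _ = fockShift k s (hTmul (fockCompress s T (expVec f)) (expVec g)) :=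
        (fockShift_hTmul_expVec s _ g).symm
    _ = fockShift k s (opTensor (fockCompress s T) (ContinuousLinearMap.id ℂ (FockSpace k))
          (hTmul (expVec f) (expVec g))) := by
        rw [opTensor_hTmul, ContinuousLinearMap.id_apply]

end IsAdaptedAt

theorem opTensor_fockCompress (s : ℝ≥0) (T X : FockSpace k →L[ℂ] FockSpace k) :
    opTensor (fockCompress s T) X = opTensor (ContinuousLinearMap.adjoint (fockEmbed k s))
        (ContinuousLinearMap.id ℂ (FockSpace k)) ∘L
      opTensor T X ∘L opTensor (fockEmbed k s) (ContinuousLinearMap.id ℂ (FockSpace k)) :=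
  clm_ext_hTmul_expVec fun f g => by
    simp only [ContinuousLinearMap.comp_apply, opTensor_hTmul, ContinuousLinearMap.id_apply,
      fockCompress]

variable (k) in
theorem exists_comp_ccrFlow_eq_comp_opTensor [CompleteSpace k] (s : ℝ≥0) :
    ∃ (U : HilbertTensor (FockSpace k) (FockSpace k) →L[ℂ] FockSpace k)
      (V : FockSpace k →L[ℂ] HilbertTensor (FockSpace k) (FockSpace k)),
      ∀ T X, IsAdaptedAt s T → T ∘L ccrFlow s X = U ∘L opTensor T X ∘L V := by
  refine ⟨(fockShift k s).toContinuousLinearMap ∘L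
      opTensor (ContinuousLinearMap.adjoint (fockEmbed k s))
        (ContinuousLinearMap.id ℂ (FockSpace k)),
    opTensor (fockEmbed k s) (ContinuousLinearMap.id ℂ (FockSpace k)) ∘L
      ContinuousLinearMap.adjoint (fockShift k s).toContinuousLinearMap, fun T X hT => ?_⟩
  have hmerge : opTensor (fockCompress s T) (ContinuousLinearMap.id ℂ (FockSpace k)) ∘L
      opTensor (ContinuousLinearMap.id ℂ (Fock (L2on k (Set.Ico 0 (s : ℝ))))) X =
      opTensor (fockCompress s T) X :=
    clm_ext_hTmul_expVec fun f g => by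
      simp only [ContinuousLinearMap.comp_apply, opTensor_hTmul, ContinuousLinearMap.id_apply]
  ext v
  let w := ContinuousLinearMap.adjoint (fockShift k s).toContinuousLinearMap v
  have hshift := DFunLike.congr_fun hT.comp_fockShift
    (opTensor (ContinuousLinearMap.id ℂ (Fock (L2on k (Set.Ico 0 (s : ℝ))))) X w)
  exact hshift.trans (congrArg (fockShift k s)
    (DFunLike.congr_fun (hmerge.trans (opTensor_fockCompress s T X)) w))

end Adapted

section Cocycles

variable {A B H K k : Type*} [CStarAlgebra A] [CStarAlgebra B]
  [NormedAddCommGroup H] [InnerProductSpace ℂ H] [CompleteSpace H]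
  [NormedAddCommGroup K] [InnerProductSpace ℂ K] [CompleteSpace K]
  [NormedAddCommGroup k] [InnerProductSpace ℂ k]

theorem exists_norm_le_of_eq_comp_opTensor_comp {E F G G' : Type*}
    [NormedAddCommGroup E] [InnerProductSpace ℂ E] [CompleteSpace E]
    [NormedAddCommGroup F] [InnerProductSpace ℂ F] [CompleteSpace F]
    [NormedAddCommGroup G] [NormedSpace ℂ G] [NormedAddCommGroup G'] [NormedSpace ℂ G']
    {π : A →⋆ₐ[ℂ] (H →L[ℂ] H)} (hπ : Function.Injective π)
    {ρ : B →⋆ₐ[ℂ] (K →L[ℂ] K)} (hρ : Function.Injective ρ)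
    {φ : A →ₗ[ℂ] (E →L[ℂ] E)} {ψ : B →ₗ[ℂ] (F →L[ℂ] F)}
    (hφ : IsCompletelyBounded φ) (hψ : IsCompletelyBounded ψ)
    (U : HilbertTensor E F →L[ℂ] G') (V : G →L[ℂ] HilbertTensor E F)
    {f : A ⊗[ℂ] B →ₗ[ℂ] (G →L[ℂ] G')}
    (hf : ∀ a b, f (a ⊗ₜ b) = U ∘L opTensor (φ a) (ψ b) ∘L V) :
    ∃ c, ∀ y, ‖f y‖ ≤ c * ‖spatialTensor.ofAlg π ρ y‖ := by
  let σ := StarAlgHom.id ℂ (E →L[ℂ] E)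
  let τ := StarAlgHom.id ℂ (F →L[ℂ] F)
  obtain ⟨c, hc⟩ := hφ.exists_isCompletelyBoundedBy hπ σ
  obtain ⟨d, hd⟩ := hψ.exists_isCompletelyBoundedBy hρ τ
  have hbound := spatialTensor.norm_ofAlg_map_le hc hd
  have hfUV : ∀ y, f y = U ∘L (spatialTensor.ofAlg σ τ (TensorProduct.map φ ψ y) :
      HilbertTensor E F →L[ℂ] HilbertTensor E F) ∘L V := by
    intro y
    induction y using TensorProduct.induction_on with
    | zero => simp
    | add x y hx hy =>
      rw [map_add, hx, hy, map_add, map_add, AddMemClass.coe_add, ContinuousLinearMap.add_comp,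
        ContinuousLinearMap.comp_add]
    | tmul a b => exact hf a b
  refine ⟨‖U‖ * (c * d) * ‖V‖, fun y => ?_⟩
  rw [hfUV]
  calc _ ≤ ‖U‖ * (‖spatialTensor.ofAlg σ τ (TensorProduct.map φ ψ y)‖ * ‖V‖) :=
        (ContinuousLinearMap.opNorm_comp_le _ _).trans (mul_le_mul_of_nonneg_left
          (ContinuousLinearMap.opNorm_comp_le _ _) (norm_nonneg _))
    _ ≤ ‖U‖ * ((c * d * ‖spatialTensor.ofAlg π ρ y‖) * ‖V‖) := by
        gcongr
        exact hbound y
    _ = _ := by ring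

namespace IsCBProcess

variable {l : ℝ≥0 → A →ₗ[ℂ] (FockSpace k →L[ℂ] FockSpace k)}

theorem isAdaptedAt (hl : IsCBProcess l) (s : ℝ≥0) (a : A) : IsAdaptedAt s (l s a) :=
  (hl.isOperatorProcess a).adapted s

theorem comp {l : ℝ≥0 → B →ₗ[ℂ] (FockSpace k →L[ℂ] FockSpace k)} (hl : IsCBProcess l)
    {φ : A →ₗ[ℂ] B} (hφ : IsCompletelyBounded φ) : IsCBProcess fun t => l t ∘ₗ φ where
  isOperatorProcess a := hl.isOperatorProcess (φ a)
  completelyBounded t := (hl.completelyBounded t).comp hφ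

variable [CompleteSpace k] {π : A →⋆ₐ[ℂ] (H →L[ℂ] H)}

theorem incrementTensor_ofAlg_tmul (hl : IsCBProcess l) (hπ : Function.Injective π) (s t : ℝ≥0)
    (a b : A) :
    incrementTensor π l s t (spatialTensor.ofAlg π π (a ⊗ₜ b)) = l s a ∘L ccrFlow s (l t b) := by
  obtain ⟨U, V, hUV⟩ := exists_comp_ccrFlow_eq_comp_opTensor k s
  exact spatialTensor.extend_ofAlg (exists_norm_le_of_eq_comp_opTensor_comp hπ hπ
    (hl.completelyBounded s) (hl.completelyBounded t) U V
    fun a b => hUV (l s a) (l t b) (hl.isAdaptedAt s a)) (a ⊗ₜ b)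

end IsCBProcess

variable {S : StarSubalgebra ℂ A} [hS : IsClosed (S : Set A)] {P : A →L[ℂ] S}
  {π : A →⋆ₐ[ℂ] (H →L[ℂ] H)} {l : ℝ≥0 → S →ₗ[ℂ] (FockSpace k →L[ℂ] FockSpace k)}

theorem isCBProcess_comp_expectation_iff (hP : IsConditionalExpectation S P) :
    IsCBProcess (fun t => l t ∘ₗ P.toLinearMap) ↔ IsCBProcess l := by
  refine ⟨fun h => ?_, fun h => h.comp hP.isCompletelyBounded⟩
  have hl : (fun t => (l t ∘ₗ P.toLinearMap) ∘ₗ S.subtype.toAlgHom.toLinearMap) = l :=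
    funext fun t => LinearMap.ext fun s => congrArg (l t) (hP.proj s)
  exact hl ▸ h.comp (isCompletelyBounded_starAlgHom S.subtype)

variable [CompleteSpace k] (hπ : Function.Injective π) (hP : IsConditionalExpectation S P)

include hπ hP

theorem incrementTensor_comp_expectation (hl : IsCBProcess l) (s t : ℝ≥0)
    (x : spatialTensor π π) :
    incrementTensor π (fun t => l t ∘ₗ P.toLinearMap) s t x =
      incrementTensor (restrictRep S π) l s t (expectationTensor P π x) := by
  have hlP : IsCBProcess fun t => l t ∘ₗ P.toLinearMap := hl.comp hP.isCompletelyBounded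
  have hπS := restrictRep_injective S hπ
  have hclm : incrementTensor π (fun t => l t ∘ₗ P.toLinearMap) s t =
      incrementTensor (restrictRep S π) l s t ∘L expectationTensor P π := by
    refine spatialTensor.clm_ext fun a b => ?_
    rw [hlP.incrementTensor_ofAlg_tmul hπ, ContinuousLinearMap.comp_apply,
      spatialTensor.map_ofAlg_tmul hπ hπ _ _ hP.isCompletelyBounded hP.isCompletelyBounded,
      hl.incrementTensor_ofAlg_tmul hπS]
    rfl
  exact DFunLike.congr_fun hclm x

variable {Δ : A →ₗ[ℂ] spatialTensor π π} {ε : A →⋆ₐ[ℂ] ℂ}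
  (hPΔ : IsCompatibleExpectation S π Δ P)

include hPΔ

theorem hasConvolutionIncrements_comp_expectation_iff (hl : IsCBProcess l) :
    HasConvolutionIncrements π Δ (fun t => l t ∘ₗ P.toLinearMap) ↔
      HasConvolutionIncrements (restrictRep S π) (restrictCoproduct S π Δ P) l := by
  have hincr : ∀ s t a, incrementTensor π (fun t => l t ∘ₗ P.toLinearMap) s t (Δ a) =
      incrementTensor (restrictRep S π) l s t (restrictCoproduct S π Δ P (P a)) := fun s t a => by
    rw [incrementTensor_comp_expectation hπ hP hl, restrictCoproduct_apply_expectation hπ hP hPΔ]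
  refine ⟨fun h s t a => ?_, fun h s t a => (h s t (P a)).trans (hincr s t a).symm⟩
  rw [← hP.proj a]
  exact (h s t a).trans (hincr s t a)

theorem isQSConvolutionCocycle_restrict_iff :
    IsQSConvolutionCocycle (restrictRep S π) (restrictCoproduct S π Δ P) (restrictCounit S ε) l ↔
      IsCBProcess (fun t => l t ∘ₗ P.toLinearMap) ∧
      HasConvolutionIncrements π Δ (fun t => l t ∘ₗ P.toLinearMap) ∧
      ∀ a, l 0 (P a) = ε (P a) • ContinuousLinearMap.id ℂ (FockSpace k) := by
  rw [isCBProcess_comp_expectation_iff hP]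
  constructor
  · rintro ⟨hl, hincr, hinit⟩
    exact ⟨hl, (hasConvolutionIncrements_comp_expectation_iff hπ hP hPΔ hl).2 hincr,
      fun a => hinit (P a)⟩
  · rintro ⟨hl, hincr, hinit⟩
    refine ⟨hl, (hasConvolutionIncrements_comp_expectation_iff hπ hP hPΔ hl).1 hincr, fun a => ?_⟩
    rw [← hP.proj a]
    exact hinit a

end Cocycles

end

/-- Quantum stochastic convolution cocycles on the C⋆-hyperbialgebra `S = P(A)` correspond
bijectively to the `P`-invariant completely bounded processes on `A` with the convolution increment
property and initial condition `ε ∘ P`. -/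
theorem mainTheorem6 {A H k : Type*} [CStarAlgebra A]
    [NormedAddCommGroup H] [InnerProductSpace ℂ H] [CompleteSpace H]
    [NormedAddCommGroup k] [InnerProductSpace ℂ k] [CompleteSpace k]
    (π : A →⋆ₐ[ℂ] (H →L[ℂ] H)) (hπ : Function.Injective π)
    (Δ : A →ₗ[ℂ] spatialTensor π π) (ε : A →⋆ₐ[ℂ] ℂ) (hA : IsCStarHyperbialgebra π Δ ε)
    (S : StarSubalgebra ℂ A) [hS : IsClosed (S : Set A)]
    (P : A →L[ℂ] S) (hP : IsConditionalExpectation S P) (hPΔ : IsCompatibleExpectation S π Δ P) :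
    IsCStarHyperbialgebra (restrictRep S π) (restrictCoproduct S π Δ P) (restrictCounit S ε) ∧
    Set.BijOn
      (fun (l' : ℝ≥0 → S →ₗ[ℂ] (FockSpace k →L[ℂ] FockSpace k)) (t : ℝ≥0) =>
        l' t ∘ₗ P.toLinearMap)
      {l' | IsQSConvolutionCocycle (restrictRep S π) (restrictCoproduct S π Δ P)
        (restrictCounit S ε) l'}
      {l | IsCBProcess l ∧ (∀ (t : ℝ≥0) (a : A), l t (P a) = l t a) ∧
        HasConvolutionIncrements π Δ l ∧
        ∀ a : A, l 0 a = ε (P a) • ContinuousLinearMap.id ℂ (FockSpace k)} ∧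
    Set.InvOn
      (fun (l : ℝ≥0 → A →ₗ[ℂ] (FockSpace k →L[ℂ] FockSpace k)) (t : ℝ≥0) =>
        l t ∘ₗ S.subtype.toAlgHom.toLinearMap)
      (fun (l' : ℝ≥0 → S →ₗ[ℂ] (FockSpace k →L[ℂ] FockSpace k)) (t : ℝ≥0) =>
        l' t ∘ₗ P.toLinearMap)
      {l' | IsQSConvolutionCocycle (restrictRep S π) (restrictCoproduct S π Δ P)
        (restrictCounit S ε) l'}
      {l | IsCBProcess l ∧ (∀ (t : ℝ≥0) (a : A), l t (P a) = l t a) ∧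
        HasConvolutionIncrements π Δ l ∧
        ∀ a : A, l 0 a = ε (P a) • ContinuousLinearMap.id ℂ (FockSpace k)} := by
  refine ⟨isCStarHyperbialgebra_restrict hπ hP hA hPΔ, ?_⟩
  rw [and_comm]
  refine (fun h => ⟨h, h.bijOn ?mapsTo_comp ?mapsTo_restrict⟩)
    ⟨fun l' _ => funext fun t => LinearMap.ext fun s => congrArg (l' t) (hP.proj s), ?rightInvOn⟩
  case rightInvOn =>
    rintro l ⟨-, hinv, -, -⟩
    exact funext fun t => LinearMap.ext (hinv t)
  case mapsTo_comp =>
    intro l' hl'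
    obtain ⟨hcb, hincr, hinit⟩ := (isQSConvolutionCocycle_restrict_iff hπ hP hPΔ).1 hl'
    exact ⟨hcb, fun t a => congrArg (l' t) (hP.proj (P a)), hincr, hinit⟩
  case mapsTo_restrict =>
    rintro l ⟨hcb, hinv, hincr, hinit⟩
    have hl : (fun t => (l t ∘ₗ S.subtype.toAlgHom.toLinearMap) ∘ₗ P.toLinearMap) = l :=
      funext fun t => LinearMap.ext (hinv t)
    refine (isQSConvolutionCocycle_restrict_iff hπ hP hPΔ).2 ?_
    rw [hl]
    exact ⟨hcb, hincr, fun a => (hinv 0 a).trans (hinit a)⟩
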